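/- Let $\mathcal T=[a,b]$ with $-\infty<a<b<\infty$, let $p$ be a positive odd integer, and consider the functional data model $y_i(t)=f_i(t)+\varepsilon_i(t)$, $f_i(t)=\eta(t)+v_i(t)$, $t\in\mathcal T$. Here $v_1,v_2,\dots$ are i.i.d. copies of a second-order stochastic process with mean $0$ and covariance function $\gamma(s,t)$; $\varepsilon_1,\varepsilon_2,\dots$ are i.i.d. copies of a second-order stochastic process with mean $0$ and covariance function $\sigma^2(t)1_{\{s=t\}}$, independent of the $v_i$. For each $n$ one observes $y_{ij}=y_i(t_{ij})$, $j=1,\dots,n_i$, $i=1,\dots,n$ (the deterministic numbers $n_i$ and the random design points $t_{ij}$ may depend on $n$). The subject effects are independent of the design points and the errors $\varepsilon_i(t_{ij})$, and, given the design points, the errors $\varepsilon_i(t_{ij})$ are distributed as the values of the $\varepsilon_i$ at fixed time points. Let $\hat f_i(t)$ be the $p$-order local polynomial kernel (LPK) reconstruction with kernel $K$ and bandwidth $h=h_n>0$, that is, the first entry of $(Z_i^TK_{ih}Z_i)^{-1}Z_i^TK_{ih}\mathbf y_i$, where $\mathbf y_i=(y_{i1},\dots,y_{in_i})^T$, $Z_i$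 has the rows $(1,t_{ij}-t,\dots,(t_{ij}-t)^p)$ and $K_{ih}=\mathrm{diag}\big(K((t_{ij}-t)/h)/h\big)_{j}$ (with $\hat f_i(t)=0$ if $Z_i^TK_{ih}Z_i$ is singular). Put $$\hat\eta(t)=\frac1n\sum_{i=1}^n\hat f_i(t),\qquad \hat\gamma(s,t)=\frac1{n-1}\sum_{i=1}^n\{\hat f_i(s)-\hat\eta(s)\}\{\hat f_i(t)-\hat\eta(t)\},$$ and let $\tilde\eta,\tilde\gamma$ be the "ideal" estimators defined in the same way with $f_i$ in place of $\hat f_i$. Let $J$ be $[a,b]$ with or without either of its end points (derivatives at end points in $J$ are one-sided), and assume the following (Condition A). 1. For each $n$, the $t_{ij}$ are i.i.d. with a probability density $\pi$ on $[a,b]$ that is positive and continuously differentiable on $J$. 2. $\eta$ and (almost surely) each $f_i$ are $p+1$ times continuously differentiable on $J$; the partial derivatives $\partial_s^k\partial_t^l\gamma$, $0\le k,l\le p+1$, exist and are continuous on $J\times J$; $\sigma^2$ is continuous on $J$. 3. $K$ is a bounded symmetric probability density vanishing outside $[-1,1]$. 4. There are constants $C,\delta>0$ with $n_i\ge Cn^\delta$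 for all $i\le n$; and $h\to0$, $n^\delta h\to\infty$ as $n\to\infty$. Assume also that $h$ is of exact order $n^{-\delta/(2p+3)}$, i.e. $c_1n^{-\delta/(2p+3)}\le h\le c_2n^{-\delta/(2p+3)}$ for some $c_1,c_2>0$ and all large $n$. Write $X_n(x)=r_nO_{\mathrm{UP}}(1)$ on a set $S$ if for every $\epsilon>0$ there is $M$ such that, for all large $n$, $P(|X_n(x)|>Mr_n)\le\epsilon$ for all $x\in S$. Then for every compact $S\subseteq J$ (in particular for $S=[a,b]$ if $J=[a,b]$), $$\hat\eta(t)-\tilde\eta(t)=n^{-(p+1)\delta/(2p+3)}O_{\mathrm{UP}}(1)\ \text{ on } S,\qquad \hat\gamma(s,t)-\tilde\gamma(s,t)=n^{-(p+1)\delta/(2p+3)}O_{\mathrm{UP}}(1)\ \text{ on } S\times S.$$ Assume in addition that $\delta>1+1/[2(p+1)]$. Then $\sqrt n\{\hat\eta(t)-\eta(t)\}$, $t\in J$, is asymptotically a Gaussian process with mean $0$ and covariance function $\gamma$, that is, all its finite-dimensional distributions converge weakly to the corresponding centred multivariate normal distributions. If moreover $E\,v_1(t)^4<\infty$ for all $t\in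 J$, then, in the same sense, $\sqrt n\{\hat\gamma(s,t)-\gamma(s,t)\}$, $(s,t)\in J\times J$, is asymptotically a Gaussian process with mean $0$ and covariance function $$\gamma^*\{(s_1,t_1),(s_2,t_2)\}=E\{v_1(s_1)v_1(t_1)v_1(s_2)v_1(t_2)\}-\gamma(s_1,t_1)\gamma(s_2,t_2).$$ Finally, if the subject effect process is Gaussian, then $\gamma^*\{(s_1,t_1),(s_2,t_2)\}=\gamma(s_1,t_2)\gamma(s_2,t_1)+\gamma(s_1,s_2)\gamma(t_1,t_2)$ for all $s_1,t_1,s_2,t_2\in[a,b]$. -/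

import Mathlib

open MeasureTheory ProbabilityTheory Filter Topology Set

noncomputable section

namespace FDA

variable {Ω : Type*} [MeasurableSpace Ω]

/-! ### Stochastic processes and asymptotic notions -/

/-- `X` is a (measurable, second-order) stochastic process on the index set `T` with mean function
`m` and covariance function `Γ`. -/
structure IsSP (P : Measure Ω) (X : ℝ → Ω → ℝ) (T : Set ℝ) (m : ℝ → ℝ) (Γ : ℝ → ℝ → ℝ) : Prop where
  measurable : ∀ t ∈ T, Measurable (X t)
  memLp_two : ∀ t ∈ T, MemLp (X t) 2 P
  mean : ∀ t ∈ T, P[X t] = m t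
  cov : ∀ s ∈ T, ∀ t ∈ T, cov[X s, X t; P] = Γ s t

/-- `X n x = r n * O(1)` in probability as `n → ∞`, uniformly for `x ∈ S`: for every `ε > 0` there
is one constant `M`, valid for all `x ∈ S`, such that eventually `P (|X n x| > M r n) ≤ ε`. -/
def IsBigOUP {ι : Type*} (P : Measure Ω) (X : ℕ → ι → Ω → ℝ) (r : ℕ → ℝ) (S : Set ι) : Prop :=
  ∀ ε : ℝ, 0 < ε → ∃ M : ℝ, ∀ᶠ n in atTop, ∀ x ∈ S,
    P {ω | M * r n < |X n x ω|} ≤ ENNReal.ofReal ε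

/-- `X n` is asymptotically a Gaussian process on the index set `S` with mean function `m` and
covariance function `Γ`: all finite-dimensional distributions converge weakly to the corresponding
(possibly degenerate) multivariate normal distributions. -/
def IsAGP {ι : Type*} (P : Measure Ω) [IsProbabilityMeasure P] (X : ℕ → ι → Ω → ℝ) (S : Set ι)
    (m : ι → ℝ) (Γ : ι → ι → ℝ) : Prop :=
  ∀ (k : ℕ) (x : Fin k → ι), (∀ l, x l ∈ S) →
    (Matrix.of fun l l' => Γ (x l) (x l')).PosSemidef ∧
    TendstoInDistribution (E := EuclideanSpace ℝ (Fin k))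
      (fun n ω => WithLp.toLp 2 fun l => X n (x l) ω) atTop id (fun _ => P)
      (multivariateGaussian (WithLp.toLp 2 fun l => m (x l))
        (Matrix.of fun l l' => Γ (x l) (x l')))

/-- All partial derivatives `∂ₛᵏ ∂ₜˡ γ` with `k, l ≤ m` exist and are continuous on `J × J`
(one-sided derivatives at end points of `J` that belong to `J`). -/
def HasContMixedPartials (m : ℕ) (γ : ℝ → ℝ → ℝ) (J : Set ℝ) : Prop :=
  ∃ G : ℕ → ℕ → ℝ → ℝ → ℝ, G 0 0 = γ ∧
    (∀ k ≤ m, ∀ l ≤ m, ContinuousOn (fun x : ℝ × ℝ => G k l x.1 x.2) (J ×ˢ J)) ∧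
    (∀ k < m, ∀ l ≤ m, ∀ s ∈ J, ∀ t ∈ J,
      HasDerivWithinAt (fun x => G k l x t) (G (k + 1) l s t) J s) ∧
    (∀ k ≤ m, ∀ l < m, ∀ s ∈ J, ∀ t ∈ J,
      HasDerivWithinAt (fun x => G k l s x) (G k (l + 1) s t) J t)

/-! ### Local polynomial kernel smoothing -/

/-- The rescaled kernel `K_h(x) = K(x / h) / h`. -/
def scaledKernel (K : ℝ → ℝ) (h x : ℝ) : ℝ := K (x / h) / h

/-- The design matrix `Z`, whose `j`-th row is `(1, τ j - t, …, (τ j - t) ^ p)`. -/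
def lpkDesign (p : ℕ) {m : ℕ} (τ : Fin m → ℝ) (t : ℝ) : Matrix (Fin m) (Fin (p + 1)) ℝ :=
  Matrix.of fun j r => (τ j - t) ^ (r : ℕ)

/-- The diagonal weight matrix with entries `K_h(τ j - t)`. -/
def lpkWeight (K : ℝ → ℝ) (h : ℝ) {m : ℕ} (τ : Fin m → ℝ) (t : ℝ) : Matrix (Fin m) (Fin m) ℝ :=
  Matrix.diagonal fun j => scaledKernel K h (τ j - t)

open scoped Matrix in
/-- The `p`-order local polynomial kernel smoother at `t`: the first entry of the weighted least
squares solution `(Zᵀ W Z)⁻¹ Zᵀ W y`. If `Zᵀ W Z` is singular, then the value is `0`. -/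
def lpk (p : ℕ) (K : ℝ → ℝ) (h : ℝ) {m : ℕ} (τ y : Fin m → ℝ) (t : ℝ) : ℝ :=
  (((lpkDesign p τ t)ᵀ * lpkWeight K h τ t * lpkDesign p τ t)⁻¹ *ᵥ
    (((lpkDesign p τ t)ᵀ * lpkWeight K h τ t) *ᵥ y)) 0

/-! ### Functional data -/

variable (Ω) in
/-- The ingredients of a functional data model. For every number `n` of subjects, the subjects are
`i < n`; subject `i` is measured at the design points `t n i j`, `j < N n i`. -/
structure FunctionalData where
  /-- left end point of the time interval -/
  a : ℝ
  /-- right end point of the time interval -/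
  b : ℝ
  /-- the population mean function -/
  η : ℝ → ℝ
  /-- the covariance function of the subject effects -/
  γ : ℝ → ℝ → ℝ
  /-- the variance function of the measurement errors -/
  σsq : ℝ → ℝ
  /-- the subject effects -/
  v : ℕ → ℝ → Ω → ℝ
  /-- the measurement error processes -/
  ε : ℕ → ℝ → Ω → ℝ
  /-- the numbers of measurements -/
  N : ℕ → ℕ → ℕ
  /-- the design time points -/
  t : ℕ → ℕ → ℕ → Ω → ℝ

namespace FunctionalData

variable (D : FunctionalData Ω)

/-- The index set of all measurements of the first `n` subjects. -/
abbrev Obs (n : ℕ) : Type := Σ i : Fin n, Fin (D.N n i)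

/-- The time interval `[a, b]`. -/
abbrev T : Set ℝ := Icc D.a D.b

/-- All design time points, for `n` subjects. -/
def design (n : ℕ) (ω : Ω) (q : D.Obs n) : ℝ := D.t n q.1 q.2 ω

/-- All measurement errors `ε_i(t_ij)`, for `n` subjects. -/
def err (n : ℕ) (ω : Ω) (q : D.Obs n) : ℝ := D.ε q.1 (D.t n q.1 q.2 ω) ω

/-- The individual functions. -/
def f (i : ℕ) (s : ℝ) (ω : Ω) : ℝ := D.η s + D.v i s ω

/-- The response processes. -/
def response (i : ℕ) (s : ℝ) (ω : Ω) : ℝ := D.η s + D.v i s ω + D.ε i s ω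

/-- The discrete observations `y_ij = y_i(t_ij)`. -/
def y (n i j : ℕ) (ω : Ω) : ℝ := D.response i (D.t n i j ω) ω

/-- The `p`-order LPK reconstruction of the `i`-th individual function, with bandwidth `h n`. -/
def fHat (p : ℕ) (K : ℝ → ℝ) (h : ℕ → ℝ) (n i : ℕ) (s : ℝ) (ω : Ω) : ℝ :=
  lpk p K (h n) (fun j : Fin (D.N n i) => D.t n i j ω) (fun j : Fin (D.N n i) => D.y n i j ω) s

/-- The mean estimator based on the reconstructions. -/
def etaHat (p : ℕ) (K : ℝ → ℝ) (h : ℕ → ℝ) (n : ℕ) (s : ℝ) (ω : Ω) : ℝ :=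
  (n : ℝ)⁻¹ * ∑ i ∈ Finset.range n, D.fHat p K h n i s ω

/-- The covariance estimator based on the reconstructions. -/
def gammaHat (p : ℕ) (K : ℝ → ℝ) (h : ℕ → ℝ) (n : ℕ) (x : ℝ × ℝ) (ω : Ω) : ℝ :=
  ((n : ℝ) - 1)⁻¹ * ∑ i ∈ Finset.range n,
    (D.fHat p K h n i x.1 ω - D.etaHat p K h n x.1 ω) *
      (D.fHat p K h n i x.2 ω - D.etaHat p K h n x.2 ω)

/-- The sample mean of the true individual functions. -/
def etaTilde (n : ℕ) (s : ℝ) (ω : Ω) : ℝ :=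
  (n : ℝ)⁻¹ * ∑ i ∈ Finset.range n, D.f i s ω

/-- The sample covariance of the true individual functions. -/
def gammaTilde (n : ℕ) (x : ℝ × ℝ) (ω : Ω) : ℝ :=
  ((n : ℝ) - 1)⁻¹ * ∑ i ∈ Finset.range n,
    (D.f i x.1 ω - D.etaTilde n x.1 ω) * (D.f i x.2 ω - D.etaTilde n x.2 ω)

/-- The limiting covariance function of the covariance estimator (subject `0` is the first one). -/
def gammaStar (P : Measure Ω) (x x' : ℝ × ℝ) : ℝ :=
  P[fun ω => D.v 0 x.1 ω * D.v 0 x.2 ω * D.v 0 x'.1 ω * D.v 0 x'.2 ω]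
    - D.γ x.1 x.2 * D.γ x'.1 x'.2

/-- The standing model: the subject effects are i.i.d. copies of a process `SP(0, γ)`, the
measurement errors are i.i.d. copies of a process `SP(0, σ²(t) 1_{s = t})`, the two families are
independent, and the design is not informative: the subject effects are independent of the design
points and errors, and, given the design points `d`, the errors `ε_i(t_ij)` are distributed as the
values of the error processes at the fixed times `d`. -/
structure IsModel (P : Measure Ω) [IsFiniteMeasure P] : Prop where
  lt : D.a < D.b
  v_sp : ∀ i, IsSP P (D.v i) D.T (fun _ => 0) D.γ
  v_indep : iIndepFun (fun i ω (s : D.T) => D.v i s ω) P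
  v_ident : ∀ i, IdentDistrib (fun ω (s : D.T) => D.v i s ω) (fun ω (s : D.T) => D.v 0 s ω) P P
  ε_sp : ∀ i, IsSP P (D.ε i) D.T (fun _ => 0) (fun s t => if s = t then D.σsq t else 0)
  ε_indep : iIndepFun (fun i ω (s : D.T) => D.ε i s ω) P
  ε_ident : ∀ i, IdentDistrib (fun ω (s : D.T) => D.ε i s ω) (fun ω (s : D.T) => D.ε 0 s ω) P P
  v_indep_ε : IndepFun (fun ω (i : ℕ) (s : D.T) => D.v i s ω)
    (fun ω (i : ℕ) (s : D.T) => D.ε i s ω) P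
  design_measurable : ∀ n, Measurable (D.design n)
  err_measurable : ∀ n, Measurable (D.err n)
  v_indep_design : ∀ n, IndepFun (fun ω (i : ℕ) (s : D.T) => D.v i s ω)
    (fun ω => (D.design n ω, D.err n ω)) P
  err_given_design : ∀ n, ∀ᵐ d ∂(P.map (D.design n)),
    condDistrib (D.err n) (D.design n) P d = P.map (fun ω (q : D.Obs n) => D.ε q.1 (d q) ω)

/-- The regularity conditions, for order `p`, kernel `K`, bandwidths `h`, design density `π` and
exponent `δ`; the smoothness requirements are imposed on the set `J`, which is `[a, b]` with or
without its end points. -/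
structure ConditionA (P : Measure Ω) (p : ℕ) (K : ℝ → ℝ) (h : ℕ → ℝ) (π : ℝ → ℝ) (δ : ℝ)
    (J : Set ℝ) : Prop where
  design_indep : ∀ n, iIndepFun (fun (q : D.Obs n) ω => D.design n ω q) P
  design_law : ∀ n (q : D.Obs n), P.map (fun ω => D.design n ω q) =
    (volume.restrict D.T).withDensity (fun x => ENNReal.ofReal (π x))
  π_pos : ∀ x ∈ J, 0 < π x
  π_smooth : ContDiffOn ℝ 1 π J
  η_smooth : ContDiffOn ℝ ((p + 1 : ℕ) : WithTop ℕ∞) D.η J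
  f_smooth : ∀ i, ∀ᵐ ω ∂P, ContDiffOn ℝ ((p + 1 : ℕ) : WithTop ℕ∞) (fun s => D.f i s ω) J
  γ_smooth : HasContMixedPartials (p + 1) D.γ J
  σsq_cont : ContinuousOn D.σsq J
  K_measurable : Measurable K
  K_nonneg : ∀ x, 0 ≤ K x
  K_bounded : ∃ B, ∀ x, K x ≤ B
  K_symm : ∀ x, K (-x) = K x
  K_support : ∀ x, 1 < |x| → K x = 0
  K_integral : ∫ x, K x = 1
  δ_pos : 0 < δ
  N_lower : ∃ C : ℝ, 0 < C ∧ ∀ n : ℕ, ∀ i < n, C * (n : ℝ) ^ δ ≤ D.N n i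
  h_pos : ∀ n, 0 < h n
  h_zero : Tendsto h atTop (𝓝 0)
  h_rate : Tendsto (fun n : ℕ => (n : ℝ) ^ δ * h n) atTop atTop

end FunctionalData

end FDA

end

/-! Everything reduces to one quantity, the average over the subjects of the squared reconstruction
errors at a point `t` (`meanSqError`). By Cauchy–Schwarz its square root bounds the difference of
the two mean estimators. Together with the boundedness in probability of the mean square of the true
functions, it also bounds the difference of the two covariance estimators, because the sample
covariance is bilinear.

For one subject, call a design good if its rescaled Gram matrix is bounded below by a multiple of `N
h` (`DesignBound`). On a good design the smoother reproduces polynomials of degree at most `p`, and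
its squared value is at most a constant times `(N h)⁻¹ ∑ K y²`. The individual function is replaced
by its Lagrange interpolant, a polynomial through nodes near `t` with first node `t`. The
reconstruction error is then the smoothed interpolation error plus the smoothed noise. The
interpolation error is a linear functional that annihilates polynomials of degree at most `p`. Its
second moment is a squared functional of `η` plus a quadratic form in `γ`, so Taylor expansion of
these two deterministic functions gives the order `h ^ (2 (p + 1))`, and no moments of the
derivatives of the random paths are needed. Given the design, the noise has variance of order `(N
h)⁻¹`. The prescribed bandwidth makes both terms of the order of the squared rate.

Good designs are overwhelmingly likely. The moments of the kernel over `[0, 1]` form a positive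
definite matrix, the empirical one-sided moments concentrate by Hoeffding's inequality, and `n`
times the resulting exponential bound tends to zero. One-sided moments suffice because half a window
always fits on one side of `t`, so end points of `J` need no separate treatment. All constants
depend only on a compact subinterval of `J`, which makes the rates uniform.

The condition on `δ` says exactly that `√n` times the rate vanishes. The estimators then share the
limit of the ideal ones, which are normalized i.i.d. sums up to a negligible remainder. Cramér–Wold,
the one-dimensional central limit theorem and Slutsky's lemma finish (`isAGP_of_iid`). In the
Gaussian case the fourth moments follow by polarization from those of one-dimensional normal laws.
-/

noncomputable section

namespace FDA

/-! ### Weighted least squares -/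

section WLS

open scoped Matrix

variable {p m : ℕ} {K : ℝ → ℝ} {h c t : ℝ} {τ : Fin m → ℝ}

/-- The rescaled Gram matrix of the local polynomial design is bounded below by `c`. -/
def DesignBound (p : ℕ) (K : ℝ → ℝ) (h c : ℝ) {m : ℕ} (τ : Fin m → ℝ) (t : ℝ) : Prop :=
  ∀ β : Fin (p + 1) → ℝ, c * ∑ k, β k ^ 2 ≤
    ∑ j, K ((τ j - t) / h) * (∑ k : Fin (p + 1), β k * ((τ j - t) / h) ^ (k : ℕ)) ^ 2

/-- The Gram matrix of the local polynomial design. -/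
def lpkGram (p : ℕ) (K : ℝ → ℝ) (h : ℝ) {m : ℕ} (τ : Fin m → ℝ) (t : ℝ) :
    Matrix (Fin (p + 1)) (Fin (p + 1)) ℝ :=
  (lpkDesign p τ t)ᵀ * lpkWeight K h τ t * lpkDesign p τ t

/-- The weights of the local polynomial kernel smoother, as a linear function of the responses. -/
def lpkCoef (p : ℕ) (K : ℝ → ℝ) (h : ℝ) {m : ℕ} (τ : Fin m → ℝ) (t : ℝ) (j : Fin m) : ℝ :=
  ((lpkGram p K h τ t)⁻¹ * ((lpkDesign p τ t)ᵀ * lpkWeight K h τ t)) 0 j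

lemma lpk_eq_sum (p : ℕ) (K : ℝ → ℝ) (h : ℝ) (τ y : Fin m → ℝ) (t : ℝ) :
    lpk p K h τ y t = ∑ j, lpkCoef p K h τ t j * y j := by
  rw [lpk, Matrix.mulVec_mulVec]
  rfl

lemma dotProduct_lpkDesign_mulVec (v : Fin (p + 1) → ℝ) (y : Fin m → ℝ) :
    v ⬝ᵥ (((lpkDesign p τ t)ᵀ * lpkWeight K h τ t) *ᵥ y) =
      ∑ j, scaledKernel K h (τ j - t) * (lpkDesign p τ t *ᵥ v) j * y j := by
  rw [← Matrix.mulVec_mulVec, Matrix.dotProduct_mulVec, Matrix.vecMul_transpose, dotProduct]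
  refine Finset.sum_congr rfl fun j _ => ?_
  rw [lpkWeight, Matrix.mulVec_diagonal]
  ring

lemma lpkDesign_mulVec_apply (hh : 0 < h) (v : Fin (p + 1) → ℝ) (j : Fin m) :
    (lpkDesign p τ t *ᵥ v) j =
      ∑ k : Fin (p + 1), (v k * h ^ (k : ℕ)) * ((τ j - t) / h) ^ (k : ℕ) := by
  simp only [lpkDesign, Matrix.mulVec, dotProduct, Matrix.of_apply]
  refine Finset.sum_congr rfl fun k _ => ?_
  rw [div_pow]
  field_simp

/-- The substitution `β k = v k * h ^ k` passes from powers of `τ j - t` to powers of `(τ j - t) /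
h`; the factor `h` undoes the normalization of `scaledKernel`. -/
lemma DesignBound.le_sum (H : DesignBound p K h c τ t) (hh : 0 < h) (v : Fin (p + 1) → ℝ) :
    c * ∑ k : Fin (p + 1), (v k * h ^ (k : ℕ)) ^ 2 ≤
      h * ∑ j, scaledKernel K h (τ j - t) * (lpkDesign p τ t *ᵥ v) j ^ 2 := by
  refine (H fun k => v k * h ^ (k : ℕ)).trans_eq ?_
  rw [Finset.mul_sum]
  refine Finset.sum_congr rfl fun j _ => ?_
  rw [lpkDesign_mulVec_apply hh, scaledKernel]
  field_simp

/-- A null vector of the Gram matrix has vanishing quadratic form, and the lower bound then forces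
all its coordinates to vanish. -/
lemma DesignBound.isUnit_det (H : DesignBound p K h c τ t) (hh : 0 < h) (hc : 0 < c) :
    IsUnit (lpkGram p K h τ t).det := by
  rw [isUnit_iff_ne_zero]
  intro h0
  obtain ⟨v, hv, hv0⟩ := Matrix.exists_mulVec_eq_zero_iff.2 h0
  have h1 := H.le_sum hh v
  have h2 : ∑ j, scaledKernel K h (τ j - t) * (lpkDesign p τ t *ᵥ v) j ^ 2 = 0 := by
    have h3 : v ⬝ᵥ (lpkGram p K h τ t *ᵥ v) = 0 := by rw [hv0, dotProduct_zero]
    rw [lpkGram, ← Matrix.mulVec_mulVec, dotProduct_lpkDesign_mulVec] at h3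
    rw [← h3]
    exact Finset.sum_congr rfl fun j _ => by ring
  rw [h2, mul_zero] at h1
  apply hv
  funext k
  have h4 : ∑ k : Fin (p + 1), (v k * h ^ (k : ℕ)) ^ 2 ≤ 0 := by
    by_contra! h5
    nlinarith [mul_pos hc h5]
  have h5 := (Finset.sum_eq_zero_iff_of_nonneg (fun k _ => sq_nonneg _)).1
    (le_antisymm h4 (Finset.sum_nonneg fun k _ => sq_nonneg _)) k (Finset.mem_univ k)
  have : h ^ (k : ℕ) ≠ 0 := by positivity
  simpa [this] using h5

lemma DesignBound.lpk_mulVec (H : DesignBound p K h c τ t) (hh : 0 < h) (hc : 0 < c)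
    (v : Fin (p + 1) → ℝ) : lpk p K h τ (lpkDesign p τ t *ᵥ v) t = v 0 := by
  rw [lpk, Matrix.mulVec_mulVec (M := (lpkDesign p τ t)ᵀ * lpkWeight K h τ t),
    Matrix.mulVec_mulVec, ← lpkGram, Matrix.nonsing_inv_mul _ (H.isUnit_det hh hc),
    Matrix.one_mulVec]

/-- Local polynomial smoothers reproduce polynomials. -/
lemma DesignBound.lpk_sum_pow (H : DesignBound p K h c τ t) (hh : 0 < h) (hc : 0 < c)
    (v : Fin (p + 1) → ℝ) :
    lpk p K h τ (fun j => ∑ k : Fin (p + 1), v k * (τ j - t) ^ (k : ℕ)) t = v 0 := by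
  rw [← H.lpk_mulVec hh hc v]
  congr 1
  funext j
  simp only [lpkDesign, Matrix.mulVec, dotProduct, Matrix.of_apply]
  exact Finset.sum_congr rfl fun k _ => mul_comm _ _

/-- The basic bound for weighted least squares. -/
lemma DesignBound.lpk_sq_le (H : DesignBound p K h c τ t) (hh : 0 < h) (hc : 0 < c)
    (hK : ∀ x, 0 ≤ K x) (y : Fin m → ℝ) :
    lpk p K h τ y t ^ 2 ≤ c⁻¹ * ∑ j, K ((τ j - t) / h) * y j ^ 2 := by
  set b := (lpkGram p K h τ t)⁻¹ *ᵥ (((lpkDesign p τ t)ᵀ * lpkWeight K h τ t) *ᵥ y) with hb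
  have hb0 : lpk p K h τ y t = b 0 := rfl
  have hGb : lpkGram p K h τ t *ᵥ b = ((lpkDesign p τ t)ᵀ * lpkWeight K h τ t) *ᵥ y := by
    rw [hb, Matrix.mulVec_mulVec, Matrix.mul_nonsing_inv _ (H.isUnit_det hh hc),
      Matrix.one_mulVec]
  have hW : ∀ j, 0 ≤ scaledKernel K h (τ j - t) := fun j => div_nonneg (hK _) hh.le
  set z := lpkDesign p τ t *ᵥ b with hz
  -- The normal equations tested against `b`: the fitted vector `z` is the weighted orthogonal
  -- projection of `y`, so its weighted norm is at most that of `y`.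
  have h1 : ∑ j, scaledKernel K h (τ j - t) * z j * z j =
      ∑ j, scaledKernel K h (τ j - t) * z j * y j := by
    rw [← dotProduct_lpkDesign_mulVec, ← dotProduct_lpkDesign_mulVec, ← hGb, hz,
      Matrix.mulVec_mulVec, lpkGram]
  have h2 : ∑ j, scaledKernel K h (τ j - t) * z j ^ 2 ≤
      ∑ j, scaledKernel K h (τ j - t) * y j ^ 2 := by
    have h3 : ∑ j, scaledKernel K h (τ j - t) * (z j - y j) ^ 2 =
        ∑ j, scaledKernel K h (τ j - t) * z j * z j
          - 2 * ∑ j, scaledKernel K h (τ j - t) * z j * y j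
          + ∑ j, scaledKernel K h (τ j - t) * y j ^ 2 := by
      rw [Finset.mul_sum, ← Finset.sum_sub_distrib, ← Finset.sum_add_distrib]
      exact Finset.sum_congr rfl fun j _ => by ring
    have h4 : 0 ≤ ∑ j, scaledKernel K h (τ j - t) * (z j - y j) ^ 2 :=
      Finset.sum_nonneg fun j _ => mul_nonneg (hW j) (sq_nonneg _)
    have h5 : ∑ j, scaledKernel K h (τ j - t) * z j ^ 2 =
        ∑ j, scaledKernel K h (τ j - t) * z j * z j :=
      Finset.sum_congr rfl fun j _ => by ring
    linarith
  have h3 := H.le_sum hh b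
  have h4 : b 0 ^ 2 ≤ ∑ k : Fin (p + 1), (b k * h ^ (k : ℕ)) ^ 2 := by
    have := Finset.single_le_sum (f := fun k : Fin (p + 1) => (b k * h ^ (k : ℕ)) ^ 2)
      (fun k _ => sq_nonneg _) (Finset.mem_univ 0)
    simpa using this
  have h5 : h * ∑ j, scaledKernel K h (τ j - t) * y j ^ 2 =
      ∑ j, K ((τ j - t) / h) * y j ^ 2 := by
    rw [Finset.mul_sum]
    refine Finset.sum_congr rfl fun j _ => ?_
    rw [scaledKernel]
    field_simp
  rw [hb0, ← h5, inv_mul_eq_div, le_div_iff₀ hc]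
  nlinarith [mul_le_mul_of_nonneg_left h4 hc.le, mul_le_mul_of_nonneg_left h2 hh.le]

/-- A duality argument: the smoother applied to its own weight vector returns the sum `s` of squared
weights, so the least squares bound reads `s ^ 2 ≤ c⁻¹ * B * s`. This controls the variance of the
smoothed noise. -/
lemma DesignBound.sum_lpkCoef_sq_le (H : DesignBound p K h c τ t) (hh : 0 < h) (hc : 0 < c)
    (hK : ∀ x, 0 ≤ K x) {B : ℝ} (hB : ∀ x, K x ≤ B) :
    ∑ j, lpkCoef p K h τ t j ^ 2 ≤ c⁻¹ * B := by
  have h1 := H.lpk_sq_le hh hc hK (lpkCoef p K h τ t)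
  rw [lpk_eq_sum] at h1
  set s := ∑ j, lpkCoef p K h τ t j ^ 2 with hs
  have h2 : ∑ j, lpkCoef p K h τ t j * lpkCoef p K h τ t j = s :=
    Finset.sum_congr rfl fun j _ => by ring
  have h3 : ∑ j, K ((τ j - t) / h) * lpkCoef p K h τ t j ^ 2 ≤ B * s := by
    rw [hs, Finset.mul_sum]
    exact Finset.sum_le_sum fun j _ => mul_le_mul_of_nonneg_right (hB _) (sq_nonneg _)
  rw [h2] at h1
  have hs0 : 0 ≤ s := Finset.sum_nonneg fun j _ => sq_nonneg _
  have hB0 : 0 ≤ B := (hK 0).trans (hB 0)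
  have hc' : 0 < c⁻¹ := inv_pos.2 hc
  have h4 : s ^ 2 ≤ (c⁻¹ * B) * s := by
    nlinarith [mul_le_mul_of_nonneg_left h3 hc'.le]
  rcases hs0.eq_or_lt with h0 | h0
  · rw [← h0]; positivity
  · nlinarith

lemma lpk_add (y z : Fin m → ℝ) :
    lpk p K h τ (fun j => y j + z j) t = lpk p K h τ y t + lpk p K h τ z t := by
  simp only [lpk_eq_sum, mul_add, Finset.sum_add_distrib]

lemma lpk_sub (y z : Fin m → ℝ) :
    lpk p K h τ (fun j => y j - z j) t = lpk p K h τ y t - lpk p K h τ z t := by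
  simp only [lpk_eq_sum, mul_sub, Finset.sum_sub_distrib]

/-- The inverse is the inverted determinant times the adjugate. This also covers singular matrices,
where inversion of zero in `ℝ` gives zero. -/
lemma measurable_lpkCoef (hK : Measurable K) (j : Fin m) :
    Measurable fun τ : Fin m → ℝ => lpkCoef p K h τ t j := by
  have hD : ∀ j r, Measurable fun τ : Fin m → ℝ => lpkDesign p τ t j r := by
    intro j r
    simp only [lpkDesign, Matrix.of_apply]
    fun_prop
  have hDW : ∀ r j, Measurable fun τ : Fin m → ℝ =>
      ((lpkDesign p τ t)ᵀ * lpkWeight K h τ t) r j := by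
    intro r j
    simp only [lpkWeight, Matrix.mul_diagonal, Matrix.transpose_apply, scaledKernel]
    have := hD j r
    fun_prop
  have hG : ∀ r s, Measurable fun τ : Fin m → ℝ => lpkGram p K h τ t r s := by
    intro r s
    have e : (fun τ : Fin m → ℝ => lpkGram p K h τ t r s) = fun τ =>
        ∑ j, ((lpkDesign p τ t)ᵀ * lpkWeight K h τ t) r j * lpkDesign p τ t j s :=
      funext fun τ => Matrix.mul_apply
    rw [e]
    exact Finset.measurable_fun_sum _ fun j _ => (hDW r j).mul (hD j s)
  have hdet : ∀ M : (Fin m → ℝ) → Matrix (Fin (p + 1)) (Fin (p + 1)) ℝ,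
      (∀ r s, Measurable fun τ => M τ r s) → Measurable fun τ => (M τ).det := by
    intro M hM
    simp only [Matrix.det_apply]
    exact Finset.measurable_fun_sum _ fun σ _ =>
      (Finset.measurable_fun_prod _ fun i _ => hM _ _).const_smul _
  have hinv : ∀ r s, Measurable fun τ : Fin m → ℝ => (lpkGram p K h τ t)⁻¹ r s := by
    intro r s
    simp only [Matrix.inv_def, Matrix.smul_apply, smul_eq_mul, Ring.inverse_eq_inv',
      Matrix.adjugate_apply]
    refine (hdet _ hG).inv.mul (hdet _ fun a b => ?_)
    by_cases hab : a = s
    · subst hab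
      simp only [Matrix.updateRow_self]
      exact measurable_const
    · simp only [Matrix.updateRow_ne hab]
      exact hG a b
  simp only [lpkCoef, Matrix.mul_apply (M := (lpkGram p K h _ t)⁻¹)]
  exact Finset.measurable_fun_sum _ fun r _ => (hinv 0 r).mul (hDW r j)

end WLS

/-! ### Interpolation -/

section Interpolation

variable {I : Set ℝ} {t : ℝ}

/-- Induction on `m`: a polynomial approximation of the derivative is integrated from `t`, and the
mean value inequality on the segment from `t` to `x` gains one factor `|x - t|`. The factorial is
dropped, since only the order matters, and derivatives within `I` allow end points. -/
lemma exists_taylor_bound (hI : Convex ℝ I) (ht : t ∈ I) {M : ℝ} (m : ℕ) :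
    ∀ f : ℕ → ℝ → ℝ, (∀ k < m, ∀ x ∈ I, HasDerivWithinAt (f k) (f (k + 1) x) I x) →
      (∀ x ∈ I, |f m x| ≤ M) →
      ∃ c : ℕ → ℝ, ∀ x ∈ I,
        |f 0 x - ∑ k ∈ Finset.range m, c k * (x - t) ^ k| ≤ M * |x - t| ^ m := by
  induction m with
  | zero =>
    intro f _ hM
    exact ⟨fun _ => 0, fun x hx => by simpa using hM x hx⟩
  | succ m ih =>
    intro f hf hM
    obtain ⟨c, hc⟩ := ih (fun k => f (k + 1)) (fun k hk => hf (k + 1) (by omega)) hM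
    -- The antiderivative of the polynomial with coefficients `c` that takes the value `f 0 t` at
    -- `t`.
    let c' : ℕ → ℝ := fun k => if k = 0 then f 0 t else c (k - 1) / k
    refine ⟨c', fun x hx => ?_⟩
    let g : ℝ → ℝ := fun y => f 0 y - ∑ k ∈ Finset.range (m + 1), c' k * (y - t) ^ k
    let g' : ℝ → ℝ := fun y => f 1 y - ∑ k ∈ Finset.range m, c k * (y - t) ^ k
    have hsub : uIcc t x ⊆ I := by
      rw [← segment_eq_uIcc]; exact hI.segment_subset ht hx
    have hg : ∀ y ∈ uIcc t x, HasDerivWithinAt g (g' y) (uIcc t x) y := by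
      intro y hy
      refine ((hf 0 (by omega) y (hsub hy)).mono hsub).sub ?_
      have : ∀ k ∈ Finset.range (m + 1), HasDerivWithinAt (fun z => c' k * (z - t) ^ k)
          (c' k * (k * (y - t) ^ (k - 1))) (uIcc t x) y := by
        intro k _
        have := (((hasDerivAt_id y).sub_const t).pow k).const_mul (c' k)
        simpa using this.hasDerivWithinAt
      have h2 := HasDerivWithinAt.fun_sum this
      convert h2 using 1
      rw [Finset.sum_range_succ']
      simp only [Nat.cast_add, Nat.cast_one, add_tsub_cancel_right, Nat.cast_zero, zero_mul,
        mul_zero, add_zero]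
      refine Finset.sum_congr rfl fun k _ => ?_
      have : (k : ℝ) + 1 ≠ 0 := by positivity
      simp only [c', Nat.add_eq_zero_iff, one_ne_zero, and_false, if_false, Nat.cast_add,
        Nat.cast_one, add_tsub_cancel_right]
      field_simp
    have hM0 : 0 ≤ M := (abs_nonneg _).trans (hM t ht)
    have hb : ∀ y ∈ uIcc t x, ‖g' y‖ ≤ M * |x - t| ^ m := by
      intro y hy
      refine (hc y (hsub hy)).trans ?_
      have := abs_sub_left_of_mem_uIcc hy
      gcongr
    have h3 := (convex_uIcc t x).norm_image_sub_le_of_norm_hasDerivWithin_le hg hb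
      left_mem_uIcc right_mem_uIcc
    have h4 : g t = 0 := by
      simp only [g, Finset.sum_range_succ', c']
      simp
    rw [h4, sub_zero, Real.norm_eq_abs, Real.norm_eq_abs] at h3
    rw [pow_succ, ← mul_assoc]
    exact h3

variable {ι : Type*} [Fintype ι]

/-- A linear functional that annihilates polynomials of degree less than `m` is small on smooth
functions. -/
lemma abs_sum_mul_le_of_annihilates (hI : Convex ℝ I) (ht : t ∈ I) {M h Λ : ℝ} (hh : 0 ≤ h) {m : ℕ}
    {f : ℕ → ℝ → ℝ} (hf : ∀ k < m, ∀ x ∈ I, HasDerivWithinAt (f k) (f (k + 1) x) I x)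
    (hM : ∀ x ∈ I, |f m x| ≤ M) {w y : ι → ℝ} (hy : ∀ i, y i ∈ I) (hyt : ∀ i, |y i - t| ≤ h)
    (hw : ∀ k < m, ∑ i, w i * (y i - t) ^ k = 0) (hΛ : ∑ i, |w i| ≤ Λ) :
    |∑ i, w i * f 0 (y i)| ≤ Λ * M * h ^ m := by
  obtain ⟨c, hc⟩ := exists_taylor_bound hI ht m f hf hM
  have hM0 : 0 ≤ M := (abs_nonneg _).trans (hM t ht)
  have h1 : ∑ i, w i * f 0 (y i) =
      ∑ i, w i * (f 0 (y i) - ∑ k ∈ Finset.range m, c k * (y i - t) ^ k) := by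
    have : ∑ i, w i * ∑ k ∈ Finset.range m, c k * (y i - t) ^ k = 0 := by
      simp only [Finset.mul_sum]
      rw [Finset.sum_comm]
      refine Finset.sum_eq_zero fun k hk => ?_
      rw [← mul_zero (c k), ← hw k (Finset.mem_range.1 hk), Finset.mul_sum]
      exact Finset.sum_congr rfl fun i _ => by ring
    simp only [mul_sub, Finset.sum_sub_distrib, this, sub_zero]
  rw [h1]
  calc _ ≤ ∑ i, |w i| * (M * h ^ m) := by
        refine (Finset.abs_sum_le_sum_abs _ _).trans (Finset.sum_le_sum fun i _ => ?_)
        rw [abs_mul]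
        refine mul_le_mul_of_nonneg_left ((hc _ (hy i)).trans ?_) (abs_nonneg _)
        have := hyt i
        gcongr
    _ ≤ Λ * (M * h ^ m) := by
        rw [← Finset.sum_mul]
        gcongr
    _ = _ := by ring

/-- The one-variable bound is used twice: in the second variable it bounds the `m`-th derivative of
the partially applied functional, and in the first variable it then gives the second factor `h ^ m`.
With `G 0 0 = γ` the double sum is a variance. -/
lemma abs_sum_sum_mul_le_of_annihilates (hI : Convex ℝ I) (ht : t ∈ I) {M h Λ : ℝ} (hh : 0 ≤ h)
    {m : ℕ} {G : ℕ → ℕ → ℝ → ℝ → ℝ}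
    (hG₁ : ∀ k < m, ∀ l ≤ m, ∀ x ∈ I, ∀ y ∈ I,
      HasDerivWithinAt (fun z => G k l z y) (G (k + 1) l x y) I x)
    (hG₂ : ∀ k ≤ m, ∀ l < m, ∀ x ∈ I, ∀ y ∈ I,
      HasDerivWithinAt (fun z => G k l x z) (G k (l + 1) x y) I y)
    (hM : ∀ x ∈ I, ∀ y ∈ I, |G m m x y| ≤ M) {w y : ι → ℝ} (hy : ∀ i, y i ∈ I)
    (hyt : ∀ i, |y i - t| ≤ h)
    (hw : ∀ k < m, ∑ i, w i * (y i - t) ^ k = 0) (hΛ : ∑ i, |w i| ≤ Λ) :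
    |∑ i, w i * ∑ j, w j * G 0 0 (y i) (y j)| ≤ Λ ^ 2 * M * (h ^ m) ^ 2 := by
  have h1 := abs_sum_mul_le_of_annihilates (M := Λ * M * h ^ m) hI ht hh
    (f := fun k x => ∑ j, w j * G k 0 x (y j))
    (fun k hk x hx => HasDerivWithinAt.fun_sum fun j _ =>
      (hG₁ k hk 0 (Nat.zero_le _) x hx (y j) (hy j)).const_mul _)
    (fun x hx => abs_sum_mul_le_of_annihilates hI ht hh (f := fun l z => G m l x z)
      (fun l hl z hz => hG₂ m le_rfl l hl x hx z hz) (fun z hz => hM x hx z hz) hy hyt hw hΛ)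
    hy hyt hw hΛ
  refine h1.trans_eq ?_
  ring

end Interpolation

/-- The Lagrange interpolation scheme with equidistant nodes in `[t, t + h]` or `[t - h, t]`. -/
lemma exists_interpolation (p : ℕ) (t : ℝ) {h d : ℝ} (hh : 0 < h) (hd : |d| = 1) :
    ∃ (x : Fin (p + 1) → ℝ) (l : Fin (p + 1) → ℝ → ℝ),
      (∀ k, ∃ θ ∈ Icc (0 : ℝ) 1, x k = t + d * h * θ) ∧ (∀ k, Continuous (l k)) ∧ x 0 = t ∧
      (∀ s, ∀ r < p + 1, ∑ k, l k s * (x k - t) ^ r = (s - t) ^ r) ∧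
      (∀ y : Fin (p + 1) → ℝ, ∃ v : Fin (p + 1) → ℝ, v 0 = y 0 ∧
        ∀ s, ∑ k, l k s * y k = ∑ k : Fin (p + 1), v k * (s - t) ^ (k : ℕ)) ∧
      (∀ s, |s - t| ≤ h → ∑ k, |l k s| ≤ (p + 1) * (2 * (p + 1)) ^ p) := by
  -- The first node is `t`, and the sign `d` decides on which side of `t` the others lie.
  let x : Fin (p + 1) → ℝ := fun k => t + d * h * ((k : ℕ) / (p + 1))
  have hp : (0 : ℝ) < p + 1 := by positivity
  have hd0 : d ≠ 0 := by rintro rfl; simp at hd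
  have hxsub : ∀ k m, x k - x m = d * h / (p + 1) * (((k : ℕ) : ℝ) - ((m : ℕ) : ℝ)) := by
    intro k m; simp only [x]; field_simp; ring
  have hxinj : Function.Injective x := by
    intro k m hkm
    have := hxsub k m
    rw [hkm, sub_self, eq_comm, mul_eq_zero] at this
    rcases this with h0 | h0
    · exact absurd h0 (by positivity)
    · exact Fin.ext (by exact_mod_cast sub_eq_zero.1 h0)
  have hθ : ∀ k : Fin (p + 1), ((k : ℕ) : ℝ) / (p + 1) ∈ Icc (0 : ℝ) 1 := by
    intro k
    refine ⟨by positivity, (div_le_one hp).2 ?_⟩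
    have := k.2.le
    exact_mod_cast this
  let l : Fin (p + 1) → ℝ → ℝ := fun k s => (Lagrange.basis Finset.univ x k).eval s
  have hinterp : ∀ (y : Fin (p + 1) → ℝ) (s : ℝ),
      (Lagrange.interpolate Finset.univ x y).eval s = ∑ k, l k s * y k := by
    intro y s
    rw [Lagrange.interpolate_apply, Polynomial.eval_finsetSum]
    exact Finset.sum_congr rfl fun k _ => by simp [l, mul_comm]
  refine ⟨x, l, fun k => ⟨_, hθ k, rfl⟩, fun k => Polynomial.continuous _, by simp [x], ?_, ?_, ?_⟩
  · intro s r hr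
    have hdeg : ((Polynomial.X - Polynomial.C t) ^ r : Polynomial ℝ).degree
        < (Finset.univ : Finset (Fin (p + 1))).card := by
      rw [Polynomial.degree_pow, Polynomial.degree_X_sub_C]
      simpa using (by exact_mod_cast hr : ((r : ℕ) : WithBot ℕ) < ((p + 1 : ℕ) : WithBot ℕ))
    have h1 := Lagrange.eq_interpolate (hxinj.injOn (s := (Finset.univ : Finset (Fin (p + 1)))))
      hdeg
    have h2 := congrArg (Polynomial.eval s) h1
    rw [hinterp] at h2
    simpa using h2.symm
  · intro y
    set Q := Lagrange.interpolate Finset.univ x y with hQ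
    refine ⟨fun k => (Polynomial.taylor t Q).coeff k, ?_, fun s => ?_⟩
    · have h1 := Lagrange.eval_interpolate_at_node y
        (hxinj.injOn (s := (Finset.univ : Finset (Fin (p + 1))))) (Finset.mem_univ 0)
      have h0 : x 0 = t := by simp [x]
      rw [h0] at h1
      exact (Polynomial.taylor_coeff_zero t Q).trans h1
    · have hdeg : Q.natDegree < p + 1 := by
        have := Lagrange.degree_interpolate_lt y
          (hxinj.injOn (s := (Finset.univ : Finset (Fin (p + 1)))))
        by_cases h0 : Q = 0
        · simp [h0]
        · rw [Polynomial.natDegree_lt_iff_degree_lt h0]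
          rwa [Finset.card_univ, Fintype.card_fin] at this
      rw [← hinterp y s, ← hQ]
      have h1 : Q.eval s = (Polynomial.taylor t Q).eval (s - t) := by
        rw [Polynomial.taylor_eval]; simp
      rw [h1, Polynomial.eval_eq_sum_range' (n := p + 1) (by rwa [Polynomial.natDegree_taylor]),
        Finset.sum_range]
  · intro s hs
    -- Each of the `p` factors of a basis polynomial is at most `2 (p + 1)`: the numerator is at
    -- most `2 h` and the nodes are at least `h / (p + 1)` apart.
    have hl : ∀ k, |l k s| ≤ (2 * (p + 1)) ^ p := by
      intro k
      simp only [l, Lagrange.basis, Polynomial.eval_prod, Finset.abs_prod]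
      have hcard : (Finset.univ.erase k).card = p := by
        rw [Finset.card_erase_of_mem (Finset.mem_univ k)]; simp
      calc _ ≤ ∏ _m ∈ Finset.univ.erase k, (2 * (p + 1) : ℝ) := by
            refine Finset.prod_le_prod (fun _ _ => abs_nonneg _) fun m hm => ?_
            simp only [Lagrange.basisDivisor, Polynomial.eval_mul, Polynomial.eval_C,
              Polynomial.eval_sub, Polynomial.eval_X, abs_mul, abs_inv]
            have hkm : (1 : ℝ) ≤ |((k : ℕ) : ℝ) - ((m : ℕ) : ℝ)| := by
              have : (k : ℕ) ≠ m := fun h => (Finset.ne_of_mem_erase hm) (Fin.ext h.symm)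
              have h1 : (1 : ℤ) ≤ |((k : ℕ) : ℤ) - ((m : ℕ) : ℤ)| :=
                Int.one_le_abs (sub_ne_zero.2 (by exact_mod_cast this))
              exact_mod_cast h1
            have h1 : h / (p + 1) ≤ |x k - x m| := by
              rw [hxsub, abs_mul, abs_div, abs_mul, hd, abs_of_pos hh, abs_of_pos hp, one_mul]
              exact le_mul_of_one_le_right (by positivity) hkm
            have h2 : |s - x m| ≤ 2 * h := by
              have : |s - x m| ≤ |s - t| + |x m - t| := by
                have := abs_sub (s - t) (x m - t); simpa using this
              have h3 : |x m - t| ≤ h := by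
                simp only [x, add_sub_cancel_left, abs_mul, hd, abs_of_pos hh, one_mul]
                rw [abs_of_nonneg (hθ m).1]
                exact mul_le_of_le_one_right hh.le (hθ m).2
              linarith
            rw [inv_mul_eq_div, div_le_iff₀ (lt_of_lt_of_le (by positivity) h1)]
            refine h2.trans ?_
            calc 2 * h = 2 * (p + 1) * (h / (p + 1)) := by field_simp
              _ ≤ _ := by gcongr
        _ = _ := by rw [Finset.prod_const, hcard]
    calc _ ≤ ∑ _k : Fin (p + 1), (2 * (p + 1) : ℝ) ^ p := Finset.sum_le_sum fun k _ => hl k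
      _ = _ := by simp

section Designs

/-! ### Well-conditioned random designs -/

/-- A bounded symmetric probability density vanishing outside `[-1, 1]`. -/
structure IsKernel (K : ℝ → ℝ) (B : ℝ) : Prop where
  measurable : Measurable K
  nonneg : ∀ x, 0 ≤ K x
  le : ∀ x, K x ≤ B
  pos : 0 < B
  symm : ∀ x, K (-x) = K x
  support : ∀ x, 1 < |x| → K x = 0
  integral : ∫ x, K x = 1

variable {K : ℝ → ℝ} {B : ℝ}

lemma IsKernel.integrableOn_mul (hK : IsKernel K B) {q : ℝ → ℝ} (hq : Continuous q) :
    IntegrableOn (fun v => K v * q v) (Icc 0 1) := by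
  refine Integrable.bdd_mul (c := B) (hq.continuousOn.integrableOn_Icc)
    hK.measurable.aestronglyMeasurable (ae_of_all _ fun x => ?_)
  rw [Real.norm_of_nonneg (hK.nonneg x)]
  exact hK.le x

/-- A nonzero polynomial has finitely many zeros, so a vanishing integral would force `K = 0` almost
everywhere on `[0, 1]`, hence by symmetry and support everywhere, against `∫ K = 1`. -/
lemma IsKernel.setIntegral_mul_sq_pos (hK : IsKernel K B) {p : ℕ} {β : Fin (p + 1) → ℝ}
    (hβ : β ≠ 0) :
    0 < ∫ v in Icc (0 : ℝ) 1, K v * (∑ k : Fin (p + 1), β k * v ^ (k : ℕ)) ^ 2 := by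
  have hnn : ∀ v, 0 ≤ K v * (∑ k : Fin (p + 1), β k * v ^ (k : ℕ)) ^ 2 :=
    fun v => mul_nonneg (hK.nonneg v) (sq_nonneg _)
  refine lt_of_le_of_ne (integral_nonneg hnn) fun h0 => ?_
  have h1 := (setIntegral_eq_zero_iff_of_nonneg_ae (ae_of_all _ hnn)
    (hK.integrableOn_mul (by fun_prop))).1 h0.symm
  rw [Filter.EventuallyEq, ae_restrict_iff' measurableSet_Icc] at h1
  let Q : Polynomial ℝ := ∑ k : Fin (p + 1), Polynomial.C (β k) * Polynomial.X ^ (k : ℕ)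
  have hQ : Q ≠ 0 := by
    intro hQ
    apply hβ
    funext k
    have := congrArg (fun R : Polynomial ℝ => R.coeff k) hQ
    simp only [Q, Polynomial.finsetSum_coeff, Polynomial.coeff_C_mul, Polynomial.coeff_X_pow,
      Polynomial.coeff_zero] at this
    simpa [Fin.val_inj] using this
  have hfin : ∀ᵐ v : ℝ, Q.eval v ≠ 0 := by
    have : {v : ℝ | Q.eval v = 0}.Finite := by
      refine (Q.roots.toFinset.finite_toSet).subset fun v hv => ?_
      simpa [hQ] using hv
    have h2 := this.measure_zero (volume : Measure ℝ)
    rw [ae_iff]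
    simpa using h2
  have hK0 : ∀ᵐ v : ℝ, v ∈ Icc (0 : ℝ) 1 → K v = 0 := by
    filter_upwards [h1, hfin] with v hv hv2 hmem
    have := hv hmem
    have h3 : ∑ k : Fin (p + 1), β k * v ^ (k : ℕ) = Q.eval v := by
      simp [Q, Polynomial.eval_finsetSum]
    rw [h3] at this
    simpa [hv2] using this
  have hK1 : ∀ᵐ v : ℝ, -v ∈ Icc (0 : ℝ) 1 → K (-v) = 0 :=
    (Measure.measurePreserving_neg (volume : Measure ℝ)).quasiMeasurePreserving.ae hK0
  have hK2 : K =ᵐ[volume] 0 := by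
    filter_upwards [hK0, hK1] with v hv hv2
    by_cases h : 1 < |v|
    · exact hK.support v h
    · rw [not_lt, abs_le] at h
      rcases le_total 0 v with h4 | h4
      · exact hv ⟨h4, h.2⟩
      · rw [← hK.symm]
        exact hv2 ⟨by linarith, by linarith⟩
  have := hK.integral
  rw [integral_congr_ae hK2] at this
  simp at this

/-- Written as a quadratic form in finitely many moments, the integral is visibly continuous in `β`.
-/
lemma IsKernel.setIntegral_mul_sq_eq (hK : IsKernel K B) {p : ℕ} (β : Fin (p + 1) → ℝ) :
    ∫ v in Icc (0 : ℝ) 1, K v * (∑ k : Fin (p + 1), β k * v ^ (k : ℕ)) ^ 2 =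
      ∑ k : Fin (p + 1), ∑ l : Fin (p + 1), β k * β l *
        ∫ v in Icc (0 : ℝ) 1, K v * v ^ ((k : ℕ) + l) := by
  have hint : ∀ k l : Fin (p + 1), IntegrableOn (fun v => β k * β l * (K v * v ^ ((k : ℕ) + l)))
      (Icc (0 : ℝ) 1) := fun k l => (hK.integrableOn_mul (by fun_prop)).const_mul _
  simp_rw [← integral_const_mul]
  have h1 : ∀ k : Fin (p + 1), ∑ l : Fin (p + 1),
      ∫ v in Icc (0 : ℝ) 1, β k * β l * (K v * v ^ ((k : ℕ) + l)) =
      ∫ v in Icc (0 : ℝ) 1, ∑ l : Fin (p + 1), β k * β l * (K v * v ^ ((k : ℕ) + l)) :=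
    fun k => (integral_finsetSum _ fun l _ => hint k l).symm
  simp_rw [h1]
  rw [← integral_finsetSum _ fun k _ => integrable_finsetSum _ fun l _ => hint k l]
  refine integral_congr_ae (ae_of_all _ fun v => ?_)
  beta_reduce
  rw [pow_two, Finset.sum_mul_sum, Finset.mul_sum]
  refine Finset.sum_congr rfl fun k _ => ?_
  rw [Finset.mul_sum]
  refine Finset.sum_congr rfl fun l _ => ?_
  rw [pow_add]; ring

/-- The one-sided moment matrix of a kernel is positive definite. -/
lemma IsKernel.exists_moment_lower_bound (hK : IsKernel K B) (p : ℕ) :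
    ∃ c : ℝ, 0 < c ∧ ∀ β : Fin (p + 1) → ℝ, c * ∑ k, β k ^ 2 ≤
      ∫ v in Icc (0 : ℝ) 1, K v * (∑ k : Fin (p + 1), β k * v ^ (k : ℕ)) ^ 2 := by
  let Φ : (Fin (p + 1) → ℝ) → ℝ := fun β =>
    ∫ v in Icc (0 : ℝ) 1, K v * (∑ k : Fin (p + 1), β k * v ^ (k : ℕ)) ^ 2
  have hΦ : Continuous Φ := by
    have : Φ = fun β => ∑ k : Fin (p + 1), ∑ l : Fin (p + 1), β k * β l *
        ∫ v in Icc (0 : ℝ) 1, K v * v ^ ((k : ℕ) + l) := funext hK.setIntegral_mul_sq_eq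
    rw [this]
    fun_prop
  -- The constant is the minimum over the unit sphere; homogeneity of degree two extends the bound
  -- to all `β`.
  let S : Set (Fin (p + 1) → ℝ) := {β | ∑ k, β k ^ 2 = 1}
  have hS : IsCompact S := by
    refine (isCompact_univ_pi fun _ : Fin (p + 1) =>
      isCompact_Icc (a := (-1 : ℝ)) (b := 1)).of_isClosed_subset
      (isClosed_eq (by fun_prop) continuous_const) fun β hβ k _ => ?_
    have h1 : β k ^ 2 ≤ 1 := by
      have h2 := Finset.single_le_sum (f := fun k => β k ^ 2) (fun k _ => sq_nonneg (β k))
        (Finset.mem_univ k)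
      exact h2.trans_eq hβ
    exact abs_le.1 ((sq_le_one_iff_abs_le_one _).1 h1)
  have hne : S.Nonempty := ⟨Pi.single 0 1, by simp [S, Pi.single_apply]⟩
  obtain ⟨β₀, hβ₀, hmin⟩ := hS.exists_isMinOn hne hΦ.continuousOn
  have hβ₀0 : β₀ ≠ 0 := by
    rintro rfl
    simp [S] at hβ₀
  refine ⟨Φ β₀, hK.setIntegral_mul_sq_pos hβ₀0, fun β => ?_⟩
  set s := ∑ k, β k ^ 2 with hs
  have hs0 : 0 ≤ s := Finset.sum_nonneg fun k _ => sq_nonneg _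
  rcases hs0.eq_or_lt with h0 | h0
  · rw [← h0, mul_zero]
    exact integral_nonneg fun v => mul_nonneg (hK.nonneg v) (sq_nonneg _)
  · have hsq : √s ^ 2 = s := Real.sq_sqrt hs0
    have hspos : 0 < √s := Real.sqrt_pos.2 h0
    have h1 : (fun k => β k / √s) ∈ S := by
      simp only [S, mem_ofPred_eq, div_pow, hsq, ← Finset.sum_div]
      exact div_self h0.ne'
    have h2 : Φ β₀ ≤ Φ (fun k => β k / √s) := hmin h1
    have h3 : Φ (fun k => β k / √s) = (∫ v in Icc (0 : ℝ) 1,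
        K v * (∑ k : Fin (p + 1), β k * v ^ (k : ℕ)) ^ 2) / s := by
      rw [← integral_div]
      refine integral_congr_ae (ae_of_all _ fun v => ?_)
      simp only [div_mul_eq_mul_div, ← Finset.sum_div, div_pow, hsq]
      ring
    rw [h3, le_div_iff₀ h0] at h2
    exact h2

/-- The summands of the one-sided empirical moments. -/
def oneSidedMoment (K : ℝ → ℝ) (r : ℕ) (v : ℝ) : ℝ :=
  (Icc (0 : ℝ) 1).indicator (fun v => K v * v ^ r) v

lemma IsKernel.measurable_oneSidedMoment (hK : IsKernel K B) (r : ℕ) :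
    Measurable (oneSidedMoment K r) :=
  (hK.measurable.mul (by fun_prop)).indicator measurableSet_Icc

lemma IsKernel.oneSidedMoment_mem (hK : IsKernel K B) (r : ℕ) (v : ℝ) :
    oneSidedMoment K r v ∈ Icc 0 B := by
  unfold oneSidedMoment
  by_cases h : v ∈ Icc (0 : ℝ) 1
  · rw [indicator_of_mem h]
    refine ⟨mul_nonneg (hK.nonneg v) (pow_nonneg h.1 _), ?_⟩
    calc K v * v ^ r ≤ K v * 1 :=
          mul_le_mul_of_nonneg_left (pow_le_one₀ h.1 h.2) (hK.nonneg v)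
      _ ≤ B := by rw [mul_one]; exact hK.le v
  · rw [indicator_of_notMem h]
    exact ⟨le_rfl, hK.pos.le⟩

lemma sum_sum_oneSidedMoment {p : ℕ} (β : Fin (p + 1) → ℝ) (v : ℝ) :
    ∑ k : Fin (p + 1), ∑ l : Fin (p + 1), β k * β l * oneSidedMoment K ((k : ℕ) + l) v =
      (Icc (0 : ℝ) 1).indicator
        (fun v => K v * (∑ k : Fin (p + 1), β k * v ^ (k : ℕ)) ^ 2) v := by
  unfold oneSidedMoment
  by_cases h : v ∈ Icc (0 : ℝ) 1
  · simp only [indicator_of_mem h]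
    rw [pow_two, Finset.sum_mul_sum, Finset.mul_sum]
    refine Finset.sum_congr rfl fun k _ => ?_
    rw [Finset.mul_sum]
    refine Finset.sum_congr rfl fun l _ => ?_
    rw [pow_add]; ring
  · simp [indicator_of_notMem h]

/-- Deterministic criterion for a well-conditioned design, in terms of the one-sided empirical
moments. -/
lemma IsKernel.designBound_of_moments (hK : IsKernel K B) {p m : ℕ} {c₀ h t d η : ℝ} (hd : |d| = 1)
    {a : ℕ → ℝ} {x : Fin m → ℝ}
    (ha : ∀ β : Fin (p + 1) → ℝ, c₀ * ∑ k, β k ^ 2 ≤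
      ∑ k : Fin (p + 1), ∑ l : Fin (p + 1), β k * β l * a ((k : ℕ) + l))
    (hx : ∀ r < 2 * p + 1, |∑ j, oneSidedMoment K r (d * ((x j - t) / h)) - a r| ≤ η) :
    DesignBound p K h (c₀ - (p + 1) * η) x t := by
  intro β
  have hη : 0 ≤ η := (abs_nonneg _).trans (hx 0 (by omega))
  have hd2 : d ^ 2 = 1 := by rw [← sq_abs, hd, one_pow]
  -- Reflection at `t` when `d = -1`: it changes the signs of the odd coefficients and preserves
  -- their sum of squares and the kernel.
  let b : Fin (p + 1) → ℝ := fun k => β k * d ^ (k : ℕ)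
  have hb : ∑ k, b k ^ 2 = ∑ k, β k ^ 2 := by
    refine Finset.sum_congr rfl fun k _ => ?_
    simp only [b, mul_pow, ← pow_mul, mul_comm (k : ℕ) 2]
    rw [pow_mul, hd2, one_pow, mul_one]
  have hKd : ∀ u, K (d * u) = K u := by
    intro u
    rcases eq_or_eq_neg_of_abs_eq hd with rfl | rfl
    · rw [one_mul]
    · rw [neg_one_mul, hK.symm]
  have hpoly : ∀ u, ∑ k : Fin (p + 1), b k * (d * u) ^ (k : ℕ) =
      ∑ k : Fin (p + 1), β k * u ^ (k : ℕ) := by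
    intro u
    refine Finset.sum_congr rfl fun k _ => ?_
    have : d ^ (k : ℕ) * d ^ (k : ℕ) = 1 := by rw [← pow_add, ← two_mul, pow_mul, hd2, one_pow]
    simp only [b, mul_pow]
    linear_combination β k * u ^ (k : ℕ) * this
  have h1 : ∑ j, ∑ k : Fin (p + 1), ∑ l : Fin (p + 1),
      b k * b l * oneSidedMoment K ((k : ℕ) + l) (d * ((x j - t) / h)) ≤
      ∑ j, K ((x j - t) / h) * (∑ k : Fin (p + 1), β k * ((x j - t) / h) ^ (k : ℕ)) ^ 2 := by
    refine Finset.sum_le_sum fun j _ => ?_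
    rw [sum_sum_oneSidedMoment]
    refine (indicator_le_self' (fun v _ => mul_nonneg (hK.nonneg v) (sq_nonneg _)) _).trans_eq ?_
    rw [hKd, hpoly]
  refine le_trans ?_ h1
  have h2 : ∑ j, ∑ k : Fin (p + 1), ∑ l : Fin (p + 1),
      b k * b l * oneSidedMoment K ((k : ℕ) + l) (d * ((x j - t) / h)) =
      ∑ k : Fin (p + 1), ∑ l : Fin (p + 1), b k * b l * a ((k : ℕ) + l) +
      ∑ k : Fin (p + 1), ∑ l : Fin (p + 1), b k * b l *
        (∑ j, oneSidedMoment K ((k : ℕ) + l) (d * ((x j - t) / h)) - a ((k : ℕ) + l)) := by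
    rw [Finset.sum_comm, ← Finset.sum_add_distrib]
    refine Finset.sum_congr rfl fun k _ => ?_
    rw [Finset.sum_comm, ← Finset.sum_add_distrib]
    refine Finset.sum_congr rfl fun l _ => ?_
    rw [← Finset.mul_sum]
    ring
  -- Deviations of at most `η` in every moment change the form by at most `η (∑ |b k|)²`, and
  -- Cauchy–Schwarz gives the factor `p + 1`.
  have h3 : -((p + 1) * η * ∑ k, b k ^ 2) ≤ ∑ k : Fin (p + 1), ∑ l : Fin (p + 1), b k * b l *
        (∑ j, oneSidedMoment K ((k : ℕ) + l) (d * ((x j - t) / h)) - a ((k : ℕ) + l)) := by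
    have h4 : ∀ k l : Fin (p + 1), -(η * (|b k| * |b l|)) ≤ b k * b l *
        (∑ j, oneSidedMoment K ((k : ℕ) + l) (d * ((x j - t) / h)) - a ((k : ℕ) + l)) := by
      intro k l
      refine le_trans ?_ (neg_abs_le _)
      rw [abs_mul (b k * b l), abs_mul (b k), neg_le_neg_iff, mul_comm η]
      exact mul_le_mul_of_nonneg_left (hx (k + l) (by omega))
        (mul_nonneg (abs_nonneg (b k)) (abs_nonneg (b l)))
    refine le_trans ?_ (Finset.sum_le_sum fun k _ => Finset.sum_le_sum fun l _ => h4 k l)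
    simp only [Finset.sum_neg_distrib, ← Finset.mul_sum, neg_le_neg_iff]
    rw [← Finset.sum_mul, ← pow_two]
    have h5 : (∑ k, |b k|) ^ 2 ≤ (p + 1) * ∑ k, b k ^ 2 := by
      have := sq_sum_le_card_mul_sum_sq (s := Finset.univ) (f := fun k => |b k|)
      simpa using this
    nlinarith [mul_le_mul_of_nonneg_left h5 hη]
  have h4 := ha b
  rw [hb] at h3 h4
  rw [h2]
  linarith

end Designs

/-! ### Concentration of the one-sided empirical moments. -/

section Hoeffding

variable {Ω : Type*} [MeasurableSpace Ω] {P : Measure Ω} [IsProbabilityMeasure P]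

/-- The two-sided Hoeffding inequality for bounded random variables. -/
lemma measureReal_abs_sum_sub_ge_le {m : ℕ} {X : Fin m → Ω → ℝ} {B : ℝ} (hind : iIndepFun X P)
    (hX : ∀ j, Measurable (X j)) (hB : ∀ j ω, X j ω ∈ Icc 0 B) {e : ℝ} (he : 0 ≤ e) :
    P.real {ω | e ≤ |∑ j, X j ω - ∑ j, P[X j]|} ≤ 2 * Real.exp (-(2 * e ^ 2 / (m * B ^ 2))) := by
  have hsub : ∀ j, HasSubgaussianMGF (fun ω => X j ω - P[X j]) ((‖B - 0‖₊ / 2) ^ 2) P :=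
    fun j => hasSubgaussianMGF_of_mem_Icc (hX j).aemeasurable (ae_of_all _ (hB j))
  have hind₁ : iIndepFun (fun j ω => X j ω - P[X j]) P :=
    hind.comp (fun j x => x - ∫ ω, X j ω ∂P) fun j => by fun_prop
  have hind₂ : iIndepFun (fun j ω => -(X j ω - P[X j])) P :=
    hind.comp (fun j x => -(x - ∫ ω, X j ω ∂P)) fun j => by fun_prop
  have h1 := HasSubgaussianMGF.measure_sum_ge_le_of_iIndepFun hind₁ (s := Finset.univ)
    (fun j _ => hsub j) he
  have h2 := HasSubgaussianMGF.measure_sum_ge_le_of_iIndepFun hind₂ (s := Finset.univ)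
    (fun j _ => (hsub j).neg) he
  have hexp : -e ^ 2 / (2 * ((∑ _j : Fin m, (‖B - 0‖₊ / 2) ^ 2 : NNReal) : ℝ)) =
      -(2 * e ^ 2 / (m * B ^ 2)) := by
    push_cast
    rw [Finset.sum_const, Finset.card_univ, Fintype.card_fin, sub_zero, div_pow, Real.norm_eq_abs,
      sq_abs, nsmul_eq_mul]
    rw [neg_div, neg_inj]
    by_cases h0 : (m : ℝ) * B ^ 2 = 0
    · rw [h0, ← mul_div_assoc, h0]; simp
    · have := left_ne_zero_of_mul h0
      have := right_ne_zero_of_mul h0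
      field_simp
  rw [hexp] at h1 h2
  calc P.real {ω | e ≤ |∑ j, X j ω - ∑ j, P[X j]|}
      ≤ P.real ({ω | e ≤ ∑ j, (X j ω - P[X j])} ∪ {ω | e ≤ ∑ j, -(X j ω - P[X j])}) := by
        refine measureReal_mono fun ω hω => ?_
        simp only [Finset.sum_neg_distrib, Finset.sum_sub_distrib, mem_union, mem_ofPred_eq] at hω ⊢
        exact le_abs.1 hω
    _ ≤ _ := measureReal_union_le _ _
    _ ≤ _ := by rw [two_mul]; exact add_le_add h1 h2

variable {K : ℝ → ℝ} {B : ℝ}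

/-- The integrand is nonnegative, so the law may be replaced by the smaller measure, `π₀` times
Lebesgue measure on the half-window. The substitution `v = d (x - t) / h` produces the factor `h`.
-/
lemma IsKernel.moment_lower_bound_of_le_law (hK : IsKernel K B) {p : ℕ} {c₀ π₀ h t d : ℝ}
    (hc : ∀ β : Fin (p + 1) → ℝ, c₀ * ∑ k, β k ^ 2 ≤
      ∫ v in Icc (0 : ℝ) 1, K v * (∑ k : Fin (p + 1), β k * v ^ (k : ℕ)) ^ 2)
    (hπ₀ : 0 < π₀) (hh : 0 < h) (hd : |d| = 1) {ν : Measure ℝ} [IsProbabilityMeasure ν]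
    (hν : ENNReal.ofReal π₀ • volume.restrict {x | d * ((x - t) / h) ∈ Icc (0 : ℝ) 1} ≤ ν)
    (β : Fin (p + 1) → ℝ) :
    (π₀ * h * c₀) * ∑ k, β k ^ 2 ≤ ∑ k : Fin (p + 1), ∑ l : Fin (p + 1), β k * β l *
      ∫ x, oneSidedMoment K ((k : ℕ) + l) (d * ((x - t) / h)) ∂ν := by
  set q : ℝ → ℝ := (Icc (0 : ℝ) 1).indicator
    (fun v => K v * (∑ k : Fin (p + 1), β k * v ^ (k : ℕ)) ^ 2) with hq
  have hq0 : ∀ v, 0 ≤ q v := fun v =>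
    indicator_nonneg (fun v _ => mul_nonneg (hK.nonneg v) (sq_nonneg _)) v
  have hint : ∀ r, Integrable (fun x => oneSidedMoment K r (d * ((x - t) / h))) ν := by
    intro r
    refine Integrable.of_bound (C := B)
      ((hK.measurable_oneSidedMoment r).comp (by fun_prop)).aestronglyMeasurable
      (ae_of_all _ fun x => ?_)
    have := hK.oneSidedMoment_mem r (d * ((x - t) / h))
    rw [Real.norm_of_nonneg this.1]
    exact this.2
  have h1 : ∑ k : Fin (p + 1), ∑ l : Fin (p + 1), β k * β l *
      ∫ x, oneSidedMoment K ((k : ℕ) + l) (d * ((x - t) / h)) ∂ν =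
      ∫ x, q (d * ((x - t) / h)) ∂ν := by
    simp_rw [← integral_const_mul]
    have h1 : ∀ k : Fin (p + 1), ∑ l : Fin (p + 1),
        ∫ x, β k * β l * oneSidedMoment K ((k : ℕ) + l) (d * ((x - t) / h)) ∂ν =
        ∫ x, ∑ l : Fin (p + 1), β k * β l * oneSidedMoment K ((k : ℕ) + l) (d * ((x - t) / h)) ∂ν :=
      fun k => (integral_finsetSum _ fun l _ => (hint _).const_mul _).symm
    simp_rw [h1]
    rw [← integral_finsetSum _ fun k _ => integrable_finsetSum _ fun l _ => (hint _).const_mul _]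
    exact integral_congr_ae (ae_of_all _ fun x => sum_sum_oneSidedMoment β _)
  have hqint : Integrable (fun x => q (d * ((x - t) / h))) ν := by
    have : (fun x => q (d * ((x - t) / h))) = fun x => ∑ k : Fin (p + 1), ∑ l : Fin (p + 1),
        β k * β l * oneSidedMoment K ((k : ℕ) + l) (d * ((x - t) / h)) :=
      funext fun x => (sum_sum_oneSidedMoment β _).symm
    rw [this]
    exact integrable_finsetSum _ fun k _ => integrable_finsetSum _ fun l _ =>
      (hint _).const_mul _
  have hseg : MeasurableSet {x : ℝ | d * ((x - t) / h) ∈ Icc (0 : ℝ) 1} :=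
    measurableSet_Icc.preimage (by fun_prop)
  have h2 : ∫ x, q (d * ((x - t) / h))
      ∂(ENNReal.ofReal π₀ • volume.restrict {x | d * ((x - t) / h) ∈ Icc (0 : ℝ) 1}) ≤
      ∫ x, q (d * ((x - t) / h)) ∂ν :=
    integral_mono_measure hν (ae_of_all _ fun x => hq0 _) hqint
  have h3 : ∫ x in {x | d * ((x - t) / h) ∈ Icc (0 : ℝ) 1}, q (d * ((x - t) / h)) =
      h * ∫ v in Icc (0 : ℝ) 1, K v * (∑ k : Fin (p + 1), β k * v ^ (k : ℕ)) ^ 2 := by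
    have hz : ∀ x ∉ {x : ℝ | d * ((x - t) / h) ∈ Icc (0 : ℝ) 1}, q (d * ((x - t) / h)) = 0 :=
      fun x hx => by
        have hx' : d * ((x - t) / h) ∉ Icc (0 : ℝ) 1 := hx
        rw [hq, indicator_of_notMem hx']
    rw [setIntegral_eq_integral_of_forall_compl_eq_zero hz,
      ← integral_indicator measurableSet_Icc, ← hq,
      integral_sub_right_eq_self (fun x => q (d * (x / h))) t]
    have : (fun x => q (d * (x / h))) = fun x => q ((d / h) * x) := by
      funext x; congr 1; ring
    rw [this, Measure.integral_comp_mul_left, smul_eq_mul, abs_inv, abs_div, hd, abs_of_pos hh,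
      one_div, inv_inv]
  rw [integral_smul_measure, ENNReal.toReal_ofReal hπ₀.le, h3, smul_eq_mul] at h2
  rw [h1]
  refine le_trans ?_ h2
  have := mul_le_mul_of_nonneg_left (hc β) (mul_pos hπ₀ hh).le
  linarith

variable (P) in
/-- Random designs are well-conditioned with overwhelming probability. -/
lemma IsKernel.exists_good_designs (hK : IsKernel K B) (p : ℕ) {π₀ : ℝ} (hπ₀ : 0 < π₀) :
    ∃ c : ℝ, 0 < c ∧ ∃ κ : ℝ, 0 < κ ∧ ∀ (m : ℕ) (h t d : ℝ), 0 < h → |d| = 1 →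
      ∀ ν : Measure ℝ, IsProbabilityMeasure ν →
      ENNReal.ofReal π₀ • volume.restrict {x | d * ((x - t) / h) ∈ Icc (0 : ℝ) 1} ≤ ν →
      ∃ G : Set (Fin m → ℝ), MeasurableSet G ∧ (∀ x ∈ G, DesignBound p K h (c * (m * h)) x t) ∧
        ∀ τ : Fin m → Ω → ℝ, iIndepFun τ P → (∀ j, Measurable (τ j)) → (∀ j, P.map (τ j) = ν) →
          P.real {ω | (fun j => τ j ω) ∉ G} ≤
            (2 * p + 1) * (2 * Real.exp (-(κ * (m * h ^ 2)))) := by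
  obtain ⟨c₀, hc₀, hc⟩ := hK.exists_moment_lower_bound p
  have hB := hK.pos
  -- With `η` below, the tolerated deviations use up exactly half of the lower bound `m π₀ h c₀`,
  -- whence `c`; the Hoeffding exponent `2 η² / (m B²)` then equals `κ m h²`. The factor `2 p + 1`
  -- counts the moments of order `0, …, 2 p` in the union bound.
  refine ⟨π₀ * c₀ / 2, by positivity, (π₀ * c₀) ^ 2 / (2 * (p + 1) ^ 2 * B ^ 2), by positivity, ?_⟩
  intro m h t d hh hd ν hνp hν
  let a : ℕ → ℝ := fun r => m * ∫ x, oneSidedMoment K r (d * ((x - t) / h)) ∂ν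
  set η : ℝ := m * (π₀ * h * c₀) / (2 * (p + 1)) with hη
  have hη0 : 0 ≤ η := by positivity
  have hmeas : ∀ r, Measurable fun x : ℝ => oneSidedMoment K r (d * ((x - t) / h)) :=
    fun r => (hK.measurable_oneSidedMoment r).comp (by fun_prop)
  refine ⟨{x | ∀ r ∈ Finset.range (2 * p + 1),
    |∑ j, oneSidedMoment K r (d * ((x j - t) / h)) - a r| ≤ η}, ?_, ?_, ?_⟩
  · have : {x : Fin m → ℝ | ∀ r ∈ Finset.range (2 * p + 1),
        |∑ j, oneSidedMoment K r (d * ((x j - t) / h)) - a r| ≤ η} =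
        ⋂ r ∈ Finset.range (2 * p + 1),
          {x | |∑ j, oneSidedMoment K r (d * ((x j - t) / h)) - a r| ≤ η} := by
      ext; simp
    rw [this]
    refine Finset.measurableSet_biInter _ fun r _ => measurableSet_le ?_ measurable_const
    refine Measurable.abs (Measurable.sub_const ?_ _)
    exact Finset.measurable_fun_sum _ fun j _ => (hmeas r).comp (measurable_pi_apply j)
  · intro x hx
    have h1 := hK.designBound_of_moments (c₀ := m * (π₀ * h * c₀)) (h := h) (t := t) (η := η) hd
      (a := a) (x := x) ?_ (fun r hr => hx r (Finset.mem_range.2 hr))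
    · convert h1 using 1
      rw [hη]
      field_simp
      ring
    · intro β
      have := mul_le_mul_of_nonneg_left
        (hK.moment_lower_bound_of_le_law hc hπ₀ hh hd hν β) (Nat.cast_nonneg (α := ℝ) m)
      refine (le_of_eq (by ring)).trans (this.trans_eq ?_)
      simp only [Finset.mul_sum, a]
      exact Finset.sum_congr rfl fun k _ => Finset.sum_congr rfl fun l _ => by ring
  · intro τ hτ hτm hlaw
    have hE : ∀ r j, P[fun ω => oneSidedMoment K r (d * ((τ j ω - t) / h))] =
        ∫ x, oneSidedMoment K r (d * ((x - t) / h)) ∂ν := by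
      intro r j
      rw [← hlaw j, integral_map (hτm j).aemeasurable (hmeas r).aestronglyMeasurable]
    have hr : ∀ r, P.real {ω | η ≤ |∑ j, oneSidedMoment K r (d * ((τ j ω - t) / h)) - a r|} ≤
        2 * Real.exp (-((π₀ * c₀) ^ 2 / (2 * (p + 1) ^ 2 * B ^ 2) * (m * h ^ 2))) := by
      intro r
      have h1 := measureReal_abs_sum_sub_ge_le (P := P)
        (X := fun j ω => oneSidedMoment K r (d * ((τ j ω - t) / h)))
        (hτ.comp (fun _ x => oneSidedMoment K r (d * ((x - t) / h))) fun _ => hmeas r)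
        (fun j => (hmeas r).comp (hτm j)) (fun j ω => hK.oneSidedMoment_mem r _) hη0
      simp only [hE r, Finset.sum_const, Finset.card_univ, Fintype.card_fin, nsmul_eq_mul] at h1
      refine h1.trans_eq ?_
      congr 3
      rw [hη]
      rcases Nat.eq_zero_or_pos m with rfl | hm
      · simp
      · have : (m : ℝ) ≠ 0 := by positivity
        field_simp
    calc P.real {ω | (fun j => τ j ω) ∉ {x : Fin m → ℝ | ∀ r ∈ Finset.range (2 * p + 1),
          |∑ j, oneSidedMoment K r (d * ((x j - t) / h)) - a r| ≤ η}}
        ≤ P.real (⋃ r ∈ Finset.range (2 * p + 1),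
          {ω | η ≤ |∑ j, oneSidedMoment K r (d * ((τ j ω - t) / h)) - a r|}) := by
          refine measureReal_mono (fun ω hω => ?_) (measure_ne_top _ _)
          simp only [mem_ofPred_eq, not_forall, not_le] at hω
          obtain ⟨r, hr, hlt⟩ := hω
          exact mem_biUnion hr hlt.le
      _ ≤ ∑ r ∈ Finset.range (2 * p + 1),
          P.real {ω | η ≤ |∑ j, oneSidedMoment K r (d * ((τ j ω - t) / h)) - a r|} :=
          measureReal_biUnion_finset_le _ _
      _ ≤ _ := by
          refine (Finset.sum_le_sum fun r _ => hr r).trans_eq ?_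
          rw [Finset.sum_const, Finset.card_range, nsmul_eq_mul]
          push_cast
          ring

end Hoeffding

open scoped ENNReal

variable {Ω : Type*} [MeasurableSpace Ω] {P : Measure Ω}

/-! ### Processes evaluated at random times -/

section RandomTimes

variable {A : Set ℝ} {s₀ : ℝ} {τ : Ω → ℝ}

/-- A process with continuous paths, evaluated at a random time, is measurable. -/
lemma aemeasurable_eval {X : ℝ → Ω → ℝ} (hs₀ : s₀ ∈ A) (hX : ∀ s ∈ A, Measurable (X s))
    (hcont : ∀ᵐ ω ∂P, ContinuousOn (fun s => X s ω) A) (hτ : Measurable τ)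
    (hmem : ∀ᵐ ω ∂P, τ ω ∈ A) : AEMeasurable (fun ω => X (τ ω) ω) P := by
  classical
  let φ : ℕ → SimpleFunc ℝ ℝ := fun k => SimpleFunc.approxOn id measurable_id A s₀ hs₀ k
  have hφ : ∀ k s, φ k s ∈ A := fun k s => SimpleFunc.approxOn_mem measurable_id hs₀ k s
  refine aemeasurable_of_tendsto_metrizable_ae atTop (f := fun k ω => X (φ k (τ ω)) ω)
    (fun k => ?_) ?_
  -- Extension by zero, because measurability of `X s` is available only for `s ∈ A`, while binding
  -- a simple function requires it for every `s`.
  · let Y : ℝ → Ω → ℝ := fun s => if s ∈ A then X s else fun _ => 0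
    have hY : ∀ s, Measurable (Y s) := by
      intro s
      by_cases hs : s ∈ A
      · simp only [Y, hs, if_true]; exact hX s hs
      · simp only [Y, hs, if_false]; exact measurable_const
    have h1 : Measurable fun ω => Y ((φ k).comp τ hτ ω) ω := SimpleFunc.measurable_bind _ Y hY
    have h2 : (fun ω => X (φ k (τ ω)) ω) = fun ω => Y ((φ k).comp τ hτ ω) ω := by
      funext ω
      simp [Y, hφ k (τ ω)]
    rw [h2]
    exact h1.aemeasurable
  · filter_upwards [hcont, hmem] with ω hω hτω
    have h1 : Tendsto (fun k => φ k (τ ω)) atTop (𝓝 (τ ω)) :=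
      SimpleFunc.tendsto_approxOn measurable_id hs₀ (subset_closure hτω)
    exact (hω (τ ω) hτω).tendsto.comp
      (tendsto_nhdsWithin_iff.2 ⟨h1, Eventually.of_forall fun k => hφ k _⟩)

/-- The mean of a nonnegative process with continuous paths at an independent random time is
bounded by the supremum of the means at fixed times. -/
lemma lintegral_mul_eval_le {g : ℝ → Ω → ℝ≥0∞} {w : ℝ → ℝ≥0∞} {C : ℝ≥0∞} (hs₀ : s₀ ∈ A)
    (hg : ∀ s ∈ A, Measurable (g s)) (hcont : ∀ᵐ ω ∂P, ContinuousOn (fun s => g s ω) A)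
    (hτ : Measurable τ) (hw : Measurable w) (hmem : ∀ᵐ ω ∂P, w (τ ω) ≠ 0 → τ ω ∈ A)
    (hwtop : ∀ s, w s ≠ ∞)
    (hind : ∀ s ∈ A, IndepFun τ (g s) P) (hC : ∀ s ∈ A, ∫⁻ ω, g s ω ∂P ≤ C) :
    ∫⁻ ω, w (τ ω) * g (τ ω) ω ∂P ≤ (∫⁻ ω, w (τ ω) ∂P) * C := by
  classical
  let φ : ℕ → SimpleFunc ℝ ℝ := fun k => SimpleFunc.approxOn id measurable_id A s₀ hs₀ k
  have hφ : ∀ k s, φ k s ∈ A := fun k s => SimpleFunc.approxOn_mem measurable_id hs₀ k s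
  -- The time is discretized to values in `A`, and the integrand splits according to these finitely
  -- many values. Independence factorizes each piece; continuity of the paths and Fatou's lemma
  -- remove the discretization.
  let u : ℕ → ℝ → ℝ → ℝ≥0∞ := fun k s x => ((φ k) ⁻¹' {s}).indicator w x
  have hu : ∀ k s, Measurable (u k s) := fun k s => hw.indicator ((φ k).measurableSet_preimage _)
  have hsum : ∀ k ω, w (τ ω) * g (φ k (τ ω)) ω =
      ∑ s ∈ (φ k).range, u k s (τ ω) * g s ω := by
    intro k ω
    rw [Finset.sum_eq_single (φ k (τ ω))]
    · simp [u]
    · intro s _ hs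
      have : τ ω ∉ (φ k) ⁻¹' {s} := fun h => hs (by simpa using h.symm)
      simp [u, this]
    · intro h
      exact absurd (SimpleFunc.mem_range_self _ _) h
  have hrange : ∀ k, ∀ s ∈ (φ k).range, s ∈ A := by
    intro k s hs
    obtain ⟨x, rfl⟩ := SimpleFunc.mem_range.1 hs
    exact hφ k x
  have hmeas : ∀ k, Measurable fun ω => w (τ ω) * g (φ k (τ ω)) ω := by
    intro k
    simp only [hsum]
    exact Finset.measurable_fun_sum _ fun s hs => ((hu k s).comp hτ).mul (hg s (hrange k s hs))
  have hk : ∀ k, ∫⁻ ω, w (τ ω) * g (φ k (τ ω)) ω ∂P ≤ (∫⁻ ω, w (τ ω) ∂P) * C := by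
    intro k
    simp only [hsum]
    have hadd : ∫⁻ ω, ∑ s ∈ (φ k).range, u k s (τ ω) * g s ω ∂P =
        ∑ s ∈ (φ k).range, ∫⁻ ω, u k s (τ ω) * g s ω ∂P :=
      lintegral_finsetSum' _ fun s hs =>
        (((hu k s).comp hτ).mul (hg s (hrange k s hs))).aemeasurable
    rw [hadd]
    calc ∑ s ∈ (φ k).range, ∫⁻ ω, u k s (τ ω) * g s ω ∂P
        ≤ ∑ s ∈ (φ k).range, (∫⁻ ω, u k s (τ ω) ∂P) * C := by
          refine Finset.sum_le_sum fun s hs => ?_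
          have := lintegral_mul_eq_lintegral_mul_lintegral_of_indepFun
            ((hu k s).comp hτ) (hg s (hrange k s hs))
            ((hind s (hrange k s hs)).comp (hu k s) measurable_id)
          simp only [Pi.mul_apply, Function.comp_apply] at this
          rw [this]
          exact mul_le_mul_right (hC s (hrange k s hs)) _
      _ = (∫⁻ ω, w (τ ω) ∂P) * C := by
          have hadd : ∫⁻ ω, ∑ s ∈ (φ k).range, u k s (τ ω) ∂P =
              ∑ s ∈ (φ k).range, ∫⁻ ω, u k s (τ ω) ∂P :=
            lintegral_finsetSum' _ fun s _ => ((hu k s).comp hτ).aemeasurable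
          rw [← Finset.sum_mul, ← hadd]
          congr 2
          funext ω
          rw [Finset.sum_eq_single (φ k (τ ω))]
          · simp [u]
          · intro s _ hs
            have : τ ω ∉ (φ k) ⁻¹' {s} := fun h => hs (by simpa using h.symm)
            simp [u, this]
          · intro h
            exact absurd (SimpleFunc.mem_range_self _ _) h
  have hlim : ∫⁻ ω, liminf (fun k => w (τ ω) * g (φ k (τ ω)) ω) atTop ∂P ≤
      (∫⁻ ω, w (τ ω) ∂P) * C :=
    (lintegral_liminf_le hmeas).trans (liminf_le_of_frequently_le' (Frequently.of_forall hk))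
  refine (lintegral_mono_ae ?_).trans hlim
  filter_upwards [hcont, hmem] with ω hω hτω
  by_cases h0 : w (τ ω) = 0
  · simp [h0]
  have hA := hτω h0
  have h1 : Tendsto (fun k => φ k (τ ω)) atTop (𝓝 (τ ω)) :=
    SimpleFunc.tendsto_approxOn measurable_id hs₀ (subset_closure hA)
  have h2 : Tendsto (fun k => g (φ k (τ ω)) ω) atTop (𝓝 (g (τ ω) ω)) :=
    (hω (τ ω) hA).tendsto.comp
      (tendsto_nhdsWithin_iff.2 ⟨h1, Eventually.of_forall fun k => hφ k _⟩)
  exact (ENNReal.Tendsto.const_mul h2 (Or.inr (hwtop _))).liminf_eq.ge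

end RandomTimes

/-! ### Second moments -/

section SecondMoments

variable {X : ℝ → Ω → ℝ} {T : Set ℝ} {Γ : ℝ → ℝ → ℝ}

lemma IsSP.integral_mul [IsProbabilityMeasure P] (hX : IsSP P X T (fun _ => 0) Γ) {s t : ℝ}
    (hs : s ∈ T) (ht : t ∈ T) : ∫ ω, X s ω * X t ω ∂P = Γ s t := by
  rw [← hX.cov s hs t ht, covariance_eq_sub (hX.memLp_two s hs) (hX.memLp_two t ht), hX.mean s hs]
  simp

lemma IsSP.integrable_mul (hX : IsSP P X T (fun _ => 0) Γ) {s t : ℝ}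
    (hs : s ∈ T) (ht : t ∈ T) : Integrable (fun ω => X s ω * X t ω) P :=
  (hX.memLp_two s hs).integrable_mul (hX.memLp_two t ht)

lemma IsSP.integral_sum_mul_sq [IsProbabilityMeasure P] (hX : IsSP P X T (fun _ => 0) Γ)
    {ι : Type*} [Fintype ι] (w : ι → ℝ) {y : ι → ℝ} (hy : ∀ i, y i ∈ T) :
    ∫ ω, (∑ i, w i * X (y i) ω) ^ 2 ∂P = ∑ i, w i * ∑ j, w j * Γ (y i) (y j) := by
  have h1 : ∀ ω, (∑ i, w i * X (y i) ω) ^ 2 =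
      ∑ i, ∑ j, w i * w j * (X (y i) ω * X (y j) ω) := by
    intro ω
    rw [pow_two, Finset.sum_mul_sum]
    exact Finset.sum_congr rfl fun i _ => Finset.sum_congr rfl fun j _ => by ring
  simp_rw [h1]
  have hint : ∀ i j, Integrable (fun ω => w i * w j * (X (y i) ω * X (y j) ω)) P :=
    fun i j => (hX.integrable_mul (hy i) (hy j)).const_mul _
  rw [integral_finsetSum _ fun i _ => integrable_finsetSum _ fun j _ => hint i j]
  refine Finset.sum_congr rfl fun i _ => ?_
  rw [integral_finsetSum _ fun j _ => hint i j, Finset.mul_sum]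
  refine Finset.sum_congr rfl fun j _ => ?_
  rw [integral_const_mul, hX.integral_mul (hy i) (hy j)]
  ring

lemma IsSP.memLp_sum_mul (hX : IsSP P X T (fun _ => 0) Γ)
    {ι : Type*} [Fintype ι] (w : ι → ℝ) {y : ι → ℝ} (hy : ∀ i, y i ∈ T) :
    MemLp (fun ω => ∑ i, w i * X (y i) ω) 2 P :=
  memLp_finsetSum _ fun i _ => (hX.memLp_two (y i) (hy i)).const_mul (w i)

lemma IsSP.lintegral_sum_mul_sq [IsProbabilityMeasure P] (hX : IsSP P X T (fun _ => 0) Γ)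
    {ι : Type*} [Fintype ι] (w : ι → ℝ) {y : ι → ℝ} (hy : ∀ i, y i ∈ T) :
    ∫⁻ ω, ENNReal.ofReal ((∑ i, w i * X (y i) ω) ^ 2) ∂P =
      ENNReal.ofReal (∑ i, w i * ∑ j, w j * Γ (y i) (y j)) := by
  rw [← hX.integral_sum_mul_sq w hy, ofReal_integral_eq_lintegral_ofReal
    (hX.memLp_sum_mul w hy).integrable_sq (ae_of_all _ fun ω => sq_nonneg _)]

end SecondMoments

/-- Points outside the kernel window carry no weight, so a bound of the noise variance is needed
only inside it. -/
lemma lpkCoef_eq_zero {p m : ℕ} {K : ℝ → ℝ} {h t : ℝ} {τ : Fin m → ℝ} {j : Fin m}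
    (hj : K ((τ j - t) / h) = 0) : lpkCoef p K h τ t j = 0 := by
  rw [lpkCoef, Matrix.mul_apply]
  refine Finset.sum_eq_zero fun r _ => ?_
  rw [lpkWeight, Matrix.mul_diagonal, scaledKernel, hj]
  simp

lemma IsKernel.lintegral_comp {K : ℝ → ℝ} {B : ℝ} (hK : IsKernel K B) {h : ℝ} (hh : 0 < h) (t : ℝ) :
    ∫⁻ x, ENNReal.ofReal (K ((x - t) / h)) = ENNReal.ofReal h := by
  have hint : Integrable K := by
    by_contra hn
    have := hK.integral
    rw [integral_undef hn] at this
    exact zero_ne_one this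
  have h1 : Integrable fun x => K ((x - t) / h) := (hint.comp_div hh.ne').comp_sub_right t
  rw [← ofReal_integral_eq_lintegral_ofReal h1 (ae_of_all _ fun x => hK.nonneg _),
    integral_sub_right_eq_self (fun x => K (x / h)) t, Measure.integral_comp_div, hK.integral,
    smul_eq_mul, mul_one, abs_of_pos hh]

/-! ### The law of the design and the errors given the design. -/

namespace FunctionalData

variable {D : FunctionalData Ω}

section Design

lemma IsModel.measurable_design [IsFiniteMeasure P] (hD : D.IsModel P) (n : ℕ) (q : D.Obs n) :
    Measurable fun ω => D.design n ω q :=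
  (measurable_pi_apply q).comp (hD.design_measurable n)

lemma IsModel.measurable_err [IsFiniteMeasure P] (hD : D.IsModel P) (n : ℕ) (q : D.Obs n) :
    Measurable fun ω => D.err n ω q :=
  (measurable_pi_apply q).comp (hD.err_measurable n)

variable {p : ℕ} {K : ℝ → ℝ} {h : ℕ → ℝ} {π : ℝ → ℝ} {δ : ℝ} {J : Set ℝ}

lemma ConditionA.ae_of_ae_volume [IsFiniteMeasure P] (hD : D.IsModel P)
    (hA : D.ConditionA P p K h π δ J) {n : ℕ}
    (q : D.Obs n) {A : ℝ → Prop} (hAe : ∀ᵐ x ∂(volume.restrict D.T), A x) :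
    ∀ᵐ ω ∂P, A (D.design n ω q) := by
  have h1 : ∀ᵐ x ∂(P.map fun ω => D.design n ω q), A x := by
    rw [hA.design_law n q]
    exact (withDensity_absolutelyContinuous _ _).ae_le hAe
  exact ae_of_ae_map (hD.measurable_design n q).aemeasurable h1

/-- End points are null for the design law. Almost surely the design therefore lies in `J`,
whichever end points `J` contains. -/
lemma ConditionA.ae_mem_Ioo [IsFiniteMeasure P] (hD : D.IsModel P)
    (hA : D.ConditionA P p K h π δ J) (n : ℕ) :
    ∀ᵐ ω ∂P, ∀ q : D.Obs n, D.design n ω q ∈ Ioo D.a D.b := by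
  refine ae_all_iff.2 fun q => hA.ae_of_ae_volume hD q ?_
  rw [← restrict_Ioo_eq_restrict_Icc]
  exact ae_restrict_mem measurableSet_Ioo

/-- Independent points with nonatomic laws almost surely do not coincide. This matters because
errors of one subject are uncorrelated only at different times. -/
lemma ConditionA.ae_injective [IsProbabilityMeasure P] (hD : D.IsModel P)
    (hA : D.ConditionA P p K h π δ J) (n : ℕ) :
    ∀ᵐ ω ∂P, Function.Injective (D.design n ω) := by
  have h1 : ∀ᵐ ω ∂P, ∀ q q' : D.Obs n, q ≠ q' → D.design n ω q ≠ D.design n ω q' := by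
    refine ae_all_iff.2 fun q => ae_all_iff.2 fun q' => ?_
    by_cases hq : q = q'
    · exact ae_of_all _ fun ω h => absurd hq h
    have hind := (hA.design_indep n).indepFun hq
    have hm := hD.measurable_design n
    have hlaw := (indepFun_iff_map_prod_eq_prod_map_map (hm q).aemeasurable
      (hm q').aemeasurable).1 hind
    have hprob : IsProbabilityMeasure (P.map fun ω => D.design n ω q') :=
      Measure.isProbabilityMeasure_map (hm q').aemeasurable
    have hnull : ∀ᵐ x ∂(P.map fun ω => (D.design n ω q, D.design n ω q')), x.1 ≠ x.2 := by
      rw [hlaw, ae_iff]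
      simp only [ne_eq, not_not]
      rw [Measure.measure_prod_null (measurableSet_eq_fun measurable_fst measurable_snd)]
      refine ae_of_all _ fun x => ?_
      have : Prod.mk x ⁻¹' {a : ℝ × ℝ | a.1 = a.2} = {x} := by
        ext y; simp [eq_comm]
      beta_reduce
      rw [this, hA.design_law n q']
      exact (withDensity_absolutelyContinuous _ _) (Measure.absolutelyContinuous_of_le
        Measure.restrict_le_self (measure_singleton x))
    have := ae_of_ae_map ((hm q).prodMk (hm q')).aemeasurable hnull
    filter_upwards [this] with ω hω _ using hω
  filter_upwards [h1] with ω hω q q' hqq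
  by_contra hne
  exact hω q q' hne hqq

lemma ConditionA.aemeasurable_density (hA : D.ConditionA P p K h π δ J)
    (hJ : Ioo D.a D.b ⊆ J) :
    AEMeasurable (fun x => ENNReal.ofReal (π x)) (volume.restrict D.T) := by
  have h1 : AEMeasurable π (volume.restrict (Ioo D.a D.b)) :=
    (hA.π_smooth.continuousOn.mono hJ).aemeasurable measurableSet_Ioo
  rw [restrict_Ioo_eq_restrict_Icc] at h1
  exact h1.ennreal_ofReal

/-- The expected number of design points in a kernel window. -/
lemma ConditionA.lintegral_kernel_le [IsFiniteMeasure P] {B : ℝ} (hK : IsKernel K B)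
    (hD : D.IsModel P) (hA : D.ConditionA P p K h π δ J) (hJ : Ioo D.a D.b ⊆ J) {n : ℕ}
    (q : D.Obs n) {t π₁ b : ℝ} (hb : 0 < b)
    (hπ : ∀ x ∈ Ioo D.a D.b, |x - t| ≤ b → π x ≤ π₁) :
    ∫⁻ ω, ENNReal.ofReal (K ((D.design n ω q - t) / b)) ∂P ≤ ENNReal.ofReal (π₁ * b) := by
  have hmeas : Measurable fun x => ENNReal.ofReal (K ((x - t) / b)) :=
    (hK.measurable.comp (by fun_prop)).ennreal_ofReal
  have h1 : ∫⁻ ω, ENNReal.ofReal (K ((D.design n ω q - t) / b)) ∂P =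
      ∫⁻ x, ENNReal.ofReal (K ((x - t) / b)) ∂(P.map fun ω => D.design n ω q) :=
    (lintegral_map hmeas (hD.measurable_design n q)).symm
  rw [h1, hA.design_law n q, lintegral_withDensity_eq_lintegral_mul₀
    (hA.aemeasurable_density hJ) hmeas.aemeasurable]
  have h2 : ∫⁻ x in D.T, ((fun x => ENNReal.ofReal (π x)) *
      fun x => ENNReal.ofReal (K ((x - t) / b))) x ≤
      ∫⁻ x in D.T, ENNReal.ofReal π₁ * ENNReal.ofReal (K ((x - t) / b)) := by
    rw [← restrict_Ioo_eq_restrict_Icc]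
    refine setLIntegral_mono_ae' measurableSet_Ioo (ae_of_all _ fun x hx => ?_)
    simp only [Pi.mul_apply]
    by_cases h0 : K ((x - t) / b) = 0
    · simp [h0]
    · have : |x - t| ≤ b := by
        by_contra! hlt
        refine h0 (hK.support _ ?_)
        rwa [abs_div, abs_of_pos hb, lt_div_iff₀ hb, one_mul]
      gcongr
      exact hπ x hx this
  refine h2.trans ((setLIntegral_le_lintegral _ _).trans_eq ?_)
  rw [lintegral_const_mul _ hmeas, hK.lintegral_comp hb, ← ENNReal.ofReal_mul' hb.le]

/-- This supplies the domination hypothesis of `IsKernel.exists_good_designs`, with `A` a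
half-window on which the density is bounded below. -/
lemma ConditionA.smul_restrict_le_law (hA : D.ConditionA P p K h π δ J) {n : ℕ} (q : D.Obs n)
    {A : Set ℝ} (hAm : MeasurableSet A) (hAT : A ⊆ D.T) {π₀ : ℝ} (hπ : ∀ x ∈ A, π₀ ≤ π x) :
    ENNReal.ofReal π₀ • volume.restrict A ≤ P.map fun ω => D.design n ω q := by
  rw [hA.design_law n q]
  have h1 : ENNReal.ofReal π₀ • volume.restrict A =
      (volume.restrict D.T).withDensity (A.indicator fun _ => ENNReal.ofReal π₀) := by
    rw [withDensity_indicator hAm, withDensity_const, Measure.restrict_restrict hAm,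
      inter_eq_left.2 hAT]
  rw [h1]
  refine withDensity_mono (ae_of_all _ fun x => ?_)
  by_cases hx : x ∈ A
  · rw [indicator_of_mem hx]
    exact ENNReal.ofReal_le_ofReal (hπ x hx)
  · rw [indicator_of_notMem hx]
    exact zero_le

/-- Given the design points, the errors are distributed as the error processes at fixed times. -/
lemma IsModel.lintegral_design_err [IsProbabilityMeasure P] (hD : D.IsModel P) (n : ℕ)
    (hmem : ∀ᵐ ω ∂P, ∀ q : D.Obs n, D.design n ω q ∈ D.T)
    {F : (D.Obs n → ℝ) → (D.Obs n → ℝ) → ℝ≥0∞} (hF : Measurable (Function.uncurry F)) :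
    ∫⁻ ω, F (D.design n ω) (D.err n ω) ∂P =
      ∫⁻ ω, ∫⁻ ω', F (D.design n ω) (fun q => D.ε q.1 (D.design n ω q) ω') ∂P ∂P := by
  have hd := hD.design_measurable n
  have he := hD.err_measurable n
  have h1 : ∫⁻ ω, F (D.design n ω) (D.err n ω) ∂P =
      ∫⁻ x, Function.uncurry F x ∂(P.map fun ω => (D.design n ω, D.err n ω)) := by
    rw [lintegral_map hF (hd.prodMk he)]
    rfl
  -- The joint law is disintegrated over the design; the model then identifies the conditional law
  -- of the errors.
  rw [h1, ← compProd_map_condDistrib he.aemeasurable, Measure.lintegral_compProd hF,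
    lintegral_map (hF.lintegral_kernel_prod_right') hd]
  refine lintegral_congr_ae ?_
  filter_upwards [hmem, ae_of_ae_map hd.aemeasurable (hD.err_given_design n)] with ω hω hω2
  have hεm : Measurable fun ω' (q : D.Obs n) => D.ε q.1 (D.design n ω q) ω' :=
    measurable_pi_lambda _ fun q => (hD.ε_sp q.1).measurable _ (hω q)
  have hFm : Measurable fun e => Function.uncurry F (D.design n ω, e) :=
    hF.comp measurable_prodMk_left
  rw [hω2, lintegral_map hFm hεm]
  rfl

end Design

end FunctionalData

/-- `f` is `m` times differentiable on `I`, with `m`-th derivative bounded by `M`. -/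
def HasBoundedDeriv (m : ℕ) (f : ℝ → ℝ) (I : Set ℝ) (M : ℝ) : Prop :=
  ∃ e : ℕ → ℝ → ℝ, e 0 = f ∧
    (∀ k < m, ∀ x ∈ I, HasDerivWithinAt (e k) (e (k + 1) x) I x) ∧ ∀ x ∈ I, |e m x| ≤ M

/-- `γ` is `m` times differentiable in each variable on `I × I`, and the mixed derivative of
order `(m, m)` is bounded by `M`. -/
def HasBoundedMixedDeriv (m : ℕ) (γ : ℝ → ℝ → ℝ) (I : Set ℝ) (M : ℝ) : Prop :=
  ∃ G : ℕ → ℕ → ℝ → ℝ → ℝ, G 0 0 = γ ∧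
    (∀ k < m, ∀ l ≤ m, ∀ x ∈ I, ∀ y ∈ I,
      HasDerivWithinAt (fun z => G k l z y) (G (k + 1) l x y) I x) ∧
    (∀ k ≤ m, ∀ l < m, ∀ x ∈ I, ∀ y ∈ I,
      HasDerivWithinAt (fun z => G k l x z) (G k (l + 1) x y) I y) ∧
    ∀ x ∈ I, ∀ y ∈ I, |G m m x y| ≤ M

lemma HasBoundedDeriv.mono {m : ℕ} {f : ℝ → ℝ} {I I' : Set ℝ} {M : ℝ}
    (hf : HasBoundedDeriv m f I M) (hI : I' ⊆ I) : HasBoundedDeriv m f I' M := by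
  obtain ⟨e, h0, h1, h2⟩ := hf
  exact ⟨e, h0, fun k hk x hx => (h1 k hk x (hI hx)).mono hI, fun x hx => h2 x (hI hx)⟩

lemma HasBoundedMixedDeriv.mono {m : ℕ} {γ : ℝ → ℝ → ℝ} {I I' : Set ℝ} {M : ℝ}
    (hf : HasBoundedMixedDeriv m γ I M) (hI : I' ⊆ I) : HasBoundedMixedDeriv m γ I' M := by
  obtain ⟨G, h0, h1, h2, h3⟩ := hf
  exact ⟨G, h0, fun k hk l hl x hx y hy => (h1 k hk l hl x (hI hx) y (hI hy)).mono hI,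
    fun k hk l hl x hx y hy => (h2 k hk l hl x (hI hx) y (hI hy)).mono hI,
    fun x hx y hy => h3 x (hI hx) y (hI hy)⟩

lemma exists_hasBoundedDeriv {m : ℕ} {f : ℝ → ℝ} {J I : Set ℝ}
    (hf : ContDiffOn ℝ (m : WithTop ℕ∞) f J) (hJ : UniqueDiffOn ℝ J) (hI : IsCompact I)
    (hIJ : I ⊆ J) : ∃ M, HasBoundedDeriv m f I M := by
  obtain ⟨M, hM⟩ := hI.exists_bound_of_continuousOn
    ((hf.continuousOn_iteratedDerivWithin le_rfl hJ).mono hIJ)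
  refine ⟨M, fun k => iteratedDerivWithin k f J, iteratedDerivWithin_zero, fun k hk x hx => ?_, hM⟩
  have h1 := (hf.differentiableOn_iteratedDerivWithin (by exact_mod_cast hk) hJ x
    (hIJ hx)).hasDerivWithinAt
  simp only [iteratedDerivWithin_succ]
  exact h1.mono hIJ

lemma exists_hasBoundedMixedDeriv {m : ℕ} {γ : ℝ → ℝ → ℝ} {J I : Set ℝ}
    (hγ : HasContMixedPartials m γ J) (hI : IsCompact I) (hIJ : I ⊆ J) :
    ∃ M, HasBoundedMixedDeriv m γ I M := by
  obtain ⟨G, h0, hc, h1, h2⟩ := hγ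
  obtain ⟨M, hM⟩ := (hI.prod hI).exists_bound_of_continuousOn
    ((hc m le_rfl m le_rfl).mono (prod_mono hIJ hIJ))
  exact ⟨M, G, h0, fun k hk l hl x hx y hy => (h1 k hk l hl x (hIJ hx) y (hIJ hy)).mono hIJ,
    fun k hk l hl x hx y hy => (h2 k hk l hl x (hIJ hx) y (hIJ hy)).mono hIJ,
    fun x hx y hy => hM (x, y) ⟨hx, hy⟩⟩

/-- The bound for the sum of the absolute values of the interpolation coefficients. -/
def interpBound (p : ℕ) : ℝ := 1 + (p + 1) * (2 * (p + 1)) ^ p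

/-! ### The mean squared error of one reconstruction. -/

namespace FunctionalData

variable {D : FunctionalData Ω}

/-- The interpolation error of an individual function. -/
def interpError (D : FunctionalData Ω) {p : ℕ} (x : Fin (p + 1) → ℝ) (l : Fin (p + 1) → ℝ → ℝ)
    (i : ℕ) (s : ℝ) (ω : Ω) : ℝ :=
  D.f i s ω - ∑ k, l k s * D.f i (x k) ω

lemma IsModel.measurable_v [IsFiniteMeasure P] (hD : D.IsModel P) (i : ℕ) {s : ℝ} (hs : s ∈ D.T) :
    Measurable (D.v i s) := (hD.v_sp i).measurable s hs

lemma IsModel.measurable_f [IsFiniteMeasure P] (hD : D.IsModel P) (i : ℕ) {s : ℝ} (hs : s ∈ D.T) :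
    Measurable (D.f i s) := (hD.measurable_v i hs).const_add _

lemma IsModel.measurable_interpError [IsFiniteMeasure P] (hD : D.IsModel P) {p : ℕ}
    {x : Fin (p + 1) → ℝ} (hx : ∀ k, x k ∈ D.T) (l : Fin (p + 1) → ℝ → ℝ) (i : ℕ) {s : ℝ}
    (hs : s ∈ D.T) : Measurable (D.interpError x l i s) :=
  (hD.measurable_f i hs).sub
    (Finset.measurable_fun_sum _ fun k _ => (hD.measurable_f i (hx k)).const_mul _)

/-- The mean squared interpolation error. -/
lemma IsModel.lintegral_interpError_sq_le [IsProbabilityMeasure P] (hD : D.IsModel P) {p : ℕ}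
    {I : Set ℝ} (hI : Convex ℝ I) (hIT : I ⊆ D.T) {M t h : ℝ} (ht : t ∈ I) (hh : 0 ≤ h)
    (hη : HasBoundedDeriv (p + 1) D.η I M) (hγ : HasBoundedMixedDeriv (p + 1) D.γ I M)
    {x : Fin (p + 1) → ℝ} {l : Fin (p + 1) → ℝ → ℝ} (hx : ∀ k, x k ∈ I)
    (hxt : ∀ k, |x k - t| ≤ h) {s : ℝ} (hs : s ∈ I) (hst : |s - t| ≤ h)
    (hl : ∀ r < p + 1, ∑ k, l k s * (x k - t) ^ r = (s - t) ^ r)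
    (hlb : ∑ k, |l k s| ≤ (p + 1) * (2 * (p + 1)) ^ p) (i : ℕ) :
    ∫⁻ ω, ENNReal.ofReal (D.interpError x l i s ω ^ 2) ∂P ≤
      ENNReal.ofReal (2 * (interpBound p ^ 2 * (M ^ 2 + M)) * (h ^ (p + 1)) ^ 2) := by
  -- The interpolation error as one functional: weight `1` at `s` (the point `none`) and `-l k s` at
  -- the nodes. It annihilates polynomials of degree at most `p`.
  let w : Option (Fin (p + 1)) → ℝ := fun o => o.elim 1 fun k => -l k s
  let y : Option (Fin (p + 1)) → ℝ := fun o => o.elim s x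
  have hy : ∀ o, y o ∈ I := by rintro (_ | k); exacts [hs, hx k]
  have hyt : ∀ o, |y o - t| ≤ h := by rintro (_ | k); exacts [hst, hxt k]
  have hw : ∀ k < p + 1, ∑ o, w o * (y o - t) ^ k = 0 := by
    intro r hr
    rw [Fintype.sum_option]
    simp only [w, y, Option.elim_none, Option.elim_some, one_mul, neg_mul, Finset.sum_neg_distrib]
    rw [hl r hr, add_neg_cancel]
  have hΛ : ∑ o, |w o| ≤ interpBound p := by
    rw [Fintype.sum_option, interpBound]
    simp only [w, Option.elim_none, Option.elim_some, abs_one, abs_neg]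
    linarith
  obtain ⟨e, he0, he1, he2⟩ := hη
  obtain ⟨G, hG0, hG1, hG2, hG3⟩ := hγ
  have h1 := abs_sum_mul_le_of_annihilates hI ht hh he1 he2 hy hyt hw hΛ
  have h2 := abs_sum_sum_mul_le_of_annihilates hI ht hh hG1 hG2 hG3 hy hyt hw hΛ
  rw [he0] at h1
  rw [hG0] at h2
  have hdec : ∀ ω, D.interpError x l i s ω =
      ∑ o, w o * D.η (y o) + ∑ o, w o * D.v i (y o) ω := by
    intro ω
    rw [← Finset.sum_add_distrib, Fintype.sum_option]
    simp only [w, y, Option.elim_none, Option.elim_some, interpError, f, neg_mul, one_mul, mul_add,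
      Finset.sum_add_distrib, Finset.sum_neg_distrib]
    ring
  calc ∫⁻ ω, ENNReal.ofReal (D.interpError x l i s ω ^ 2) ∂P
      ≤ ∫⁻ ω, (ENNReal.ofReal (2 * (interpBound p * M * h ^ (p + 1)) ^ 2) +
          2 * ENNReal.ofReal ((∑ o, w o * D.v i (y o) ω) ^ 2)) ∂P := by
        refine lintegral_mono fun ω => ?_
        rw [hdec, ← ENNReal.ofReal_ofNat, ← ENNReal.ofReal_mul zero_le_two,
          ← ENNReal.ofReal_add (by positivity) (by positivity)]
        refine ENNReal.ofReal_le_ofReal ?_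
        have h3 : (∑ o, w o * D.η (y o)) ^ 2 ≤ (interpBound p * M * h ^ (p + 1)) ^ 2 :=
          sq_le_sq' (abs_le.1 h1).1 (abs_le.1 h1).2
        nlinarith [sq_nonneg ((∑ o, w o * D.η (y o)) - ∑ o, w o * D.v i (y o) ω)]
    _ = ENNReal.ofReal (2 * (interpBound p * M * h ^ (p + 1)) ^ 2) +
          2 * ENNReal.ofReal (∑ o, w o * ∑ o', w o' * D.γ (y o) (y o')) := by
        rw [lintegral_add_left measurable_const, lintegral_const, measure_univ, mul_one,
          lintegral_const_mul' _ _ (by simp),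
          (hD.v_sp i).lintegral_sum_mul_sq w fun o => hIT (hy o)]
    _ ≤ _ := by
        rw [← ENNReal.ofReal_ofNat, ← ENNReal.ofReal_mul zero_le_two]
        have hM0 : 0 ≤ M := (abs_nonneg _).trans (he2 t ht)
        refine (add_le_add_right (ENNReal.ofReal_le_ofReal
          (mul_le_mul_of_nonneg_left (abs_le.1 h2).2 zero_le_two)) _).trans ?_
        rw [← ENNReal.ofReal_add (by positivity) (by positivity)]
        refine ENNReal.ofReal_le_ofReal (le_of_eq ?_)
        ring

variable {p : ℕ} {K : ℝ → ℝ} {h : ℕ → ℝ} {π : ℝ → ℝ} {δ : ℝ} {J : Set ℝ}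

lemma ConditionA.ae_continuousOn_interpError [IsProbabilityMeasure P]
    (hA : D.ConditionA P p K h π δ J) {x : Fin (p + 1) → ℝ} {l : Fin (p + 1) → ℝ → ℝ}
    (hl : ∀ k, Continuous (l k)) (i : ℕ) :
    ∀ᵐ ω ∂P, ContinuousOn (fun s => D.interpError x l i s ω) J := by
  filter_upwards [hA.f_smooth i] with ω hω
  exact hω.continuousOn.sub
    (continuousOn_finsetSum _ fun k _ => (hl k).continuousOn.mul continuousOn_const)

lemma IsModel.indepFun_design_interpError [IsProbabilityMeasure P] (hD : D.IsModel P) (n : ℕ)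
    (q : D.Obs n) {x : Fin (p + 1) → ℝ} (hx : ∀ k, x k ∈ D.T) (l : Fin (p + 1) → ℝ → ℝ) (i : ℕ)
    {s : ℝ} (hs : s ∈ D.T) :
    IndepFun (fun ω => D.design n ω q)
      (fun ω => ENNReal.ofReal (D.interpError x l i s ω ^ 2)) P := by
  have h1 : Measurable fun z : ℕ → D.T → ℝ => ENNReal.ofReal (((D.η s + z i ⟨s, hs⟩) -
      ∑ k, l k s * (D.η (x k) + z i ⟨x k, hx k⟩)) ^ 2) := by fun_prop
  have h2 : Measurable fun z : (D.Obs n → ℝ) × (D.Obs n → ℝ) => z.1 q := by fun_prop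
  exact ((hD.v_indep_design n).comp h1 h2).symm

/-- The design points of subject `i`. -/
def subjectDesign (D : FunctionalData Ω) (n i : ℕ) (ω : Ω) (j : Fin (D.N n i)) : ℝ := D.t n i j ω

/-- The measurement errors of subject `i` at its design points. -/
def subjectErr (D : FunctionalData Ω) (n i : ℕ) (ω : Ω) (j : Fin (D.N n i)) : ℝ :=
  D.ε i (D.t n i j ω) ω

lemma fHat_eq (n i : ℕ) (s : ℝ) (ω : Ω) :
    D.fHat p K h n i s ω = lpk p K (h n) (D.subjectDesign n i ω)
      (fun j => D.f i (D.subjectDesign n i ω j) ω + D.subjectErr n i ω j) s := rfl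

lemma IsModel.measurable_subjectDesign [IsFiniteMeasure P] (hD : D.IsModel P) {n i : ℕ}
    (hi : i < n) : Measurable (D.subjectDesign n i) :=
  measurable_pi_lambda _ fun j => hD.measurable_design n ⟨⟨i, hi⟩, j⟩

lemma IsModel.measurable_subjectErr [IsFiniteMeasure P] (hD : D.IsModel P) {n i : ℕ}
    (hi : i < n) : Measurable (D.subjectErr n i) :=
  measurable_pi_lambda _ fun j => hD.measurable_err n ⟨⟨i, hi⟩, j⟩

lemma measurable_sum_lpkCoef_mul {m : ℕ} (hK : Measurable K) (b t : ℝ) :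
    Measurable fun z : (Fin m → ℝ) × (Fin m → ℝ) => ∑ j, lpkCoef p K b z.1 t j * z.2 j :=
  Finset.measurable_fun_sum _ fun j _ =>
    ((measurable_lpkCoef hK j).comp measurable_fst).mul
      ((measurable_pi_apply j).comp measurable_snd)

/-- The stochastic part of the error of a reconstruction. -/
lemma ConditionA.lintegral_noise_le [IsProbabilityMeasure P] {B : ℝ} (hK : IsKernel K B)
    (hD : D.IsModel P) (hA : D.ConditionA P p K h π δ J) {n i : ℕ} (hi : i < n)
    {G : Set (Fin (D.N n i) → ℝ)} (hG : MeasurableSet G) {b c t σ₁ : ℝ} (hb : 0 < b) (hc : 0 < c)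
    (hGc : ∀ x ∈ G, DesignBound p K b c x t)
    (hσ : ∀ x ∈ Ioo D.a D.b, |x - t| ≤ b → D.σsq x ≤ σ₁) (hσ₁ : 0 ≤ σ₁) :
    ∫⁻ ω, G.indicator 1 (D.subjectDesign n i ω) *
      ENNReal.ofReal (lpk p K b (D.subjectDesign n i ω) (D.subjectErr n i ω) t ^ 2) ∂P ≤
      ENNReal.ofReal (σ₁ * (c⁻¹ * B)) := by
  let F : (D.Obs n → ℝ) → (D.Obs n → ℝ) → ℝ≥0∞ := fun d e =>
    G.indicator 1 (fun j => d ⟨⟨i, hi⟩, j⟩) * ENNReal.ofReal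
      ((∑ j, lpkCoef p K b (fun j => d ⟨⟨i, hi⟩, j⟩) t j * e ⟨⟨i, hi⟩, j⟩) ^ 2)
  have hproj : Measurable fun (d : D.Obs n → ℝ) (j : Fin (D.N n i)) => d ⟨⟨i, hi⟩, j⟩ :=
    measurable_pi_lambda _ fun j => measurable_pi_apply _
  have hF : Measurable (Function.uncurry F) := by
    have e1 : Measurable fun z : (D.Obs n → ℝ) × (D.Obs n → ℝ) =>
        G.indicator (1 : (Fin (D.N n i) → ℝ) → ℝ≥0∞) (fun j => z.1 ⟨⟨i, hi⟩, j⟩) :=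
      (measurable_one.indicator hG).comp (hproj.comp measurable_fst)
    have e2 : Measurable fun z : (D.Obs n → ℝ) × (D.Obs n → ℝ) =>
        ((fun j : Fin (D.N n i) => z.1 ⟨⟨i, hi⟩, j⟩), fun j : Fin (D.N n i) => z.2 ⟨⟨i, hi⟩, j⟩) :=
      (hproj.comp measurable_fst).prodMk (hproj.comp measurable_snd)
    have e3 := (measurable_sum_lpkCoef_mul (p := p) hK.measurable b t).comp e2
    have e4 := (e3.pow_const 2).ennreal_ofReal
    exact e1.mul e4
  have hmem := hA.ae_mem_Ioo hD n
  have h1 := hD.lintegral_design_err n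
    (hmem.mono fun ω hω q => Ioo_subset_Icc_self (hω q)) hF
  have h2 : ∀ ω, G.indicator 1 (D.subjectDesign n i ω) *
      ENNReal.ofReal (lpk p K b (D.subjectDesign n i ω) (D.subjectErr n i ω) t ^ 2) =
      F (D.design n ω) (D.err n ω) := by
    intro ω
    rw [lpk_eq_sum]
    rfl
  simp_rw [h2]
  rw [h1]
  have h3 : ∀ᵐ ω ∂P, ∫⁻ ω', F (D.design n ω) (fun q => D.ε q.1 (D.design n ω q) ω') ∂P ≤
      ENNReal.ofReal (σ₁ * (c⁻¹ * B)) := by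
    filter_upwards [hmem, hA.ae_injective hD n] with ω hω hinj
    set d : Fin (D.N n i) → ℝ := fun j => D.design n ω ⟨⟨i, hi⟩, j⟩ with hd
    have hdinj : Function.Injective d := by
      intro j k hjk
      have := hinj hjk
      simpa using this
    by_cases hdG : d ∈ G
    swap
    · have : ∀ ω', F (D.design n ω) (fun q => D.ε q.1 (D.design n ω q) ω') = 0 := by
        intro ω'
        simp only [F]
        rw [indicator_of_notMem hdG, zero_mul]
      simp [this]
    have h4 : ∀ ω', F (D.design n ω) (fun q => D.ε q.1 (D.design n ω q) ω') =
        ENNReal.ofReal ((∑ j, lpkCoef p K b d t j * D.ε i (d j) ω') ^ 2) := by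
      intro ω'
      simp only [F]
      rw [indicator_of_mem hdG, Pi.one_apply, one_mul]
    simp_rw [h4]
    -- For a fixed design the second moment is a quadratic form in the error covariance, which is
    -- diagonal because the design points are distinct.
    rw [(hD.ε_sp i).lintegral_sum_mul_sq _ fun j => Ioo_subset_Icc_self (hω ⟨⟨i, hi⟩, j⟩)]
    refine ENNReal.ofReal_le_ofReal ?_
    have h5 : ∑ j, lpkCoef p K b d t j * ∑ k, lpkCoef p K b d t k *
        (if d j = d k then D.σsq (d k) else 0) ≤ ∑ j, σ₁ * lpkCoef p K b d t j ^ 2 := by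
      refine Finset.sum_le_sum fun j _ => ?_
      rw [Finset.sum_eq_single j (fun k _ hk => by simp [hdinj.ne hk.symm]) (by simp), if_pos rfl]
      by_cases h0 : K ((d j - t) / b) = 0
      · simp [lpkCoef_eq_zero h0]
      · have : |d j - t| ≤ b := by
          by_contra! hlt
          refine h0 (hK.support _ ?_)
          rwa [abs_div, abs_of_pos hb, lt_div_iff₀ hb, one_mul]
        have := hσ (d j) (hω ⟨⟨i, hi⟩, j⟩) this
        nlinarith [sq_nonneg (lpkCoef p K b d t j)]
    refine h5.trans ?_
    rw [← Finset.mul_sum]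
    exact mul_le_mul_of_nonneg_left ((hGc d hdG).sum_lpkCoef_sq_le hb hc hK.nonneg hK.le) hσ₁
  refine (lintegral_mono_ae h3).trans_eq ?_
  simp

/-- The mean of a kernel-weighted squared interpolation error. -/
lemma ConditionA.lintegral_kernel_interpError_le [IsProbabilityMeasure P] {B : ℝ}
    (hK : IsKernel K B) (hD : D.IsModel P) (hA : D.ConditionA P p K h π δ J)
    (hJ : Ioo D.a D.b ⊆ J) {n : ℕ} (q : D.Obs n) {b t π₁ M a' b' : ℝ} (hb : 0 < b)
    (hIJ : Icc a' b' ⊆ J) (hJT : J ⊆ Icc D.a D.b)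
    (hwin : ∀ x ∈ Ioo D.a D.b, |x - t| ≤ b → x ∈ Icc a' b')
    (hπ : ∀ x ∈ Icc a' b', π x ≤ π₁) (ht : t ∈ Icc a' b')
    (hη : HasBoundedDeriv (p + 1) D.η (Icc a' b') M)
    (hγ : HasBoundedMixedDeriv (p + 1) D.γ (Icc a' b') M)
    {x : Fin (p + 1) → ℝ} {l : Fin (p + 1) → ℝ → ℝ} (hx : ∀ k, x k ∈ Icc a' b')
    (hxt : ∀ k, |x k - t| ≤ b) (hlc : ∀ k, Continuous (l k))
    (hl : ∀ s, ∀ r < p + 1, ∑ k, l k s * (x k - t) ^ r = (s - t) ^ r)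
    (hlb : ∀ s, |s - t| ≤ b → ∑ k, |l k s| ≤ (p + 1) * (2 * (p + 1)) ^ p) (i : ℕ) :
    ∫⁻ ω, ENNReal.ofReal (K ((D.design n ω q - t) / b)) *
      ENNReal.ofReal (D.interpError x l i (D.design n ω q) ω ^ 2) ∂P ≤
      ENNReal.ofReal (π₁ * b) *
        ENNReal.ofReal (2 * (interpBound p ^ 2 * (M ^ 2 + M)) * (b ^ (p + 1)) ^ 2) := by
  -- Where the kernel weight is nonzero the design point lies in `A`, and at fixed times in `A` the
  -- interpolation bound holds.
  set A : Set ℝ := Icc a' b' ∩ Icc (t - b) (t + b) with hAdef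
  have hAI : A ⊆ Icc a' b' := inter_subset_left
  have hIT : Icc a' b' ⊆ D.T := hIJ.trans hJT
  have htA : t ∈ A := ⟨ht, by constructor <;> linarith⟩
  have habs : ∀ s, |s - t| ≤ b ↔ s ∈ Icc (t - b) (t + b) := fun s => by
    rw [abs_le, mem_Icc]; constructor <;> rintro ⟨h1, h2⟩ <;> constructor <;> linarith
  have hxT : ∀ k, x k ∈ D.T := fun k => hIT (hx k)
  refine (lintegral_mul_eval_le (g := fun s ω => ENNReal.ofReal (D.interpError x l i s ω ^ 2))
    (w := fun y => ENNReal.ofReal (K ((y - t) / b))) htA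
    (fun s hs => ((hD.measurable_interpError hxT l i (hIT (hAI hs))).pow_const 2).ennreal_ofReal)
    ?_ (hD.measurable_design n q) (hK.measurable.comp (by fun_prop)).ennreal_ofReal ?_
    (fun _ => ENNReal.ofReal_ne_top)
    (fun s hs => hD.indepFun_design_interpError n q hxT l i (hIT (hAI hs)))
    (fun s hs => hD.lintegral_interpError_sq_le ((convex_Icc a' b').inter (convex_Icc _ _))
      (hAI.trans hIT) htA hb.le (hη.mono hAI) (hγ.mono hAI)
      (fun k => ⟨hx k, (habs _).1 (hxt k)⟩) hxt hs ((habs _).2 hs.2) (hl s)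
      (hlb s ((habs _).2 hs.2)) i)).trans ?_
  · filter_upwards [hA.ae_continuousOn_interpError (x := x) hlc i] with ω hω
    exact ENNReal.continuous_ofReal.comp_continuousOn ((hω.mono (hAI.trans hIJ)).pow 2)
  · filter_upwards [hA.ae_mem_Ioo hD n] with ω hω hne
    have h0 : K ((D.design n ω q - t) / b) ≠ 0 := fun h0 => hne (by simp [h0])
    have : |D.design n ω q - t| ≤ b := by
      by_contra! hlt
      refine h0 (hK.support _ ?_)
      rwa [abs_div, abs_of_pos hb, lt_div_iff₀ hb, one_mul]
    exact ⟨hwin _ (hω q) this, (habs _).1 this⟩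
  · gcongr
    exact hA.lintegral_kernel_le hK hD hJ q hb fun y hy hyt => hπ y (hwin y hy hyt)

/-- The pathwise decomposition of the error of a reconstruction. -/
lemma sq_fHat_sub_f_le {B : ℝ} (hK : IsKernel K B) {n i : ℕ} {c t : ℝ} (hb : 0 < h n) (hc : 0 < c)
    {ω : Ω} (hG : DesignBound p K (h n) c (D.subjectDesign n i ω) t)
    {x : Fin (p + 1) → ℝ} {l : Fin (p + 1) → ℝ → ℝ} (hx0 : x 0 = t)
    (hv : ∀ y : Fin (p + 1) → ℝ, ∃ v : Fin (p + 1) → ℝ, v 0 = y 0 ∧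
      ∀ s, ∑ k, l k s * y k = ∑ k : Fin (p + 1), v k * (s - t) ^ (k : ℕ)) :
    (D.fHat p K h n i t ω - D.f i t ω) ^ 2 ≤
      2 * (c⁻¹ * ∑ j, K ((D.subjectDesign n i ω j - t) / h n) *
        D.interpError x l i (D.subjectDesign n i ω j) ω ^ 2) +
      2 * lpk p K (h n) (D.subjectDesign n i ω) (D.subjectErr n i ω) t ^ 2 := by
  obtain ⟨v, hv0, hvs⟩ := hv fun k => D.f i (x k) ω
  set τ := D.subjectDesign n i ω with hτ
  -- The interpolant is a polynomial of degree at most `p` with value `f i t` at `t`, so the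
  -- smoother returns this value exactly; what remains is smoothed interpolation error and smoothed
  -- noise.
  have h1 : D.fHat p K h n i t ω - D.f i t ω =
      lpk p K (h n) τ (fun j => D.interpError x l i (τ j) ω) t +
        lpk p K (h n) τ (D.subjectErr n i ω) t := by
    have h2 : lpk p K (h n) τ (fun j => D.interpError x l i (τ j) ω) t =
        lpk p K (h n) τ (fun j => D.f i (τ j) ω) t - D.f i t ω := by
      have h3 := hG.lpk_sum_pow hb hc v
      rw [hv0, hx0] at h3
      rw [← h3, ← lpk_sub]
      congr 1
      funext j
      rw [interpError, hvs]
    rw [h2, fHat_eq, lpk_add]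
    ring
  have h2 := hG.lpk_sq_le hb hc hK.nonneg fun j => D.interpError x l i (τ j) ω
  rw [h1]
  nlinarith [sq_nonneg (lpk p K (h n) τ (fun j => D.interpError x l i (τ j) ω) t -
    lpk p K (h n) τ (D.subjectErr n i ω) t)]

/-- The mean squared error of a reconstruction on the event of a well-conditioned design. -/
lemma ConditionA.lintegral_sq_fHat_sub_f_le [IsProbabilityMeasure P] {B : ℝ}
    (hK : IsKernel K B) (hD : D.IsModel P) (hA : D.ConditionA P p K h π δ J)
    (hJ : Ioo D.a D.b ⊆ J) {n i : ℕ} (hi : i < n) (hN : 0 < D.N n i) {t π₁ σ₁ M a' b' c d : ℝ}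
    (hIJ : Icc a' b' ⊆ J) (hJT : J ⊆ Icc D.a D.b)
    (hwin : ∀ x ∈ Ioo D.a D.b, |x - t| ≤ h n → x ∈ Icc a' b')
    (hπ : ∀ x ∈ Icc a' b', π x ≤ π₁) (hσ : ∀ x ∈ Icc a' b', D.σsq x ≤ σ₁) (hπ₁ : 0 ≤ π₁)
    (hσ₁ : 0 ≤ σ₁) (hM : 0 ≤ M)
    (hd : |d| = 1) (hdI : ∀ θ ∈ Icc (0 : ℝ) 1, t + d * h n * θ ∈ Icc a' b')
    (hη : HasBoundedDeriv (p + 1) D.η (Icc a' b') M)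
    (hγ : HasBoundedMixedDeriv (p + 1) D.γ (Icc a' b') M) (hc : 0 < c)
    {G : Set (Fin (D.N n i) → ℝ)} (hG : MeasurableSet G)
    (hGc : ∀ x ∈ G, DesignBound p K (h n) (c * (D.N n i * h n)) x t) :
    ∫⁻ ω, G.indicator 1 (D.subjectDesign n i ω) *
      ENNReal.ofReal ((D.fHat p K h n i t ω - D.f i t ω) ^ 2) ∂P ≤
      ENNReal.ofReal ((4 * c⁻¹ * π₁ * (interpBound p ^ 2 * (M ^ 2 + M)) + 2 * σ₁ * c⁻¹ * B) *
        ((h n ^ (p + 1)) ^ 2 + (D.N n i * h n)⁻¹)) := by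
  have hb := hA.h_pos n
  have hNp : (0 : ℝ) < D.N n i := by exact_mod_cast hN
  have hc' : 0 < c * (D.N n i * h n) := by positivity
  obtain ⟨x, l, hxθ, hlc, hx0, hl, hv, hlb⟩ := exists_interpolation p t hb hd
  have hx : ∀ k, x k ∈ Icc a' b' := fun k => by
    obtain ⟨θ, hθ, hk⟩ := hxθ k; rw [hk]; exact hdI θ hθ
  have hxt : ∀ k, |x k - t| ≤ h n := fun k => by
    obtain ⟨θ, hθ, hk⟩ := hxθ k
    rw [hk, add_sub_cancel_left, abs_mul, abs_mul, hd, abs_of_pos hb, one_mul, abs_of_nonneg hθ.1]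
    exact mul_le_of_le_one_right hb.le hθ.2
  have ht : t ∈ Icc a' b' := by rw [← hx0]; exact hx 0
  set CR := ENNReal.ofReal (2 * (interpBound p ^ 2 * (M ^ 2 + M)) * (h n ^ (p + 1)) ^ 2) with hCR
  have hbias : ∀ j : Fin (D.N n i), ∫⁻ ω, ENNReal.ofReal (K ((D.subjectDesign n i ω j - t) / h n)) *
      ENNReal.ofReal (D.interpError x l i (D.subjectDesign n i ω j) ω ^ 2) ∂P ≤
      ENNReal.ofReal (π₁ * h n) * CR := fun j =>
    hA.lintegral_kernel_interpError_le hK hD hJ ⟨⟨i, hi⟩, j⟩ hb hIJ hJT hwin hπ ht hη hγ hx hxt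
      hlc hl hlb i
  have hnoise := hA.lintegral_noise_le hK hD hi hG hb hc' hGc
    (fun x hx hxt => hσ x (hwin x hx hxt)) hσ₁
  have haem : ∀ j : Fin (D.N n i), AEMeasurable
      (fun ω => ENNReal.ofReal (K ((D.subjectDesign n i ω j - t) / h n)) *
      ENNReal.ofReal (D.interpError x l i (D.subjectDesign n i ω j) ω ^ 2)) P := by
    intro j
    have hτ := hD.measurable_design n ⟨⟨i, hi⟩, j⟩
    have h1 : AEMeasurable (fun ω => D.interpError x l i (D.subjectDesign n i ω j) ω) P :=
      aemeasurable_eval (hIJ ht)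
        (fun s hs => hD.measurable_interpError (fun k => hJT (hIJ (hx k))) l i (hJT hs))
        (hA.ae_continuousOn_interpError hlc i) hτ
        ((hA.ae_mem_Ioo hD n).mono fun ω hω => hJ (hω ⟨⟨i, hi⟩, j⟩))
    exact ((hK.measurable.comp ((hτ.sub_const t).div_const (h n))).ennreal_ofReal.aemeasurable).mul
      (h1.pow_const 2).ennreal_ofReal
  have hpt : ∀ ω, G.indicator 1 (D.subjectDesign n i ω) *
      ENNReal.ofReal ((D.fHat p K h n i t ω - D.f i t ω) ^ 2) ≤
      ENNReal.ofReal (2 * (c * (D.N n i * h n))⁻¹) *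
        ∑ j, ENNReal.ofReal (K ((D.subjectDesign n i ω j - t) / h n)) *
          ENNReal.ofReal (D.interpError x l i (D.subjectDesign n i ω j) ω ^ 2) +
      2 * (G.indicator 1 (D.subjectDesign n i ω) * ENNReal.ofReal
        (lpk p K (h n) (D.subjectDesign n i ω) (D.subjectErr n i ω) t ^ 2)) := by
    intro ω
    by_cases hω : D.subjectDesign n i ω ∈ G
    swap
    · rw [indicator_of_notMem hω, zero_mul]; exact zero_le
    rw [indicator_of_mem hω, Pi.one_apply, one_mul, one_mul]
    have h1 := sq_fHat_sub_f_le hK hb hc' (hGc _ hω) hx0 hv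
    have hnn : ∀ j, 0 ≤ K ((D.subjectDesign n i ω j - t) / h n) *
        D.interpError x l i (D.subjectDesign n i ω j) ω ^ 2 :=
      fun j => mul_nonneg (hK.nonneg _) (sq_nonneg _)
    have hsum0 : 0 ≤ ∑ j, K ((D.subjectDesign n i ω j - t) / h n) *
        D.interpError x l i (D.subjectDesign n i ω j) ω ^ 2 := Finset.sum_nonneg fun j _ => hnn j
    refine (ENNReal.ofReal_le_ofReal h1).trans_eq ?_
    rw [ENNReal.ofReal_add (by positivity) (by positivity),
      ENNReal.ofReal_mul zero_le_two (q := lpk _ _ _ _ _ _ ^ 2),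
      ENNReal.ofReal_ofNat, ← mul_assoc, ENNReal.ofReal_mul (by positivity),
      ENNReal.ofReal_sum_of_nonneg fun j _ => hnn j]
    simp_rw [ENNReal.ofReal_mul (hK.nonneg _)]
  refine (lintegral_mono hpt).trans ?_
  rw [lintegral_add_left' (AEMeasurable.const_mul
    (Finset.aemeasurable_fun_sum _ fun j _ => haem j) _),
    lintegral_const_mul' _ _ ENNReal.ofReal_ne_top, lintegral_const_mul' _ _ (by simp),
    lintegral_finsetSum' _ fun j _ => haem j]
  have hsumle := Finset.sum_le_sum fun j (_ : j ∈ (Finset.univ : Finset (Fin (D.N n i)))) => hbias j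
  refine (add_le_add (mul_le_mul_right hsumle _) (mul_le_mul_right hnoise _)).trans ?_
  have hB := hK.pos
  have hib : 0 ≤ interpBound p := by unfold interpBound; positivity
  rw [Finset.sum_const, Finset.card_univ, Fintype.card_fin, nsmul_eq_mul, hCR,
    ← ENNReal.ofReal_mul (by positivity), ← ENNReal.ofReal_natCast,
    ← ENNReal.ofReal_mul (by positivity), ← ENNReal.ofReal_mul (by positivity),
    ← ENNReal.ofReal_ofNat, ← ENNReal.ofReal_mul zero_le_two,
    ← ENNReal.ofReal_add (by positivity) (by positivity)]
  refine ENNReal.ofReal_le_ofReal ?_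
  -- The `N` window terms, each of mean at most `π₁ h` times the squared interpolation error, cancel
  -- the factor `(N h)⁻¹` of the least squares bound.
  have e1 : 2 * (c * (D.N n i * h n))⁻¹ * (D.N n i * (π₁ * h n *
      (2 * (interpBound p ^ 2 * (M ^ 2 + M)) * (h n ^ (p + 1)) ^ 2))) =
      4 * c⁻¹ * π₁ * (interpBound p ^ 2 * (M ^ 2 + M)) * (h n ^ (p + 1)) ^ 2 := by
    field_simp
    ring
  have e2 : 2 * (σ₁ * ((c * (D.N n i * h n))⁻¹ * B)) = 2 * σ₁ * c⁻¹ * B * (D.N n i * h n)⁻¹ := by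
    field_simp
  rw [e1, e2, add_mul, mul_add, mul_add]
  have p1 : 0 ≤ 4 * c⁻¹ * π₁ * (interpBound p ^ 2 * (M ^ 2 + M)) * (D.N n i * h n)⁻¹ := by
    positivity
  have p2 : 0 ≤ 2 * σ₁ * c⁻¹ * B * (h n ^ (p + 1)) ^ 2 := by positivity
  linarith

end FunctionalData

lemma HasBoundedDeriv.mono_bound {m : ℕ} {f : ℝ → ℝ} {I : Set ℝ} {M M' : ℝ}
    (hf : HasBoundedDeriv m f I M) (hM : M ≤ M') : HasBoundedDeriv m f I M' := by
  obtain ⟨e, h0, h1, h2⟩ := hf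
  exact ⟨e, h0, h1, fun x hx => (h2 x hx).trans hM⟩

lemma HasBoundedMixedDeriv.mono_bound {m : ℕ} {γ : ℝ → ℝ → ℝ} {I : Set ℝ} {M M' : ℝ}
    (hf : HasBoundedMixedDeriv m γ I M) (hM : M ≤ M') : HasBoundedMixedDeriv m γ I M' := by
  obtain ⟨G, h0, h1, h2, h3⟩ := hf
  exact ⟨G, h0, h1, h2, fun x hx y hy => (h3 x hx y hy).trans hM⟩

/-- If `a ∈ J`, the interval may start at `a`, since points above `a` cannot leave it. Otherwise `a
< α` and the interval starts halfway between. The clause on `a' = α` ensures that the interval built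
in `exists_window` has positive length. -/
lemma exists_left_margin {a α : ℝ} (ha : a ≤ α) {J : Set ℝ} (hα : α ∈ J) :
    ∃ a' ρ : ℝ, 0 < ρ ∧ a ≤ a' ∧ a' ≤ α ∧ (a' = a → a ∈ J) ∧ (a' = α → α = a) ∧
      ∀ t x, α ≤ t → a < x → t - ρ ≤ x → a' ≤ x := by
  by_cases h : a ∈ J
  · exact ⟨a, 1, one_pos, le_rfl, ha, fun _ => h, fun h => h.symm, fun t x _ hx _ => hx.le⟩
  · have hlt : a < α := lt_of_le_of_ne ha fun h' => h (h' ▸ hα)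
    refine ⟨(a + α) / 2, (α - a) / 2, by linarith, by linarith, by linarith, fun h => by linarith,
      fun h => by linarith, fun t x ht _ hx => by linarith⟩

/-- Every compact subset of `J` has a one-sided neighbourhood contained in a compact subinterval
of `J`. -/
lemma exists_window {a b : ℝ} (hab : a < b) {J : Set ℝ} (hJ : Ioo a b ⊆ J) (hJT : J ⊆ Icc a b)
    {S : Set ℝ} (hS : IsCompact S) (hSJ : S ⊆ J) :
    ∃ a' b' ρ : ℝ, a' < b' ∧ 0 < ρ ∧ Icc a' b' ⊆ J ∧ ∀ t ∈ S, ∀ r, 0 < r → r ≤ ρ →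
      (∀ x ∈ Ioo a b, |x - t| ≤ r → x ∈ Icc a' b') ∧
      ∃ d : ℝ, |d| = 1 ∧ ∀ θ ∈ Icc (0 : ℝ) 1, t + d * r * θ ∈ Icc a' b' := by
  rcases S.eq_empty_or_nonempty with rfl | hne
  · refine ⟨(2 * a + b) / 3, (a + 2 * b) / 3, 1, by linarith, one_pos, fun x hx => hJ ?_,
      fun t ht => ht.elim⟩
    constructor <;> linarith [hx.1, hx.2]
  have hα := hS.sInf_mem hne
  have hβ := hS.sSup_mem hne
  have hαS : ∀ t ∈ S, sInf S ≤ t := fun t ht => csInf_le hS.bddBelow ht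
  have hβS : ∀ t ∈ S, t ≤ sSup S := fun t ht => le_csSup hS.bddAbove ht
  set α := sInf S
  set β := sSup S
  have hαβ : α ≤ β := hαS β hβ
  obtain ⟨a', ρ₁, hρ₁, h1, h2, h3, h4, h5⟩ :=
    exists_left_margin (hJT (hSJ hα)).1 (hSJ hα)
  -- The right margin is the left margin of the reflected set.
  obtain ⟨b'', ρ₂, hρ₂, k1, k2, k3, k4, k5⟩ :=
    exists_left_margin (a := -b) (α := -β) (neg_le_neg (hJT (hSJ hβ)).2)
      (J := {x | -x ∈ J}) (by simpa using hSJ hβ)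
  obtain ⟨b', rfl⟩ : ∃ b', b'' = -b' := ⟨-b'', by ring⟩
  have hab' : a' < b' := by
    rcases h2.lt_or_eq with h | h
    · linarith
    · rcases k2.lt_or_eq with k | k
      · linarith
      · have := h4 h; have := k4 k; linarith
  refine ⟨a', b', min (min ρ₁ ρ₂) ((b' - a') / 2), hab',
    lt_min (lt_min hρ₁ hρ₂) (by linarith), fun x hx => ?_, fun t ht r hr hrρ => ⟨?_, ?_⟩⟩
  · rcases (h1.trans hx.1).lt_or_eq with h | h
    · rcases (show x ≤ b by linarith [hx.2]).lt_or_eq with h' | h'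
      · exact hJ ⟨h, h'⟩
      · have : -b' = -b := by linarith [hx.2]
        rw [h']
        simpa using k3 this
    · have : a' = a := by linarith [hx.1]
      rw [← h]
      exact h3 this
  · intro x hx hxt
    have hr1 : r ≤ ρ₁ := hrρ.trans ((min_le_left _ _).trans (min_le_left _ _))
    have hr2 : r ≤ ρ₂ := hrρ.trans ((min_le_left _ _).trans (min_le_right _ _))
    rw [abs_le] at hxt
    refine ⟨h5 t x (hαS t ht) hx.1 (by linarith), ?_⟩
    have := k5 (-t) (-x) (by linarith [hβS t ht]) (by linarith [hx.2]) (by linarith)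
    linarith
  · have hr3 : r ≤ (b' - a') / 2 := hrρ.trans (min_le_right _ _)
    have ht1 := hαS t ht
    have ht2 := hβS t ht
    -- The half-window points towards the farther end of the interval, at distance at least `(b' -
    -- a') / 2 ≥ r`.
    by_cases hmid : t ≤ (a' + b') / 2
    · refine ⟨1, abs_one, fun θ hθ => ?_⟩
      have := mul_le_of_le_one_right hr.le hθ.2
      have := mul_nonneg hr.le hθ.1
      constructor <;> linarith
    · refine ⟨-1, by simp, fun θ hθ => ?_⟩
      have := mul_le_of_le_one_right hr.le hθ.2
      have := mul_nonneg hr.le hθ.1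
      constructor <;> linarith

/-! ### All subjects simultaneously. -/

namespace FunctionalData

variable {D : FunctionalData Ω} {p : ℕ} {K : ℝ → ℝ} {h : ℕ → ℝ} {π : ℝ → ℝ} {δ : ℝ} {J : Set ℝ}

lemma ConditionA.exists_isKernel [IsFiniteMeasure P] (hA : D.ConditionA P p K h π δ J) :
    ∃ B, IsKernel K B := by
  obtain ⟨B, hB⟩ := hA.K_bounded
  exact ⟨max B 1, hA.K_measurable, hA.K_nonneg, fun x => (hB x).trans (le_max_left _ _),
    lt_max_of_lt_right one_pos, hA.K_symm, hA.K_support, hA.K_integral⟩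

/-- The design of one subject is well-conditioned with overwhelming probability, and then its
reconstruction has a small mean squared error. -/
lemma ConditionA.exists_subject_bound [IsProbabilityMeasure P] (hD : D.IsModel P)
    (hA : D.ConditionA P p K h π δ J) (hJ : Ioo D.a D.b ⊆ J) (hJT : J ⊆ Icc D.a D.b) {S : Set ℝ}
    (hS : IsCompact S) (hSJ : S ⊆ J) :
    ∃ C κ ρ : ℝ, 0 ≤ C ∧ 0 < κ ∧ 0 < ρ ∧ ∀ n, h n ≤ ρ → ∀ i < n, 0 < D.N n i → ∀ t ∈ S,
      ∃ E : Set Ω, MeasurableSet E ∧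
        P.real Eᶜ ≤ (2 * p + 1) * (2 * Real.exp (-(κ * (D.N n i * h n ^ 2)))) ∧
        ∫⁻ ω in E, ENNReal.ofReal ((D.fHat p K h n i t ω - D.f i t ω) ^ 2) ∂P ≤
          ENNReal.ofReal (C * ((h n ^ (p + 1)) ^ 2 + (D.N n i * h n)⁻¹)) := by
  obtain ⟨B, hK⟩ := hA.exists_isKernel
  obtain ⟨a', b', ρ, hab', hρ, hIJ, hwin⟩ := exists_window hD.lt hJ hJT hS hSJ
  have hJu : UniqueDiffOn ℝ J := by
    refine (uniqueDiffOn_convex (s := J) ?_ ?_)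
    · refine convex_iff_ordConnected.2 ⟨fun x hx y hy z hz => ?_⟩
      rcases (hJT hx).1.eq_or_lt with h1 | h1
      · rcases hz.1.eq_or_lt with h2 | h2
        · exact h2 ▸ hx
        · rcases hz.2.eq_or_lt with h3 | h3
          · exact h3 ▸ hy
          · exact hJ ⟨h1 ▸ h2, h3.trans_le (hJT hy).2⟩
      · rcases hz.2.eq_or_lt with h3 | h3
        · exact h3 ▸ hy
        · exact hJ ⟨h1.trans_le hz.1, h3.trans_le (hJT hy).2⟩
    · exact (nonempty_Ioo.2 hD.lt).mono (isOpen_Ioo.subset_interior_iff.2 hJ)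
  have hIc : IsCompact (Icc a' b') := isCompact_Icc
  have hIne : (Icc a' b').Nonempty := nonempty_Icc.2 hab'.le
  have hπc : ContinuousOn π (Icc a' b') := hA.π_smooth.continuousOn.mono hIJ
  obtain ⟨x₀, hx₀, hmin⟩ := hIc.exists_isMinOn hIne hπc
  obtain ⟨x₁, hx₁, hmax⟩ := hIc.exists_isMaxOn hIne hπc
  obtain ⟨σ₁, hσ₁⟩ := hIc.exists_bound_of_continuousOn (hA.σsq_cont.mono hIJ)
  have hπ₀ : 0 < π x₀ := hA.π_pos x₀ (hIJ hx₀)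
  have hπ₁ : 0 < π x₁ := hA.π_pos x₁ (hIJ hx₁)
  obtain ⟨M₁, hM₁⟩ := exists_hasBoundedDeriv hA.η_smooth hJu hIc hIJ
  obtain ⟨M₂, hM₂⟩ := exists_hasBoundedMixedDeriv hA.γ_smooth hIc hIJ
  have hη := hM₁.mono_bound ((le_max_left M₁ M₂).trans (le_max_left _ 0))
  have hγ := hM₂.mono_bound ((le_max_right M₁ M₂).trans (le_max_left _ 0))
  set M := max (max M₁ M₂) 0
  have hM0 : 0 ≤ M := le_max_right _ _
  obtain ⟨c, hc, κ, hκ, hgood⟩ := hK.exists_good_designs P p hπ₀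
  have hσ0 : 0 ≤ σ₁ := (norm_nonneg _).trans (hσ₁ x₀ hx₀)
  have hB := hK.pos
  have hib : 0 ≤ interpBound p := by unfold interpBound; positivity
  refine ⟨4 * c⁻¹ * π x₁ * (interpBound p ^ 2 * (M ^ 2 + M)) + 2 * σ₁ * c⁻¹ * B, κ, ρ,
    by positivity, hκ, hρ, fun n hn i hi hN t ht => ?_⟩
  obtain ⟨hw, d, hd, hdI⟩ := hwin t ht (h n) (hA.h_pos n) hn
  have hlaw : ∀ j : Fin (D.N n i), P.map (fun ω => D.subjectDesign n i ω j) =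
      (volume.restrict D.T).withDensity (fun x => ENNReal.ofReal (π x)) :=
    fun j => hA.design_law n ⟨⟨i, hi⟩, j⟩
  have hmeas := hD.measurable_subjectDesign hi
  have hprob : IsProbabilityMeasure
      ((volume.restrict D.T).withDensity (fun x => ENNReal.ofReal (π x))) := by
    rw [← hlaw ⟨0, hN⟩]
    exact Measure.isProbabilityMeasure_map ((measurable_pi_apply _).comp hmeas).aemeasurable
  -- The half-window lies in the compact interval, so the minimum of the density there serves as
  -- `π₀`.
  have hseg : {x | d * ((x - t) / h n) ∈ Icc (0 : ℝ) 1} ⊆ Icc a' b' := by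
    intro x hx
    have h1 := hdI _ hx
    have hd2 : d * d = 1 := by rw [← pow_two, ← sq_abs, hd, one_pow]
    have : t + d * h n * (d * ((x - t) / h n)) = x := by
      have := (hA.h_pos n).ne'
      field_simp
      linear_combination (x - t) * hd2
    rwa [this] at h1
  have hle := hA.smul_restrict_le_law (n := n) ⟨⟨i, hi⟩, ⟨0, hN⟩⟩
    (measurableSet_Icc.preimage (by fun_prop) : MeasurableSet
      {x | d * ((x - t) / h n) ∈ Icc (0 : ℝ) 1})
    (hseg.trans (hIJ.trans hJT)) (fun x hx => hmin (hseg hx))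
  rw [hA.design_law n] at hle
  obtain ⟨G, hG, hGc, hGP⟩ := hgood (D.N n i) (h n) t d (hA.h_pos n) hd _ hprob hle
  have hind : iIndepFun (fun j ω => D.subjectDesign n i ω j) P :=
    (hA.design_indep n).precomp (g := fun j : Fin (D.N n i) => (⟨⟨i, hi⟩, j⟩ : D.Obs n))
      (fun j k hjk => by simpa using hjk)
  refine ⟨D.subjectDesign n i ⁻¹' G, hmeas hG, ?_, ?_⟩
  · exact hGP _ hind (fun j => (measurable_pi_apply j).comp hmeas) hlaw
  · have h1 := hA.lintegral_sq_fHat_sub_f_le hK hD hJ hi hN hIJ hJT hw (fun x hx => hmax hx)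
      (fun x hx => (le_abs_self _).trans (hσ₁ x hx)) hπ₁.le hσ0 hM0 hd hdI hη hγ hc hG hGc
    rw [← lintegral_indicator (hmeas hG)]
    refine le_trans (le_of_eq (lintegral_congr fun ω => ?_)) h1
    by_cases hω : D.subjectDesign n i ω ∈ G
    · rw [indicator_of_mem hω, indicator_of_mem (s := D.subjectDesign n i ⁻¹' G) hω, Pi.one_apply,
        one_mul]
    · rw [indicator_of_notMem hω, indicator_of_notMem (s := D.subjectDesign n i ⁻¹' G) hω, zero_mul]

lemma ConditionA.aemeasurable_fHat [IsProbabilityMeasure P] (hD : D.IsModel P)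
    (hA : D.ConditionA P p K h π δ J) (hJ : Ioo D.a D.b ⊆ J) (hJT : J ⊆ Icc D.a D.b)
    {n i : ℕ} (hi : i < n) (s : ℝ) : AEMeasurable (D.fHat p K h n i s) P := by
  have hmeas := hD.measurable_subjectDesign hi
  have h1 : D.fHat p K h n i s = fun ω => ∑ j, lpkCoef p K (h n) (D.subjectDesign n i ω) s j *
      (D.f i (D.subjectDesign n i ω j) ω + D.subjectErr n i ω j) := by
    funext ω
    rw [fHat_eq, lpk_eq_sum]
  rw [h1]
  refine Finset.aemeasurable_fun_sum _ fun j _ => ?_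
  have hτ : Measurable fun ω => D.subjectDesign n i ω j := (measurable_pi_apply j).comp hmeas
  have hmid : (D.a + D.b) / 2 ∈ J := hJ ⟨by linarith [hD.lt], by linarith [hD.lt]⟩
  have h2 : AEMeasurable (fun ω => D.f i (D.subjectDesign n i ω j) ω) P :=
    aemeasurable_eval hmid (fun s hs => hD.measurable_f i (hJT hs))
      ((hA.f_smooth i).mono fun ω hω => hω.continuousOn) hτ
      ((hA.ae_mem_Ioo hD n).mono fun ω hω => hJ (hω ⟨⟨i, hi⟩, j⟩))
  exact ((measurable_lpkCoef hA.K_measurable j).comp hmeas).aemeasurable.mul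
    (h2.add ((measurable_pi_apply j).comp (hD.measurable_subjectErr hi)).aemeasurable)

/-- The mean squared difference of the reconstructions and the individual functions. -/
def meanSqError (D : FunctionalData Ω) (p : ℕ) (K : ℝ → ℝ) (h : ℕ → ℝ) (n : ℕ) (t : ℝ)
    (ω : Ω) : ℝ :=
  (n : ℝ)⁻¹ * ∑ i ∈ Finset.range n, (D.fHat p K h n i t ω - D.f i t ω) ^ 2

/-- The exact order of the bandwidth, in terms of powers of `n ^ (δ / (2p + 3))`. -/
lemma ConditionA.eventually_rates [IsFiniteMeasure P] (hA : D.ConditionA P p K h π δ J)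
    (hh : h =Θ[atTop] fun n : ℕ => (n : ℝ) ^ (-(δ / (2 * p + 3)))) :
    ∃ c₁ c₂ : ℝ, 0 < c₁ ∧ 0 < c₂ ∧ ∀ᶠ n : ℕ in atTop, ∀ i < n,
      0 < D.N n i ∧ c₁ * (n : ℝ) ^ (δ / (2 * p + 3)) ≤ D.N n i * h n ^ 2 ∧
      (h n ^ (p + 1)) ^ 2 + (D.N n i * h n)⁻¹ ≤
        c₂ * ((n : ℝ) ^ (-((p + 1) * δ / (2 * p + 3)))) ^ 2 := by
  obtain ⟨CN, hCN, hN⟩ := hA.N_lower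
  obtain ⟨b₂, hb₂, hup⟩ := hh.1.exists_pos
  obtain ⟨b₁, hb₁, hlo⟩ := hh.2.exists_pos
  have hδ := hA.δ_pos
  refine ⟨CN * b₁⁻¹ ^ 2, (b₂ ^ (p + 1)) ^ 2 + (CN * b₁⁻¹)⁻¹, by positivity, by positivity, ?_⟩
  filter_upwards [hup.bound, hlo.bound, eventually_ge_atTop 1] with n h1 h2 hn i hi
  have hn1 : (1 : ℝ) ≤ n := by exact_mod_cast hn
  have hn0 : (0 : ℝ) ≤ n := zero_le_one.trans hn1
  -- In terms of `u`, the bandwidth is of order `u⁻¹` and `n ^ δ = u ^ (2 p + 3)`. Hence `N h` is at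
  -- least of order `u ^ (2 p + 2)`, and squared bias and variance are both of order at most `u ^
  -- (-2 (p + 1))`.
  set u : ℝ := (n : ℝ) ^ (δ / (2 * p + 3)) with hu
  have hu1 : 1 ≤ u := Real.one_le_rpow hn1 (by positivity)
  have hu0 : 0 < u := one_pos.trans_le hu1
  have e1 : (n : ℝ) ^ (-(δ / (2 * p + 3))) = u⁻¹ := Real.rpow_neg hn0 _
  have e2 : (n : ℝ) ^ δ = u ^ (2 * p + 3) := by
    rw [hu, ← Real.rpow_natCast, ← Real.rpow_mul hn0]
    congr 1
    push_cast
    field_simp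
  have e3 : (n : ℝ) ^ (-((p + 1) * δ / (2 * p + 3))) = (u ^ (p + 1))⁻¹ := by
    rw [Real.rpow_neg hn0, hu, ← Real.rpow_natCast, ← Real.rpow_mul hn0]
    congr 2
    push_cast
    field_simp
  have hpos := hA.h_pos n
  rw [e1, Real.norm_of_nonneg hpos.le, Real.norm_of_nonneg (by positivity)] at h1 h2
  have h3 : b₁⁻¹ * u⁻¹ ≤ h n := by
    rw [inv_mul_le_iff₀ hb₁]; exact h2
  have h4 := hN n i hi
  rw [e2] at h4
  have hNpos : (0 : ℝ) < D.N n i := lt_of_lt_of_le (by positivity) h4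
  have h5 : CN * b₁⁻¹ * (u ^ (p + 1)) ^ 2 ≤ D.N n i * h n := by
    calc CN * b₁⁻¹ * (u ^ (p + 1)) ^ 2 = (CN * u ^ (2 * p + 3)) * (b₁⁻¹ * u⁻¹) := by
          field_simp
          ring
      _ ≤ _ := by gcongr
  refine ⟨by exact_mod_cast hNpos, ?_, ?_⟩
  · calc CN * b₁⁻¹ ^ 2 * u ≤ CN * b₁⁻¹ ^ 2 * u ^ (2 * p + 1) := by
          gcongr
          exact le_self_pow₀ hu1 (by omega)
      _ = (CN * u ^ (2 * p + 3)) * (b₁⁻¹ * u⁻¹) ^ 2 := by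
          field_simp
          ring
      _ ≤ _ := by gcongr
  · rw [e3, add_mul]
    refine add_le_add ?_ ?_
    · calc (h n ^ (p + 1)) ^ 2 ≤ ((b₂ * u⁻¹) ^ (p + 1)) ^ 2 := by gcongr
        _ = _ := by rw [mul_pow, mul_pow, inv_pow]
    · calc (D.N n i * h n)⁻¹ ≤ (CN * b₁⁻¹ * (u ^ (p + 1)) ^ 2)⁻¹ := by
            gcongr
        _ = _ := by rw [mul_inv, inv_pow]

/-- The uniform rate of the mean squared difference of the reconstructions and the individual
functions. -/
lemma ConditionA.isBigOUP_meanSqError [IsProbabilityMeasure P] (hD : D.IsModel P)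
    (hA : D.ConditionA P p K h π δ J) (hJ : Ioo D.a D.b ⊆ J) (hJT : J ⊆ Icc D.a D.b)
    (hh : h =Θ[atTop] fun n : ℕ => (n : ℝ) ^ (-(δ / (2 * p + 3)))) {S : Set ℝ}
    (hS : IsCompact S) (hSJ : S ⊆ J) :
    IsBigOUP P (D.meanSqError p K h)
      (fun n => ((n : ℝ) ^ (-((p + 1) * δ / (2 * p + 3)))) ^ 2) S := by
  intro ε hε
  obtain ⟨C, κ, ρ, hC, hκ, hρ, hsub⟩ := hA.exists_subject_bound hD hJ hJT hS hSJ
  obtain ⟨c₁, c₂, hc₁, hc₂, hrates⟩ := hA.eventually_rates hh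
  have hδ := hA.δ_pos
  have hθ : 0 < δ / (2 * p + 3) := by positivity
  -- The union bound over `n` subjects: `n` is a power of `n ^ (δ / (2 p + 3))`, and the exponential
  -- beats every power.
  have hlim : Tendsto (fun n : ℕ => (n : ℝ) * ((2 * p + 1) *
      (2 * Real.exp (-(κ * (c₁ * (n : ℝ) ^ (δ / (2 * p + 3)))))))) atTop (𝓝 0) := by
    have h1 := ((tendsto_rpow_mul_exp_neg_mul_atTop_nhds_zero ((δ / (2 * p + 3))⁻¹) (κ * c₁)
      (by positivity)).comp ((tendsto_rpow_atTop hθ).comp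
        tendsto_natCast_atTop_atTop)).const_mul ((2 * p + 1) * 2 : ℝ)
    rw [mul_zero] at h1
    refine h1.congr fun n => ?_
    simp only [Function.comp_apply]
    rw [← Real.rpow_mul (Nat.cast_nonneg n), mul_inv_cancel₀ hθ.ne', Real.rpow_one]
    ring_nf
  -- Markov's inequality on the good event then costs at most `ε / 2`, the bad event costs the rest;
  -- the `1` keeps the constant positive.
  refine ⟨2 * (C * c₂ + 1) / ε, ?_⟩
  have hhρ : ∀ᶠ n in atTop, h n ≤ ρ := (hA.h_zero.eventually_lt_const hρ).mono fun n hn => hn.le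
  filter_upwards [hrates, hlim.eventually_lt_const (half_pos hε), hhρ, eventually_ge_atTop 1]
    with n hr hexp hn hn1 t ht
  have hn0 : (0 : ℝ) < n := by exact_mod_cast hn1
  set r : ℝ := ((n : ℝ) ^ (-((p + 1) * δ / (2 * p + 3)))) ^ 2 with hrdef
  have hr0 : 0 < r := by positivity
  have hE : ∀ i : Fin n, ∃ E : Set Ω, MeasurableSet E ∧
      P.real Eᶜ ≤ (2 * p + 1) *
        (2 * Real.exp (-(κ * (c₁ * (n : ℝ) ^ (δ / (2 * p + 3)))))) ∧
      ∫⁻ ω in E, ENNReal.ofReal ((D.fHat p K h n i t ω - D.f i t ω) ^ 2) ∂P ≤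
        ENNReal.ofReal (C * c₂ * r) := by
    intro i
    obtain ⟨hN, h1, h2⟩ := hr i i.2
    obtain ⟨E, hE, hEP, hEb⟩ := hsub n hn i i.2 hN t ht
    refine ⟨E, hE, hEP.trans ?_, hEb.trans (ENNReal.ofReal_le_ofReal ?_)⟩
    · gcongr
    · rw [mul_assoc]
      exact mul_le_mul_of_nonneg_left h2 hC
  choose E hEm hEP hEb using hE
  -- All designs are good on this event. Off it the reconstructions are not controlled, so only its
  -- probability enters.
  set E₀ : Set Ω := ⋂ i, E i with hE₀
  have hE₀m : MeasurableSet E₀ := MeasurableSet.iInter hEm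
  have hbad : P E₀ᶜ ≤ ENNReal.ofReal (ε / 2) := by
    rw [← ofReal_measureReal (measure_ne_top _ _)]
    refine ENNReal.ofReal_le_ofReal (le_trans ?_ hexp.le)
    rw [hE₀, compl_iInter]
    refine (measureReal_iUnion_fintype_le _).trans
      ((Finset.sum_le_sum fun i _ => hEP i).trans_eq ?_)
    simp
  have haem : ∀ i : Fin n, AEMeasurable
      (fun ω => ENNReal.ofReal ((D.fHat p K h n i t ω - D.f i t ω) ^ 2)) P :=
    fun i => (((hA.aemeasurable_fHat hD hJ hJT i.2 t).sub
      (hD.measurable_f i (hJT (hSJ ht))).aemeasurable).pow_const 2).ennreal_ofReal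
  have hsum : ∀ ω, ENNReal.ofReal (D.meanSqError p K h n t ω) =
      ENNReal.ofReal ((n : ℝ)⁻¹) *
        ∑ i : Fin n, ENNReal.ofReal ((D.fHat p K h n i t ω - D.f i t ω) ^ 2) := by
    intro ω
    rw [meanSqError, ENNReal.ofReal_mul (by positivity), Finset.sum_range,
      ENNReal.ofReal_sum_of_nonneg fun i _ => sq_nonneg _]
  have hint : ∫⁻ ω in E₀, ENNReal.ofReal (D.meanSqError p K h n t ω) ∂P ≤
      ENNReal.ofReal (C * c₂ * r) := by
    simp_rw [hsum]
    rw [lintegral_const_mul' _ _ ENNReal.ofReal_ne_top,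
      lintegral_finsetSum' _ fun i _ => (haem i).restrict]
    calc _ ≤ ENNReal.ofReal ((n : ℝ)⁻¹) * ∑ _i : Fin n, ENNReal.ofReal (C * c₂ * r) := by
          gcongr with i
          exact (lintegral_mono_set (iInter_subset _ i)).trans (hEb i)
      _ = ENNReal.ofReal (C * c₂ * r) := by
          rw [Finset.sum_const, Finset.card_univ, Fintype.card_fin, nsmul_eq_mul, ← mul_assoc,
            ← ENNReal.ofReal_natCast, ← ENNReal.ofReal_mul (by positivity), inv_mul_cancel₀ hn0.ne',
            ENNReal.ofReal_one, one_mul]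
  have hmarkov : P ({ω | 2 * (C * c₂ + 1) / ε * r < |D.meanSqError p K h n t ω|} ∩ E₀) ≤
      ENNReal.ofReal (ε / 2) := by
    have hM : 0 < 2 * (C * c₂ + 1) / ε * r := by positivity
    have hnn : ∀ ω, 0 ≤ D.meanSqError p K h n t ω := fun ω =>
      mul_nonneg (by positivity) (Finset.sum_nonneg fun i _ => sq_nonneg _)
    have hm : AEMeasurable (fun ω => ENNReal.ofReal (D.meanSqError p K h n t ω))
        (P.restrict E₀) := by
      simp_rw [hsum]
      exact (Finset.aemeasurable_fun_sum _ fun i _ => (haem i).restrict).const_mul _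
    calc P ({ω | 2 * (C * c₂ + 1) / ε * r < |D.meanSqError p K h n t ω|} ∩ E₀)
        = (P.restrict E₀) {ω | 2 * (C * c₂ + 1) / ε * r < |D.meanSqError p K h n t ω|} :=
          (Measure.restrict_apply' hE₀m).symm
      _ ≤ (P.restrict E₀) {ω | ENNReal.ofReal (2 * (C * c₂ + 1) / ε * r) ≤
          ENNReal.ofReal (D.meanSqError p K h n t ω)} := by
          refine measure_mono fun ω hω => ?_
          simp only [mem_ofPred_eq, abs_of_nonneg (hnn ω)] at hω ⊢
          exact ENNReal.ofReal_le_ofReal hω.le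
      _ ≤ (∫⁻ ω in E₀, ENNReal.ofReal (D.meanSqError p K h n t ω) ∂P) /
          ENNReal.ofReal (2 * (C * c₂ + 1) / ε * r) :=
          meas_ge_le_lintegral_div hm (by simpa using hM) ENNReal.ofReal_ne_top
      _ ≤ ENNReal.ofReal (C * c₂ * r) / ENNReal.ofReal (2 * (C * c₂ + 1) / ε * r) := by gcongr
      _ ≤ ENNReal.ofReal (ε / 2) := by
          rw [← ENNReal.ofReal_div_of_pos hM]
          refine ENNReal.ofReal_le_ofReal ?_
          rw [div_le_iff₀ hM]
          have : ε / 2 * (2 * (C * c₂ + 1) / ε * r) = (C * c₂ + 1) * r := by field_simp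
          rw [this]
          nlinarith
  calc P {ω | 2 * (C * c₂ + 1) / ε * r < |D.meanSqError p K h n t ω|}
      ≤ P ({ω | 2 * (C * c₂ + 1) / ε * r < |D.meanSqError p K h n t ω|} ∩ E₀) + P E₀ᶜ := by
        refine (measure_mono fun ω hω => ?_).trans (measure_union_le _ _)
        by_cases h0 : ω ∈ E₀
        · exact Or.inl ⟨hω, h0⟩
        · exact Or.inr h0
    _ ≤ ENNReal.ofReal (ε / 2) + ENNReal.ofReal (ε / 2) := add_le_add hmarkov hbad
    _ = ENNReal.ofReal ε := by
        rw [← ENNReal.ofReal_add (by positivity) (by positivity), add_halves]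

end FunctionalData

/-! ### Calculus of uniform boundedness in probability. -/

section BigOUP

variable {ι : Type*} {X Y : ℕ → ι → Ω → ℝ} {r r' : ℕ → ℝ} {S : Set ι}

lemma IsBigOUP.comp {ι' : Type*} {S' : Set ι'} (hX : IsBigOUP P X r S) {φ : ι' → ι}
    (hφ : MapsTo φ S' S) : IsBigOUP P (fun n x ω => X n (φ x) ω) r S' := by
  intro ε hε
  obtain ⟨M, hM⟩ := hX ε hε
  exact ⟨M, hM.mono fun n hn x hx => hn _ (hφ hx)⟩

lemma IsBigOUP.of_abs_le (hY : IsBigOUP P Y r S) {C : ℝ} (hC : 0 ≤ C)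
    (hle : ∀ᶠ n in atTop, ∀ x ∈ S, ∀ ω, |X n x ω| ≤ C * |Y n x ω|) : IsBigOUP P X r S := by
  intro ε hε
  obtain ⟨M, hM⟩ := hY ε hε
  refine ⟨C * M, ?_⟩
  filter_upwards [hM, hle] with n hn hl x hx
  refine (measure_mono fun ω hω => ?_).trans (hn x hx)
  simp only [mem_ofPred_eq] at hω ⊢
  by_contra! hlt
  have := mul_le_mul_of_nonneg_left hlt hC
  linarith [hl x hx ω]

lemma IsBigOUP.add (hX : IsBigOUP P X r S) (hY : IsBigOUP P Y r S) :
    IsBigOUP P (fun n x ω => X n x ω + Y n x ω) r S := by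
  intro ε hε
  obtain ⟨M, hM⟩ := hX (ε / 2) (half_pos hε)
  obtain ⟨N, hN⟩ := hY (ε / 2) (half_pos hε)
  refine ⟨M + N, ?_⟩
  filter_upwards [hM, hN] with n h1 h2 x hx
  rw [← add_halves ε, ENNReal.ofReal_add (half_pos hε).le (half_pos hε).le]
  refine le_trans (measure_mono fun ω hω => ?_)
    ((measure_union_le _ _).trans (add_le_add (h1 x hx) (h2 x hx)))
  simp only [mem_ofPred_eq, mem_union] at hω ⊢
  by_contra! hlt
  linarith [abs_add_le (X n x ω) (Y n x ω), hlt.1, hlt.2]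

lemma IsBigOUP.mul (hX : IsBigOUP P X r S) (hY : IsBigOUP P Y r' S) :
    IsBigOUP P (fun n x ω => X n x ω * Y n x ω) (fun n => r n * r' n) S := by
  intro ε hε
  obtain ⟨M, hM⟩ := hX (ε / 2) (half_pos hε)
  obtain ⟨N, hN⟩ := hY (ε / 2) (half_pos hε)
  refine ⟨M * N, ?_⟩
  filter_upwards [hM, hN] with n h1 h2 x hx
  rw [← add_halves ε, ENNReal.ofReal_add (half_pos hε).le (half_pos hε).le]
  refine le_trans (measure_mono fun ω hω => ?_)
    ((measure_union_le _ _).trans (add_le_add (h1 x hx) (h2 x hx)))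
  simp only [mem_ofPred_eq, mem_union] at hω ⊢
  by_contra! hlt
  rw [abs_mul] at hω
  nlinarith [mul_le_mul hlt.1 hlt.2 (abs_nonneg _) ((abs_nonneg _).trans hlt.1)]

lemma IsBigOUP.mono_rate (hX : IsBigOUP P X r S)
    (hr : ∀ᶠ n in atTop, 0 ≤ r n ∧ r n ≤ r' n) : IsBigOUP P X r' S := by
  intro ε hε
  obtain ⟨M, hM⟩ := hX ε hε
  -- A negative constant would reverse the comparison of the rates.
  refine ⟨max M 0, ?_⟩
  filter_upwards [hM, hr] with n h1 h2 x hx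
  refine (measure_mono fun ω hω => ?_).trans (h1 x hx)
  simp only [mem_ofPred_eq] at hω ⊢
  refine lt_of_le_of_lt ?_ hω
  exact mul_le_mul (le_max_left _ _) h2.2 h2.1 (le_max_right _ _)

lemma IsBigOUP.sqrt (hX : IsBigOUP P X (fun n => r n ^ 2) S) (hr : ∀ n, 0 ≤ r n) :
    IsBigOUP P (fun n x ω => √(X n x ω)) r S := by
  intro ε hε
  obtain ⟨M, hM⟩ := hX ε hε
  refine ⟨√(max M 0), ?_⟩
  filter_upwards [hM] with n h1 x hx
  refine (measure_mono fun ω hω => ?_).trans (h1 x hx)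
  simp only [mem_ofPred_eq, abs_of_nonneg (Real.sqrt_nonneg _)] at hω ⊢
  have h0 : 0 ≤ √(max M 0) * r n := mul_nonneg (Real.sqrt_nonneg _) (hr n)
  have h2 := (Real.lt_sqrt h0).1 hω
  rw [mul_pow, Real.sq_sqrt (le_max_right _ _)] at h2
  calc M * r n ^ 2 ≤ max M 0 * r n ^ 2 :=
        mul_le_mul_of_nonneg_right (le_max_left _ _) (sq_nonneg _)
    _ < X n x ω := h2
    _ ≤ _ := le_abs_self _

/-- Markov's inequality; `C + 1` replaces `C` to have a positive threshold. -/
lemma IsBigOUP.of_lintegral_le (hm : ∀ n, ∀ x ∈ S, AEMeasurable (X n x) P) {C : ℝ} (hC : 0 ≤ C)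
    (hr : ∀ᶠ n in atTop, 0 < r n)
    (hle : ∀ᶠ n in atTop, ∀ x ∈ S, ∫⁻ ω, ENNReal.ofReal |X n x ω| ∂P ≤ ENNReal.ofReal (C * r n)) :
    IsBigOUP P X r S := by
  intro ε hε
  refine ⟨(C + 1) / ε, ?_⟩
  filter_upwards [hr, hle] with n hn hl x hx
  have hMp : 0 < (C + 1) / ε * r n := by positivity
  calc P {ω | (C + 1) / ε * r n < |X n x ω|}
      ≤ P {ω | ENNReal.ofReal ((C + 1) / ε * r n) ≤ ENNReal.ofReal |X n x ω|} := by
        refine measure_mono fun ω hω => ?_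
        simp only [mem_ofPred_eq] at hω ⊢
        exact ENNReal.ofReal_le_ofReal hω.le
    _ ≤ (∫⁻ ω, ENNReal.ofReal |X n x ω| ∂P) / ENNReal.ofReal ((C + 1) / ε * r n) :=
        meas_ge_le_lintegral_div
          (continuous_abs.measurable.comp_aemeasurable (hm n x hx)).ennreal_ofReal
          (by simpa using hMp) ENNReal.ofReal_ne_top
    _ ≤ ENNReal.ofReal (C * r n) / ENNReal.ofReal ((C + 1) / ε * r n) := by
        gcongr
        exact hl x hx
    _ ≤ ENNReal.ofReal ε := by
        rw [← ENNReal.ofReal_div_of_pos hMp]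
        refine ENNReal.ofReal_le_ofReal ?_
        rw [div_le_iff₀ hMp]
        have : ε * ((C + 1) / ε * r n) = (C + 1) * r n := by field_simp
        rw [this]
        nlinarith

lemma IsBigOUP.const_mul (hX : IsBigOUP P X r S) {a : ℕ → ℝ} (ha : ∀ n, 0 ≤ a n) :
    IsBigOUP P (fun n x ω => a n * X n x ω) (fun n => a n * r n) S := by
  intro ε hε
  obtain ⟨M, hM⟩ := hX ε hε
  refine ⟨M, hM.mono fun n hn x hx => (measure_mono fun ω hω => ?_).trans (hn x hx)⟩
  simp only [mem_ofPred_eq, abs_mul, abs_of_nonneg (ha n)] at hω ⊢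
  by_contra! hlt
  have := mul_le_mul_of_nonneg_left hlt (ha n)
  linarith

lemma IsBigOUP.tendstoInMeasure (hX : IsBigOUP P X r S)
    (hr : Tendsto r atTop (𝓝 0)) {x : ι} (hx : x ∈ S) :
    TendstoInMeasure P (fun n ω => X n x ω) atTop fun _ => 0 := by
  rw [tendstoInMeasure_iff_norm]
  intro c hc
  rw [ENNReal.tendsto_nhds_zero]
  intro ε hε
  obtain ⟨ε', hε', hle⟩ : ∃ ε' : ℝ, 0 < ε' ∧ ENNReal.ofReal ε' ≤ ε := by
    by_cases htop : ε = ∞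
    · exact ⟨1, one_pos, htop ▸ le_top⟩
    · exact ⟨ε.toReal, ENNReal.toReal_pos hε.ne' htop, (ENNReal.ofReal_toReal htop).le⟩
  obtain ⟨M, hM⟩ := hX ε' hε'
  have h1 : Tendsto (fun n => M * r n) atTop (𝓝 0) := by simpa using hr.const_mul M
  filter_upwards [hM, h1.eventually_lt_const hc] with n h2 h3
  refine (measure_mono fun ω hω => ?_).trans ((h2 x hx).trans hle)
  simp only [mem_ofPred_eq, sub_zero, Real.norm_eq_abs] at hω ⊢
  linarith

end BigOUP

/-! ### Sample covariances -/

section SampleCov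

/-- The sum of the products of the deviations from the sample means. -/
def devSum (n : ℕ) (a b : ℕ → ℝ) : ℝ :=
  ∑ i ∈ Finset.range n, (a i - (n : ℝ)⁻¹ * ∑ j ∈ Finset.range n, a j) *
    (b i - (n : ℝ)⁻¹ * ∑ j ∈ Finset.range n, b j)

lemma devSum_eq {n : ℕ} (hn : 0 < n) (a b : ℕ → ℝ) :
    devSum n a b = ∑ i ∈ Finset.range n, a i * b i -
      n * ((n : ℝ)⁻¹ * ∑ j ∈ Finset.range n, a j) * ((n : ℝ)⁻¹ * ∑ j ∈ Finset.range n, b j) := by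
  have hn0 : (n : ℝ) ≠ 0 := by positivity
  simp only [devSum, sub_mul, mul_sub, Finset.sum_sub_distrib, ← Finset.mul_sum, ← Finset.sum_mul,
    Finset.sum_const, Finset.card_range, nsmul_eq_mul]
  field_simp
  ring

/-- Bilinearity, arranged to isolate the ideal term `devSum n a c` from the three terms that contain
reconstruction errors. -/
lemma devSum_add_add (n : ℕ) (a b c d : ℕ → ℝ) :
    devSum n (fun i => a i + b i) (fun i => c i + d i) =
      devSum n a c + (devSum n b c + devSum n a d + devSum n b d) := by
  simp only [devSum, Finset.sum_add_distrib]
  generalize ∑ j ∈ Finset.range n, a j = A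
  generalize ∑ j ∈ Finset.range n, b j = B
  generalize ∑ j ∈ Finset.range n, c j = C
  generalize ∑ j ∈ Finset.range n, d j = E
  simp only [← Finset.sum_add_distrib]
  exact Finset.sum_congr rfl fun i _ => by ring

/-- Cauchy–Schwarz, since centring at the sample mean does not increase a sum of squares. -/
lemma abs_devSum_le (n : ℕ) (a b : ℕ → ℝ) :
    |devSum n a b| ≤ n * (√((n : ℝ)⁻¹ * ∑ i ∈ Finset.range n, a i ^ 2) *
      √((n : ℝ)⁻¹ * ∑ i ∈ Finset.range n, b i ^ 2)) := by
  rcases n.eq_zero_or_pos with rfl | hn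
  · simp [devSum]
  have hn0 : (0 : ℝ) < n := by exact_mod_cast hn
  have hself : ∀ a : ℕ → ℝ, ∑ i ∈ Finset.range n,
      (a i - (n : ℝ)⁻¹ * ∑ j ∈ Finset.range n, a j) ^ 2 ≤ ∑ i ∈ Finset.range n, a i ^ 2 := by
    intro a
    have := devSum_eq hn a a
    simp only [devSum, ← pow_two] at this
    rw [this]
    nlinarith [mul_nonneg hn0.le (sq_nonneg ((n : ℝ)⁻¹ * ∑ j ∈ Finset.range n, a j))]
  have h1 := Finset.sum_mul_sq_le_sq_mul_sq (Finset.range n)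
    (fun i => a i - (n : ℝ)⁻¹ * ∑ j ∈ Finset.range n, a j)
    (fun i => b i - (n : ℝ)⁻¹ * ∑ j ∈ Finset.range n, b j)
  have h2 : devSum n a b ^ 2 ≤ (∑ i ∈ Finset.range n, a i ^ 2) * ∑ i ∈ Finset.range n, b i ^ 2 :=
    h1.trans (mul_le_mul (hself a) (hself b) (Finset.sum_nonneg fun i _ => sq_nonneg _)
      (Finset.sum_nonneg fun i _ => sq_nonneg _))
  have ha : 0 ≤ ∑ i ∈ Finset.range n, a i ^ 2 := Finset.sum_nonneg fun i _ => sq_nonneg _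
  have hb : 0 ≤ ∑ i ∈ Finset.range n, b i ^ 2 := Finset.sum_nonneg fun i _ => sq_nonneg _
  refine abs_le_of_sq_le_sq (h2.trans_eq ?_) (by positivity)
  rw [mul_pow, mul_pow, Real.sq_sqrt (by positivity), Real.sq_sqrt (by positivity)]
  field_simp

end SampleCov

/-! ### From reconstruction errors to the estimators. -/

namespace FunctionalData

variable {D : FunctionalData Ω} {p : ℕ} {K : ℝ → ℝ} {h : ℕ → ℝ} {π : ℝ → ℝ} {δ : ℝ} {J : Set ℝ}

lemma abs_etaHat_sub_etaTilde_le (n : ℕ) (t : ℝ) (ω : Ω) :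
    |D.etaHat p K h n t ω - D.etaTilde n t ω| ≤ √(D.meanSqError p K h n t ω) := by
  rcases n.eq_zero_or_pos with rfl | hn
  · simp [etaHat, etaTilde]
  have hn0 : (0 : ℝ) < n := by exact_mod_cast hn
  rw [etaHat, etaTilde, ← mul_sub, ← Finset.sum_sub_distrib]
  refine Real.abs_le_sqrt ?_
  rw [meanSqError, mul_pow]
  have := sq_sum_le_card_mul_sum_sq (s := Finset.range n)
    (f := fun i => D.fHat p K h n i t ω - D.f i t ω)
  rw [Finset.card_range] at this
  calc _ ≤ (n : ℝ)⁻¹ ^ 2 * (n * ∑ i ∈ Finset.range n, (D.fHat p K h n i t ω - D.f i t ω) ^ 2) := by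
        gcongr
    _ = _ := by field_simp

/-- The mean square of the individual functions. -/
def meanSq (D : FunctionalData Ω) (n : ℕ) (t : ℝ) (ω : Ω) : ℝ :=
  (n : ℝ)⁻¹ * ∑ i ∈ Finset.range n, D.f i t ω ^ 2

/-- Each reconstruction is the true function plus an error; after bilinear expansion the ideal
estimator cancels. The factor `2` bounds `n / (n - 1)`. -/
lemma abs_gammaHat_sub_gammaTilde_le {n : ℕ} (hn : 2 ≤ n) (x : ℝ × ℝ) (ω : Ω) :
    |D.gammaHat p K h n x ω - D.gammaTilde n x ω| ≤
      2 * (√(D.meanSqError p K h n x.1 ω) * √(D.meanSq n x.2 ω) +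
        √(D.meanSq n x.1 ω) * √(D.meanSqError p K h n x.2 ω) +
        √(D.meanSqError p K h n x.1 ω) * √(D.meanSqError p K h n x.2 ω)) := by
  have hn2 : (2 : ℝ) ≤ n := by exact_mod_cast hn
  set e : ℝ → ℕ → ℝ := fun t i => D.fHat p K h n i t ω - D.f i t ω with he
  set f : ℝ → ℕ → ℝ := fun t i => D.f i t ω with hf
  have h1 : D.gammaHat p K h n x ω = ((n : ℝ) - 1)⁻¹ * devSum n (fun i => f x.1 i + e x.1 i)
      (fun i => f x.2 i + e x.2 i) := by
    simp only [he, hf, add_sub_cancel]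
    rfl
  have h2 : D.gammaTilde n x ω = ((n : ℝ) - 1)⁻¹ * devSum n (f x.1) (f x.2) := rfl
  rw [h1, h2, devSum_add_add, ← mul_sub, add_sub_cancel_left, abs_mul,
    abs_of_nonneg (inv_nonneg.2 (by linarith))]
  have e1 := abs_devSum_le n (e x.1) (f x.2)
  have e2 := abs_devSum_le n (f x.1) (e x.2)
  have e3 := abs_devSum_le n (e x.1) (e x.2)
  have e4 : ((n : ℝ) - 1)⁻¹ * n ≤ 2 := by
    rw [inv_mul_le_iff₀ (by linarith)]; linarith
  set Z := √(D.meanSqError p K h n x.1 ω) * √(D.meanSq n x.2 ω) +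
        √(D.meanSq n x.1 ω) * √(D.meanSqError p K h n x.2 ω) +
        √(D.meanSqError p K h n x.1 ω) * √(D.meanSqError p K h n x.2 ω) with hZ
  have hZ0 : 0 ≤ Z := by positivity
  have e5 : |devSum n (e x.1) (f x.2) + devSum n (f x.1) (e x.2) + devSum n (e x.1) (e x.2)| ≤
      n * Z := by
    refine (abs_add_three _ _ _).trans ((add_le_add (add_le_add e1 e2) e3).trans_eq ?_)
    rw [hZ, mul_add, mul_add]
    rfl
  calc _ ≤ ((n : ℝ) - 1)⁻¹ * (n * Z) :=
        mul_le_mul_of_nonneg_left e5 (inv_nonneg.2 (by linarith))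
    _ = (((n : ℝ) - 1)⁻¹ * n) * Z := by ring
    _ ≤ 2 * Z := mul_le_mul_of_nonneg_right e4 hZ0

/-- Markov's inequality: the second moment of `f i t` is at most `2 η(t)² + 2 γ(t, t)`, which is
bounded on a compact set by continuity. -/
lemma ConditionA.isBigOUP_meanSq [IsProbabilityMeasure P] (hD : D.IsModel P)
    (hA : D.ConditionA P p K h π δ J) (hJT : J ⊆ Icc D.a D.b) {S : Set ℝ}
    (hS : IsCompact S) (hSJ : S ⊆ J) : IsBigOUP P D.meanSq (fun _ => 1) S := by
  obtain ⟨M₁, hM₁⟩ := hS.exists_bound_of_continuousOn (hA.η_smooth.continuousOn.mono hSJ)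
  obtain ⟨G, hG0, hGc, -, -⟩ := hA.γ_smooth
  have hγc := hGc 0 (Nat.zero_le _) 0 (Nat.zero_le _)
  rw [hG0] at hγc
  obtain ⟨M₂, hM₂⟩ := (hS.prod hS).exists_bound_of_continuousOn
    (hγc.mono (prod_mono hSJ hSJ))
  set C := 2 * M₁ ^ 2 + 2 * M₂ with hC
  have hmom : ∀ i, ∀ t ∈ S, ∫⁻ ω, ENNReal.ofReal (D.f i t ω ^ 2) ∂P ≤ ENNReal.ofReal C := by
    intro i t ht
    have htT := hJT (hSJ ht)
    have hLp := (hD.v_sp i).memLp_two t htT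
    have hint : Integrable (fun ω => 2 * D.η t ^ 2 + 2 * (D.v i t ω * D.v i t ω)) P :=
      (integrable_const _).add (((hD.v_sp i).integrable_mul htT htT).const_mul 2)
    calc ∫⁻ ω, ENNReal.ofReal (D.f i t ω ^ 2) ∂P
        ≤ ∫⁻ ω, ENNReal.ofReal (2 * D.η t ^ 2 + 2 * (D.v i t ω * D.v i t ω)) ∂P := by
          refine lintegral_mono fun ω => ENNReal.ofReal_le_ofReal ?_
          rw [f]
          nlinarith [sq_nonneg (D.η t - D.v i t ω)]
      _ = ENNReal.ofReal (∫ ω, (2 * D.η t ^ 2 + 2 * (D.v i t ω * D.v i t ω)) ∂P) :=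
          (ofReal_integral_eq_lintegral_ofReal hint (ae_of_all _ fun ω => by
            have := mul_self_nonneg (D.v i t ω)
            show (0 : ℝ) ≤ _
            positivity)).symm
      _ ≤ ENNReal.ofReal C := by
          refine ENNReal.ofReal_le_ofReal ?_
          rw [integral_add (integrable_const _)
            (((hD.v_sp i).integrable_mul htT htT).const_mul 2),
            integral_const_mul 2 fun ω => D.v i t ω * D.v i t ω,
            (hD.v_sp i).integral_mul htT htT]
          simp only [integral_const, probReal_univ, one_smul]
          have h1 := (le_abs_self _).trans (hM₂ (t, t) ⟨ht, ht⟩)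
          have h2 := sq_le_sq' (abs_le.1 (hM₁ t ht)).1 (abs_le.1 (hM₁ t ht)).2
          rw [hC]
          simp only at h1
          linarith
  have hmeas : ∀ i, ∀ t ∈ S, Measurable fun ω => D.f i t ω ^ 2 := fun i t ht =>
    (hD.measurable_f i (hJT (hSJ ht))).pow_const 2
  refine IsBigOUP.of_lintegral_le (C := |C|) (fun n t ht =>
    ((Finset.measurable_fun_sum _ fun i _ => hmeas i t ht).const_mul _).aemeasurable)
    (abs_nonneg C) (Eventually.of_forall fun _ => one_pos) ?_
  filter_upwards [eventually_ge_atTop 1] with n hn t ht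
  have hn0 : (0 : ℝ) < n := by exact_mod_cast hn
  have hsum : ∀ ω, ENNReal.ofReal |D.meanSq n t ω| =
      ENNReal.ofReal ((n : ℝ)⁻¹) * ∑ i ∈ Finset.range n, ENNReal.ofReal (D.f i t ω ^ 2) := by
    intro ω
    rw [abs_of_nonneg (mul_nonneg (by positivity) (Finset.sum_nonneg fun i _ => sq_nonneg _)),
      meanSq, ENNReal.ofReal_mul (by positivity),
      ENNReal.ofReal_sum_of_nonneg fun i _ => sq_nonneg _]
  simp_rw [hsum]
  rw [lintegral_const_mul' _ _ ENNReal.ofReal_ne_top,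
    lintegral_finsetSum' _ fun i _ => (hmeas i t ht).ennreal_ofReal.aemeasurable]
  calc _ ≤ ENNReal.ofReal ((n : ℝ)⁻¹) * ∑ _i ∈ Finset.range n, ENNReal.ofReal C := by
        gcongr with i
        exact hmom i t ht
    _ = ENNReal.ofReal C := by
        rw [Finset.sum_const, Finset.card_range, nsmul_eq_mul, ← mul_assoc,
          ← ENNReal.ofReal_natCast, ← ENNReal.ofReal_mul (by positivity), inv_mul_cancel₀ hn0.ne',
          ENNReal.ofReal_one, one_mul]
    _ ≤ _ := by
        rw [mul_one]
        exact ENNReal.ofReal_le_ofReal (le_abs_self C)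

/-- The effect of the reconstructions on the estimators of the mean and covariance functions. -/
theorem ConditionA.isBigOUP_estimators [IsProbabilityMeasure P] (hD : D.IsModel P)
    (hA : D.ConditionA P p K h π δ J) (hJ : Ioo D.a D.b ⊆ J) (hJT : J ⊆ Icc D.a D.b)
    (hh : h =Θ[atTop] fun n : ℕ => (n : ℝ) ^ (-(δ / (2 * p + 3)))) {S : Set ℝ}
    (hS : IsCompact S) (hSJ : S ⊆ J) :
    IsBigOUP P (fun n s ω => D.etaHat p K h n s ω - D.etaTilde n s ω)
      (fun n : ℕ => (n : ℝ) ^ (-((p + 1) * δ / (2 * p + 3)))) S ∧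
    IsBigOUP P (fun n x ω => D.gammaHat p K h n x ω - D.gammaTilde n x ω)
      (fun n : ℕ => (n : ℝ) ^ (-((p + 1) * δ / (2 * p + 3)))) (S ×ˢ S) := by
  have hE := (hA.isBigOUP_meanSqError hD hJ hJT hh hS hSJ).sqrt
    fun n => Real.rpow_nonneg (Nat.cast_nonneg n) _
  have hF : IsBigOUP P (fun n t ω => √(D.meanSq n t ω)) (fun _ => 1) S :=
    IsBigOUP.sqrt (by simpa using hA.isBigOUP_meanSq hD hJT hS hSJ) fun _ => zero_le_one
  have hfst : MapsTo (Prod.fst : ℝ × ℝ → ℝ) (S ×ˢ S) S := fun x hx => hx.1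
  have hsnd : MapsTo (Prod.snd : ℝ × ℝ → ℝ) (S ×ˢ S) S := fun x hx => hx.2
  refine ⟨hE.of_abs_le zero_le_one (Eventually.of_forall fun n x _ ω => ?_), ?_⟩
  · rw [one_mul, abs_of_nonneg (Real.sqrt_nonneg _)]
    exact abs_etaHat_sub_etaTilde_le n x ω
  · have h1 := (hE.comp hfst).mul (hF.comp hsnd)
    have h2 := (hF.comp hfst).mul (hE.comp hsnd)
    -- The product of two errors has the squared rate, which is at most the rate itself because the
    -- rate is at most one.
    have h3 := ((hE.comp hfst).mul (hE.comp hsnd)).mono_rate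
      (r' := fun n : ℕ => (n : ℝ) ^ (-((p + 1) * δ / (2 * p + 3)))) (by
        filter_upwards [eventually_ge_atTop 1] with n hn
        have h0 : 0 ≤ (n : ℝ) ^ (-((p + 1) * δ / (2 * p + 3))) :=
          Real.rpow_nonneg (Nat.cast_nonneg n) _
        refine ⟨mul_nonneg h0 h0, mul_le_of_le_one_right h0 ?_⟩
        have := hA.δ_pos
        refine Real.rpow_le_one_of_one_le_of_nonpos (by exact_mod_cast hn) ?_
        rw [neg_nonpos]
        positivity)
    simp only [mul_one] at h1
    simp only [one_mul] at h2
    refine ((h1.add h2).add h3).of_abs_le zero_le_two ?_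
    filter_upwards [eventually_ge_atTop 2] with n hn x _ ω
    refine (abs_gammaHat_sub_gammaTilde_le hn x ω).trans ?_
    exact mul_le_mul_of_nonneg_left (le_abs_self _) zero_le_two

end FunctionalData

/-! ### The multivariate central limit theorem -/

section CLT

/-- Convergence in measure of vectors follows from that of their coordinates. -/
lemma tendstoInMeasure_toLp {k : ℕ} {Z : ℕ → Ω → Fin k → ℝ}
    (hZ : ∀ l, TendstoInMeasure P (fun n ω => Z n ω l) atTop fun _ => 0) :
    TendstoInMeasure (E := EuclideanSpace ℝ (Fin k)) P (fun n ω => WithLp.toLp 2 (Z n ω)) atTop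
      0 := by
  rw [tendstoInMeasure_iff_norm]
  intro ε hε
  -- The denominator `k + 1` keeps the estimate valid in dimension zero.
  have hZ' : ∀ l, Tendsto (fun n => P {ω | ε / (k + 1) ≤ |Z n ω l|}) atTop (𝓝 0) := by
    intro l
    have := tendstoInMeasure_iff_norm.1 (hZ l) (ε / (k + 1)) (by positivity)
    simpa using this
  have hsum := tendsto_finsetSum (Finset.univ : Finset (Fin k)) fun l _ => hZ' l
  simp only [Finset.sum_const_zero] at hsum
  refine tendsto_of_tendsto_of_tendsto_of_le_of_le tendsto_const_nhds hsum
    (fun _ => zero_le) fun n => ?_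
  refine le_trans (measure_mono fun ω hω => ?_) (measure_biUnion_finset_le Finset.univ _)
  simp only [mem_ofPred_eq, Pi.zero_apply, sub_zero] at hω
  by_contra hcon
  simp only [Finset.mem_univ, iUnion_true, mem_iUnion, mem_ofPred_eq, not_exists, not_le] at hcon
  have h1 : ‖(WithLp.toLp 2 (Z n ω) : EuclideanSpace ℝ (Fin k))‖ ≤ ∑ l, |Z n ω l| := by
    have h2 : (WithLp.toLp 2 (Z n ω) : EuclideanSpace ℝ (Fin k)) =
        ∑ l, EuclideanSpace.single l (Z n ω l) := by
      ext m
      simp [Pi.single_apply]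
    rw [h2]
    refine (norm_sum_le _ _).trans_eq ?_
    simp
  have h3 : ∑ l, |Z n ω l| ≤ ∑ _l : Fin k, ε / (k + 1) :=
    Finset.sum_le_sum fun l _ => (hcon l).le
  rw [Finset.sum_const, Finset.card_univ, Fintype.card_fin, nsmul_eq_mul] at h3
  have h4 : (k : ℝ) * (ε / (k + 1)) < ε := by
    rw [← mul_div_assoc, div_lt_iff₀ (by positivity)]
    linarith
  linarith

lemma covariance_sum_mul_self {ι : Type*} [Fintype ι] [IsProbabilityMeasure P] {X : ι → Ω → ℝ}
    (hX : ∀ l, MemLp (X l) 2 P) (c : ι → ℝ) :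
    Var[fun ω => ∑ l, c l * X l ω; P] = ∑ l, c l * ∑ l', cov[X l, X l'; P] * c l' := by
  have h1 : (fun ω => ∑ l, c l * X l ω) = ∑ l, fun ω => c l * X l ω := by
    funext ω; simp
  rw [h1, variance_sum fun l => (hX l).const_mul (c l)]
  simp_rw [covariance_const_mul_left, covariance_const_mul_right, Finset.mul_sum]
  exact Finset.sum_congr rfl fun l _ => Finset.sum_congr rfl fun l' _ => by ring

lemma posSemidef_covariance {k : ℕ} [IsProbabilityMeasure P] {X : Fin k → Ω → ℝ}
    (hX : ∀ l, MemLp (X l) 2 P) :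
    (Matrix.of fun l l' => cov[X l, X l'; P]).PosSemidef := by
  refine Matrix.PosSemidef.of_dotProduct_mulVec_nonneg ?_ fun c => ?_
  · ext l l'
    simp [covariance_comm]
  · have h1 := variance_nonneg (fun ω => ∑ l, c l * X l ω) P
    rw [covariance_sum_mul_self hX] at h1
    exact h1

/-- A functional central limit theorem for the finite-dimensional distributions, with a negligible
remainder. -/
theorem isAGP_of_iid {ι : Type*} [IsProbabilityMeasure P] {V : ℕ → ι → Ω → ℝ}
    {X : ℕ → ι → Ω → ℝ} {S : Set ι} {Γ : ι → ι → ℝ}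
    (hind : iIndepFun (fun i ω (s : S) => V i s ω) P)
    (hident : ∀ i, IdentDistrib (fun ω (s : S) => V i s ω) (fun ω (s : S) => V 0 s ω) P P)
    (hL2 : ∀ s ∈ S, MemLp (V 0 s) 2 P) (hmean : ∀ s ∈ S, P[V 0 s] = 0)
    (hcov : ∀ s ∈ S, ∀ t ∈ S, cov[V 0 s, V 0 t; P] = Γ s t)
    (hX : ∀ n, ∀ s ∈ S, AEMeasurable (X n s) P)
    (hrem : ∀ s ∈ S, TendstoInMeasure P
      (fun n ω => X n s ω - (√(n : ℝ))⁻¹ * ∑ i ∈ Finset.range n, V i s ω) atTop fun _ => 0) :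
    IsAGP P X S (fun _ => 0) Γ := by
  intro k x hx
  have hΓ : (Matrix.of fun l l' => Γ (x l) (x l')) =
      Matrix.of fun l l' => cov[V 0 (x l), V 0 (x l'); P] := by
    ext l l'
    exact (hcov _ (hx l) _ (hx l')).symm
  have hpsd : (Matrix.of fun l l' => Γ (x l) (x l')).PosSemidef := by
    rw [hΓ]
    exact posSemidef_covariance fun l => hL2 _ (hx l)
  refine ⟨hpsd, ?_⟩
  have hVm : ∀ i, ∀ s ∈ S, AEMeasurable (V i s) P := fun i s hs =>
    (measurable_pi_apply (⟨s, hs⟩ : S)).comp_aemeasurable (hident i).aemeasurable_fst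
  set Y : ℕ → Ω → EuclideanSpace ℝ (Fin k) := fun n ω =>
    WithLp.toLp 2 fun l => (√(n : ℝ))⁻¹ * ∑ i ∈ Finset.range n, V i (x l) ω with hY
  have htoLp : ∀ Z : Ω → Fin k → ℝ, (∀ l, AEMeasurable (fun ω => Z ω l) P) →
      AEMeasurable (fun ω => (WithLp.toLp 2 (Z ω) : EuclideanSpace ℝ (Fin k))) P := fun Z hZ =>
    (MeasurableEquiv.toLp 2 (Fin k → ℝ)).measurable.comp_aemeasurable (aemeasurable_pi_lambda _ hZ)
  have hYm : ∀ n, AEMeasurable (Y n) P := fun n => htoLp _ fun l =>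
    (Finset.aemeasurable_fun_sum _ fun i _ => hVm i _ (hx l)).const_mul _
  have hYlim : TendstoInDistribution (E := EuclideanSpace ℝ (Fin k)) Y atTop id (fun _ => P)
      (multivariateGaussian (WithLp.toLp 2 fun _ => 0)
        (Matrix.of fun l l' => Γ (x l) (x l'))) := by
    refine ⟨hYm, aemeasurable_id, ProbabilityMeasure.tendsto_iff_tendsto_charFun.2 fun c => ?_⟩
    -- Cramér–Wold: the characteristic function of the vector at `c` is that of the normalized sum
    -- of the projections `W i` at `1`.
    let W : ℕ → Ω → ℝ := fun i ω => ∑ l, c l * V i (x l) ω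
    have hφ : Measurable fun z : S → ℝ => ∑ l, c l * z ⟨x l, hx l⟩ := by fun_prop
    have hWind : iIndepFun W P := hind.comp (fun _ z => ∑ l, c l * z ⟨x l, hx l⟩) fun _ => hφ
    have hWid : ∀ i, IdentDistrib (W i) (W 0) P P := fun i => (hident i).comp hφ
    have hW2 : MemLp (W 0) 2 P := memLp_finsetSum _ fun l _ => (hL2 _ (hx l)).const_mul _
    have hWmean : P[W 0] = 0 := by
      simp only [W]
      rw [integral_finsetSum _ fun l _ => ((hL2 _ (hx l)).const_mul _).integrable one_le_two]
      refine Finset.sum_eq_zero fun l _ => ?_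
      rw [integral_const_mul, hmean _ (hx l), mul_zero]
    have hWvar : Var[W 0; P] = c.ofLp ⬝ᵥ (Matrix.of fun l l' => Γ (x l) (x l')).mulVec c.ofLp := by
      rw [hΓ]
      exact covariance_sum_mul_self (fun l => hL2 _ (hx l)) c
    have hclt := tendstoInDistribution_inv_sqrt_mul_sum_sub (P := P)
      (Y := id) (HasLaw.id (μ := gaussianReal 0 Var[W 0; P].toNNReal)) hW2 hWind hWid
    have h1 := ProbabilityMeasure.tendsto_iff_tendsto_charFun.1 hclt.tendsto 1
    simp only [ProbabilityMeasure.coe_mk, Measure.map_id, charFun_gaussianReal, hWmean] at h1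
    have h2 : charFun (multivariateGaussian (WithLp.toLp 2 fun _ => 0)
        (Matrix.of fun l l' => Γ (x l) (x l'))) c =
        Complex.exp
          (-(c.ofLp ⬝ᵥ (Matrix.of fun l l' => Γ (x l) (x l')).mulVec c.ofLp : ℝ) / 2) := by
      rw [charFun_multivariateGaussian hpsd]
      congr 1
      have : inner ℝ c (WithLp.toLp 2 fun _ : Fin k => (0 : ℝ)) = 0 := by
        simp [PiLp.inner_apply]
      rw [this]
      push_cast
      ring
    simp only [ProbabilityMeasure.coe_mk, Measure.map_id]
    rw [h2, ← hWvar]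
    convert h1 using 2 with n
    · rw [charFun_apply, charFun_apply, integral_map (hYm n) (by fun_prop),
        integral_map (hclt.forall_aemeasurable n |>.congr (by simp [hWmean])) (by fun_prop)]
      refine integral_congr_ae (ae_of_all _ fun ω => ?_)
      simp only [hY, PiLp.inner_apply, W]
      congr 3
      simp only [RCLike.inner_apply, conj_trivial, mul_zero, sub_zero, one_mul]
      rw [Finset.sum_comm, Finset.mul_sum]
      refine Finset.sum_congr rfl fun l _ => ?_
      rw [← Finset.mul_sum]
      ring
    · congr 1
      rw [Real.coe_toNNReal _ (variance_nonneg _ _)]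
      simp
      ring
  -- Slutsky's lemma absorbs the remainder.
  refine tendstoInDistribution_of_tendstoInMeasure_sub (E := EuclideanSpace ℝ (Fin k)) _ _ hYlim ?_
    fun n => htoLp _ fun l => hX n _ (hx l)
  exact tendstoInMeasure_toLp (Z := fun n ω l => X n (x l) ω -
    (√(n : ℝ))⁻¹ * ∑ i ∈ Finset.range n, V i (x l) ω) fun l => hrem _ (hx l)

end CLT

/-! ### Asymptotic normality of the estimators -/

section NormalizedSums

/-- Normalized sums of centred, square-integrable i.i.d. variables are bounded in probability. -/
lemma isBigOUP_inv_sqrt_mul_sum {ι : Type*} {S : Set ι} [IsProbabilityMeasure P] {W : ℕ → Ω → ℝ}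
    (hind : iIndepFun W P) (hident : ∀ i, IdentDistrib (W i) (W 0) P P)
    (hL2 : MemLp (W 0) 2 P) (hmean : P[W 0] = 0) :
    IsBigOUP P (fun n (_ : ι) ω => (√(n : ℝ))⁻¹ * ∑ i ∈ Finset.range n, W i ω) (fun _ => 1) S := by
  have hL : ∀ i, MemLp (W i) 2 P := fun i => (hident i).memLp_iff.2 hL2
  have hsum : ∀ n, MemLp (∑ i ∈ Finset.range n, W i) 2 P := fun n =>
    memLp_finsetSum' _ fun i _ => hL i
  have hvar : ∀ n, ∫ ω, (∑ i ∈ Finset.range n, W i ω) ^ 2 ∂P = n * Var[W 0; P] := by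
    intro n
    have h1 := IndepFun.variance_sum (s := Finset.range n) (fun i _ => hL i)
      fun i _ j _ hij => hind.indepFun hij
    have h0 : P[∑ i ∈ Finset.range n, W i] = 0 := by
      simp only [Finset.sum_apply]
      rw [integral_finsetSum _ fun i _ => (hL i).integrable one_le_two]
      refine Finset.sum_eq_zero fun i _ => ?_
      rw [(hident i).integral_eq, hmean]
    rw [variance_of_integral_eq_zero (hsum n).aemeasurable h0] at h1
    simp only [Finset.sum_apply] at h1
    rw [h1, Finset.sum_congr rfl fun i _ => (hident i).variance_eq]
    simp
  have hsq : IsBigOUP P (fun n (_ : ι) ω => ((√(n : ℝ))⁻¹ * ∑ i ∈ Finset.range n, W i ω) ^ 2)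
      (fun _ => (1 : ℝ) ^ 2) S := by
    refine IsBigOUP.of_lintegral_le (C := Var[W 0; P]) (fun n _ _ => ?_) (variance_nonneg _ _)
      (Eventually.of_forall fun _ => by norm_num) ?_
    · exact ((Finset.aemeasurable_fun_sum _ fun i _ => (hL i).aemeasurable).const_mul _).pow_const 2
    · filter_upwards [eventually_ge_atTop 1] with n hn _ _
      have hn0 : (0 : ℝ) < n := by exact_mod_cast hn
      have hint : Integrable (fun ω => ((√(n : ℝ))⁻¹ * ∑ i ∈ Finset.range n, W i ω) ^ 2) P := by
        have := ((hsum n).const_mul (√(n : ℝ))⁻¹).integrable_sq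
        simpa using this
      simp only [abs_sq]
      rw [← ofReal_integral_eq_lintegral_ofReal hint (ae_of_all _ fun ω => sq_nonneg _)]
      simp_rw [mul_pow]
      rw [integral_const_mul, hvar, inv_pow, Real.sq_sqrt hn0.le]
      refine ENNReal.ofReal_le_ofReal (le_of_eq ?_)
      field_simp
  refine (hsq.sqrt fun _ => zero_le_one).of_abs_le zero_le_one
    (Eventually.of_forall fun n x _ ω => ?_)
  rw [Real.sqrt_sq_eq_abs, abs_abs, one_mul]

end NormalizedSums

/-- The lower bound for `δ` equals `(2 p + 3) / (2 (p + 1))`, so it says exactly that the exponent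
`(p + 1) δ / (2 p + 3)` exceeds `1 / 2`. -/
lemma tendsto_sqrt_mul_rpow {p : ℕ} {δ : ℝ} (hδ : 1 + 1 / (2 * (p + 1)) < δ) :
    Tendsto (fun n : ℕ => √(n : ℝ) * (n : ℝ) ^ (-((p + 1) * δ / (2 * p + 3)))) atTop (𝓝 0) := by
  have h1 : 0 < (p + 1) * δ / (2 * p + 3) - 1 / 2 := by
    have e : (1 : ℝ) + 1 / (2 * (p + 1)) = (2 * p + 3) / (2 * (p + 1)) := by field_simp; ring
    rw [e, div_lt_iff₀ (by positivity)] at hδ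
    rw [sub_pos, lt_div_iff₀ (by positivity)]
    linarith
  refine ((tendsto_rpow_neg_atTop h1).comp tendsto_natCast_atTop_atTop).congr' ?_
  filter_upwards [eventually_ge_atTop 1] with n hn
  have hn0 : (0 : ℝ) < n := by exact_mod_cast hn
  rw [Function.comp_apply, Real.sqrt_eq_rpow, ← Real.rpow_add hn0]
  congr 1
  ring

lemma tendsto_inv_sqrt_natCast : Tendsto (fun n : ℕ => (√(n : ℝ))⁻¹) atTop (𝓝 0) :=
  tendsto_inv_atTop_zero.comp (Real.tendsto_sqrt_atTop.comp tendsto_natCast_atTop_atTop)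

namespace FunctionalData

variable {D : FunctionalData Ω} {p : ℕ} {K : ℝ → ℝ} {h : ℕ → ℝ} {π : ℝ → ℝ} {δ : ℝ} {J : Set ℝ}

lemma ConditionA.aemeasurable_etaHat [IsProbabilityMeasure P] (hD : D.IsModel P)
    (hA : D.ConditionA P p K h π δ J) (hJ : Ioo D.a D.b ⊆ J) (hJT : J ⊆ Icc D.a D.b)
    (n : ℕ) (s : ℝ) : AEMeasurable (D.etaHat p K h n s) P :=
  (Finset.aemeasurable_fun_sum _ fun _ hi =>
    hA.aemeasurable_fHat hD hJ hJT (Finset.mem_range.1 hi) s).const_mul _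

lemma ConditionA.aemeasurable_gammaHat [IsProbabilityMeasure P] (hD : D.IsModel P)
    (hA : D.ConditionA P p K h π δ J) (hJ : Ioo D.a D.b ⊆ J) (hJT : J ⊆ Icc D.a D.b)
    (n : ℕ) (x : ℝ × ℝ) : AEMeasurable (D.gammaHat p K h n x) P :=
  (Finset.aemeasurable_fun_sum _ fun _ hi =>
    ((hA.aemeasurable_fHat hD hJ hJT (Finset.mem_range.1 hi) _).sub
      (hA.aemeasurable_etaHat hD hJ hJT n _)).mul
    ((hA.aemeasurable_fHat hD hJ hJT (Finset.mem_range.1 hi) _).sub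
      (hA.aemeasurable_etaHat hD hJ hJT n _))).const_mul _

/-- Asymptotic normality of the estimator of the mean function. -/
theorem ConditionA.isAGP_etaHat [IsProbabilityMeasure P] (hD : D.IsModel P)
    (hA : D.ConditionA P p K h π δ J) (hJ : Ioo D.a D.b ⊆ J) (hJT : J ⊆ Icc D.a D.b)
    (hh : h =Θ[atTop] fun n : ℕ => (n : ℝ) ^ (-(δ / (2 * p + 3))))
    (hδ : 1 + 1 / (2 * (p + 1)) < δ) :
    IsAGP P (fun n s ω => √(n : ℝ) * (D.etaHat p K h n s ω - D.η s)) J (fun _ => 0) D.γ := by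
  have hφ : Measurable fun (z : D.T → ℝ) (s : J) => z ⟨s, hJT s.2⟩ :=
    measurable_pi_lambda _ fun s => measurable_pi_apply _
  refine isAGP_of_iid (V := D.v) (hD.v_indep.comp (fun _ z (s : J) => z ⟨s, hJT s.2⟩) fun _ => hφ)
    (fun i => (hD.v_ident i).comp hφ) (fun s hs => (hD.v_sp 0).memLp_two s (hJT hs))
    (fun s hs => (hD.v_sp 0).mean s (hJT hs))
    (fun s hs t ht => (hD.v_sp 0).cov s (hJT hs) t (hJT ht))
    (fun n s _ => ((hA.aemeasurable_etaHat hD hJ hJT n s).sub_const _).const_mul _)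
    fun s hs => ?_
  -- Since `√n (η̃ - η)` is exactly the normalized sum of the subject effects, the remainder is `√n
  -- (η̂ - η̃)`, and the rate is needed only at the single point `s`.
  have h1 := ((hA.isBigOUP_estimators hD hJ hJT hh isCompact_singleton
    (singleton_subset_iff.2 hs)).1.const_mul fun n : ℕ => Real.sqrt_nonneg (n : ℝ)).tendstoInMeasure
    (tendsto_sqrt_mul_rpow hδ) (mem_singleton s)
  convert h1 using 3 with n ω
  rcases n.eq_zero_or_pos with rfl | hn
  · simp
  have hn0 : (0 : ℝ) < n := by exact_mod_cast hn
  simp only [etaTilde, f, Finset.sum_add_distrib, Finset.sum_const, Finset.card_range,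
    nsmul_eq_mul]
  have hsq := Real.sq_sqrt hn0.le
  have hs0 : √(n : ℝ) ≠ 0 := (Real.sqrt_pos.2 hn0).ne'
  generalize √(n : ℝ) = r at hsq hs0
  rw [← hsq]
  field_simp
  ring

/-- Sample covariances ignore shifts, so the mean function drops out of the ideal covariance
estimator. -/
lemma devSum_const_add {n : ℕ} (hn : 0 < n) (c d : ℝ) (a b : ℕ → ℝ) :
    devSum n (fun i => c + a i) (fun i => d + b i) = devSum n a b := by
  have hn0 : (n : ℝ) ≠ 0 := by positivity
  simp only [devSum, Finset.sum_add_distrib, Finset.sum_const, Finset.card_range, nsmul_eq_mul,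
    mul_add, inv_mul_cancel_left₀ hn0, add_sub_add_left_eq_sub]

/-- The sample covariance of the individual functions, in terms of normalized sums. -/
lemma sqrt_mul_gammaTilde {n : ℕ} (hn : 2 ≤ n) (x : ℝ × ℝ) (ω : Ω) :
    √(n : ℝ) * (D.gammaTilde n x ω - D.γ x.1 x.2) -
      (√(n : ℝ))⁻¹ * ∑ i ∈ Finset.range n, (D.v i x.1 ω * D.v i x.2 ω - D.γ x.1 x.2) =
    ((n : ℝ) - 1)⁻¹ *
      ((√(n : ℝ))⁻¹ * ∑ i ∈ Finset.range n, (D.v i x.1 ω * D.v i x.2 ω - D.γ x.1 x.2) +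
        √(n : ℝ) * (D.γ x.1 x.2 - ((√(n : ℝ))⁻¹ * ∑ i ∈ Finset.range n, D.v i x.1 ω) *
          ((√(n : ℝ))⁻¹ * ∑ i ∈ Finset.range n, D.v i x.2 ω))) := by
  have hn2 : (2 : ℝ) ≤ n := by exact_mod_cast hn
  have h1 : D.gammaTilde n x ω = ((n : ℝ) - 1)⁻¹ * devSum n (fun i => D.v i x.1 ω)
      (fun i => D.v i x.2 ω) := by
    rw [← devSum_const_add (by lia) (D.η x.1) (D.η x.2)]
    rfl
  rw [h1, devSum_eq (by lia)]
  simp only [Finset.sum_sub_distrib, Finset.sum_const, Finset.card_range, nsmul_eq_mul]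
  have hn1 : (n : ℝ) - 1 ≠ 0 := by linarith
  have hsq := Real.sq_sqrt (show (0 : ℝ) ≤ n by linarith)
  have hs0 : √(n : ℝ) ≠ 0 := (Real.sqrt_pos.2 (show (0 : ℝ) < n by linarith)).ne'
  generalize √(n : ℝ) = r at hsq hs0
  rw [← hsq] at hn1 ⊢
  field_simp
  ring

/-- Asymptotic normality of the estimator of the covariance function. -/
theorem ConditionA.isAGP_gammaHat [IsProbabilityMeasure P] (hD : D.IsModel P)
    (hA : D.ConditionA P p K h π δ J) (hJ : Ioo D.a D.b ⊆ J) (hJT : J ⊆ Icc D.a D.b)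
    (hh : h =Θ[atTop] fun n : ℕ => (n : ℝ) ^ (-(δ / (2 * p + 3))))
    (hδ : 1 + 1 / (2 * (p + 1)) < δ) (h4 : ∀ s ∈ J, MemLp (D.v 0 s) 4 P) :
    IsAGP P (fun n x ω => √(n : ℝ) * (D.gammaHat p K h n x ω - D.γ x.1 x.2)) (J ×ˢ J)
      (fun _ => 0) (D.gammaStar P) := by
  have hφ : Measurable fun (z : D.T → ℝ) (x : (J ×ˢ J : Set (ℝ × ℝ))) =>
      z ⟨x.1.1, hJT x.2.1⟩ * z ⟨x.1.2, hJT x.2.2⟩ - D.γ x.1.1 x.1.2 :=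
    measurable_pi_lambda _ fun s => by fun_prop
  have hmul : ∀ x ∈ J ×ˢ J, MemLp (fun ω => D.v 0 x.1 ω * D.v 0 x.2 ω) 2 P := by
    intro x hx
    -- Products of two variables with fourth moments are square-integrable.
    have : ENNReal.HolderTriple 4 4 2 := ⟨by
      rw [show (4 : ℝ≥0∞) = 2 * 2 by norm_num, ENNReal.mul_inv (by simp) (by simp), ← mul_add,
        ENNReal.inv_two_add_inv_two, mul_one]⟩
    exact (h4 _ hx.2).mul (h4 _ hx.1)
  have hL2 : ∀ x ∈ J ×ˢ J, MemLp (fun ω => D.v 0 x.1 ω * D.v 0 x.2 ω - D.γ x.1 x.2) 2 P :=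
    fun x hx => (hmul x hx).sub (memLp_const _)
  have hint : ∀ x ∈ J ×ˢ J, ∫ ω, D.v 0 x.1 ω * D.v 0 x.2 ω ∂P = D.γ x.1 x.2 := fun x hx =>
    (hD.v_sp 0).integral_mul (hJT hx.1) (hJT hx.2)
  have hmean : ∀ x ∈ J ×ˢ J, ∫ ω, (D.v 0 x.1 ω * D.v 0 x.2 ω - D.γ x.1 x.2) ∂P = 0 := by
    intro x hx
    rw [integral_sub ((hmul x hx).integrable one_le_two) (integrable_const _), hint x hx]
    simp
  have hind : iIndepFun (fun i ω (x : (J ×ˢ J : Set (ℝ × ℝ))) =>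
      D.v i x.1.1 ω * D.v i x.1.2 ω - D.γ x.1.1 x.1.2) P :=
    hD.v_indep.comp (fun _ z (x : (J ×ˢ J : Set (ℝ × ℝ))) =>
      z ⟨x.1.1, hJT x.2.1⟩ * z ⟨x.1.2, hJT x.2.2⟩ - D.γ x.1.1 x.1.2) fun _ => hφ
  have hid : ∀ i, IdentDistrib
      (fun ω (x : (J ×ˢ J : Set (ℝ × ℝ))) => D.v i x.1.1 ω * D.v i x.1.2 ω - D.γ x.1.1 x.1.2)
      (fun ω (x : (J ×ˢ J : Set (ℝ × ℝ))) => D.v 0 x.1.1 ω * D.v 0 x.1.2 ω - D.γ x.1.1 x.1.2)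
      P P := fun i => (hD.v_ident i).comp hφ
  refine isAGP_of_iid (V := fun i x ω => D.v i x.1 ω * D.v i x.2 ω - D.γ x.1 x.2) hind hid hL2
    hmean (fun x hx y hy => ?_)
    (fun n s _ => ((hA.aemeasurable_gammaHat hD hJ hJT n s).sub_const _).const_mul _)
    fun x hx => ?_
  · rw [covariance_sub_const_left ((hmul x hx).integrable one_le_two),
      covariance_sub_const_right ((hmul y hy).integrable one_le_two),
      covariance_eq_sub (hmul x hx) (hmul y hy), hint x hx, hint y hy, gammaStar]
    congr 2
    funext ω
    simp only [Pi.mul_apply]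
    ring
  have hpt : ∀ s ∈ J, IsBigOUP P
      (fun n (_ : ℝ × ℝ) ω => (√(n : ℝ))⁻¹ * ∑ i ∈ Finset.range n, D.v i s ω) (fun _ => 1) {x} := by
    intro s hs
    have he : Measurable fun z : D.T → ℝ => z ⟨s, hJT hs⟩ := measurable_pi_apply _
    exact isBigOUP_inv_sqrt_mul_sum (hD.v_indep.comp (fun _ z => z ⟨s, hJT hs⟩) fun _ => he)
      (fun i => (hD.v_ident i).comp he) ((hD.v_sp 0).memLp_two s (hJT hs))
      ((hD.v_sp 0).mean s (hJT hs))
  have hU : IsBigOUP P (fun n (_ : ℝ × ℝ) ω => (√(n : ℝ))⁻¹ *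
      ∑ i ∈ Finset.range n, (D.v i x.1 ω * D.v i x.2 ω - D.γ x.1 x.2)) (fun _ => 1) {x} := by
    have he : Measurable fun z : (J ×ˢ J : Set (ℝ × ℝ)) → ℝ => z ⟨x, hx⟩ := measurable_pi_apply _
    exact isBigOUP_inv_sqrt_mul_sum (hind.comp (fun _ z => z ⟨x, hx⟩) fun _ => he)
      (fun i => (hid i).comp he) (hL2 x hx) (hmean x hx)
  have hconst : IsBigOUP P (fun _ (_ : ℝ × ℝ) (_ : Ω) => D.γ x.1 x.2) (fun _ => 1) {x} := by
    refine fun ε hε => ⟨|D.γ x.1 x.2|, Eventually.of_forall fun n y _ => ?_⟩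
    simp
  have habs : ∀ {X : ℕ → ℝ × ℝ → Ω → ℝ} {r : ℕ → ℝ}, IsBigOUP P X r {x} →
      IsBigOUP P (fun n y ω => |X n y ω|) r {x} := fun hX =>
    hX.of_abs_le zero_le_one (Eventually.of_forall fun n y _ ω => by rw [abs_abs, one_mul])
  have hsub : {x.1, x.2} ⊆ J := insert_subset hx.1 (singleton_subset_iff.2 hx.2)
  have hest := habs (((hA.isBigOUP_estimators hD hJ hJT hh (S := {x.1, x.2})
    ((finite_singleton _).insert _).isCompact hsub).2.comp (φ := id) (S' := {x})
    (fun y hy => by rw [mem_singleton_iff.1 hy]; simp)).const_mul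
      fun n : ℕ => Real.sqrt_nonneg (n : ℝ))
  have hsum := ((habs hU).add ((habs hconst).add (habs ((hpt x.1 hx.1).mul
    ((hpt x.2 hx.2).mono_rate (r' := fun _ => 1) (by simp))) |>.mono_rate
      (r' := fun _ => 1) (by simp)))).const_mul fun n : ℕ => inv_nonneg.2 (Real.sqrt_nonneg (n : ℝ))
  set ρ : ℕ → ℝ := fun n => √(n : ℝ) * (n : ℝ) ^ (-((p + 1) * δ / (2 * p + 3))) with hρ
  have hρ0 : ∀ n, 0 ≤ ρ n := fun n =>
    mul_nonneg (Real.sqrt_nonneg _) (Real.rpow_nonneg (Nat.cast_nonneg n) _)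
  have hr0 : ∀ n : ℕ, 0 ≤ (√(n : ℝ))⁻¹ := fun n => inv_nonneg.2 (Real.sqrt_nonneg _)
  have htot := (hest.mono_rate (r' := fun n => ρ n + (√(n : ℝ))⁻¹)
      (Eventually.of_forall fun n => ⟨hρ0 n, le_add_of_nonneg_right (hr0 n)⟩)).add
    (hsum.mono_rate (r' := fun n => ρ n + (√(n : ℝ))⁻¹)
      (Eventually.of_forall fun n => by
        rw [mul_one]
        exact ⟨hr0 n, le_add_of_nonneg_left (hρ0 n)⟩))
  have hrem : IsBigOUP P (fun n y ω => √(n : ℝ) * (D.gammaHat p K h n y ω - D.γ y.1 y.2) -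
      (√(n : ℝ))⁻¹ * ∑ i ∈ Finset.range n, (D.v i y.1 ω * D.v i y.2 ω - D.γ y.1 y.2))
      (fun n => ρ n + (√(n : ℝ))⁻¹) {x} := by
    refine htot.of_abs_le zero_le_two ?_
    filter_upwards [eventually_ge_atTop 2] with n hn y hy ω
    obtain rfl := mem_singleton_iff.1 hy
    have e1 := sqrt_mul_gammaTilde (D := D) hn y ω
    have hn2 : (2 : ℝ) ≤ n := by exact_mod_cast hn
    simp only [id_eq]
    set U := (√(n : ℝ))⁻¹ *
      ∑ i ∈ Finset.range n, (D.v i y.1 ω * D.v i y.2 ω - D.γ y.1 y.2)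
    set U₁ := (√(n : ℝ))⁻¹ * ∑ i ∈ Finset.range n, D.v i y.1 ω
    set U₂ := (√(n : ℝ))⁻¹ * ∑ i ∈ Finset.range n, D.v i y.2 ω
    -- The remainder has two sources: the reconstructions, of order `ρ n`, and the estimated mean
    -- together with the factor `1 / (n - 1)`, of order `(√n)⁻¹` because `U`, `U₁` and `U₂` are
    -- bounded in probability.
    have e2 : √(n : ℝ) * (D.gammaHat p K h n y ω - D.γ y.1 y.2) - U =
        √(n : ℝ) * (D.gammaHat p K h n y ω - D.gammaTilde n y ω) +
          ((n : ℝ) - 1)⁻¹ * (U + √(n : ℝ) * (D.γ y.1 y.2 - U₁ * U₂)) := by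
      rw [← e1]; ring
    have hn1 : (0 : ℝ) < n - 1 := by linarith
    have hsq := Real.sq_sqrt (show (0 : ℝ) ≤ n by linarith)
    have hr1 : 1 ≤ √(n : ℝ) := Real.one_le_sqrt.2 (by linarith)
    have e3 : |U + √(n : ℝ) * (D.γ y.1 y.2 - U₁ * U₂)| ≤
        √(n : ℝ) * (|U| + (|D.γ y.1 y.2| + |U₁ * U₂|)) := by
      refine (abs_add_le _ _).trans ?_
      rw [abs_mul (√(n : ℝ)), abs_of_pos (one_pos.trans_le hr1), mul_add]
      exact add_le_add (le_mul_of_one_le_left (abs_nonneg _) hr1)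
        (mul_le_mul_of_nonneg_left (abs_sub _ _) (Real.sqrt_nonneg _))
    have e4 : ((n : ℝ) - 1)⁻¹ * √(n : ℝ) ≤ 2 * (√(n : ℝ))⁻¹ := by
      rw [inv_mul_le_iff₀ hn1, ← mul_assoc, le_mul_inv_iff₀ (one_pos.trans_le hr1), ← pow_two, hsq]
      linarith
    set Z := |U| + (|D.γ y.1 y.2| + |U₁ * U₂|)
    have hZ : 0 ≤ Z := by positivity
    set A := √(n : ℝ) * (D.gammaHat p K h n y ω - D.gammaTilde n y ω)
    calc _ ≤ |A| + ((n : ℝ) - 1)⁻¹ * (√(n : ℝ) * Z) := by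
          rw [e2]
          refine (abs_add_le _ _).trans (add_le_add_right ?_ _)
          rw [abs_mul, abs_of_pos (inv_pos.2 hn1)]
          exact mul_le_mul_of_nonneg_left e3 (inv_pos.2 hn1).le
      _ ≤ |A| + 2 * (√(n : ℝ))⁻¹ * Z := by
          rw [← mul_assoc]
          exact add_le_add_right (mul_le_mul_of_nonneg_right e4 hZ) _
      _ ≤ 2 * (|A| + (√(n : ℝ))⁻¹ * Z) := by linarith [abs_nonneg A]
      _ ≤ _ := mul_le_mul_of_nonneg_left (le_abs_self _) zero_le_two
  exact hrem.tendstoInMeasure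
    (by simpa using (tendsto_sqrt_mul_rpow hδ).add tendsto_inv_sqrt_natCast) (mem_singleton x)

end FunctionalData

/-! ### Fourth moments of Gaussian processes -/

section GaussianMoments

open scoped NNReal

/-- The fourth derivative at `0` of the moment generating function `exp (v t² / 2)`. Each
differentiation keeps the form polynomial times exponential and sends the polynomial `q` to `q' + v
t q`. -/
lemma integral_pow_four_gaussianReal (v : ℝ≥0) :
    ∫ x, x ^ 4 ∂gaussianReal 0 v = 3 * (v : ℝ) ^ 2 := by
  have hmem : (0 : ℝ) ∈ interior (integrableExpSet id (gaussianReal 0 v)) := by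
    rw [integrableExpSet_id_gaussianReal, interior_univ]
    exact mem_univ _
  have hder : ∀ q : Polynomial ℝ, deriv (fun t => q.eval t * Real.exp (v * t ^ 2 / 2)) =
      fun t => (q.derivative + Polynomial.C (v : ℝ) * Polynomial.X * q).eval t *
        Real.exp (v * t ^ 2 / 2) := by
    intro q
    funext t
    have h1 : HasDerivAt (fun t : ℝ => (v : ℝ) * t ^ 2 / 2) (v * t) t := by
      refine (((hasDerivAt_pow 2 t).const_mul (v : ℝ)).div_const 2).congr_deriv ?_
      norm_num
      ring
    refine ((q.hasDerivAt t).mul h1.exp).deriv.trans ?_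
    simp only [Polynomial.eval_add, Polynomial.eval_mul, Polynomial.eval_C, Polynomial.eval_X]
    ring
  have e : (fun x : ℝ => x ^ 4) = id ^ 4 := rfl
  have e0 : (fun t : ℝ => Real.exp (0 * t + v * t ^ 2 / 2)) =
      fun t => (1 : Polynomial ℝ).eval t * Real.exp (v * t ^ 2 / 2) := by simp
  rw [e, ← iteratedDeriv_mgf_zero hmem 4, mgf_id_gaussianReal, e0, iteratedDeriv_succ,
    iteratedDeriv_succ, iteratedDeriv_succ, iteratedDeriv_one, hder, hder, hder, hder]
  simp
  ring

lemma integral_pow_four_of_hasGaussianLaw {L : Ω → ℝ} (hL : HasGaussianLaw L P)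
    (hmean : P[L] = 0) : ∫ ω, L ω ^ 4 ∂P = 3 * (∫ ω, L ω ^ 2 ∂P) ^ 2 := by
  have h1 := hL.map_eq_gaussianReal
  rw [hmean] at h1
  have h2 : ∫ ω, L ω ^ 4 ∂P = ∫ x, x ^ 4 ∂(P.map L) :=
    (integral_map (f := fun x : ℝ => x ^ 4) hL.aemeasurable (by fun_prop)).symm
  rw [h2, h1, integral_pow_four_gaussianReal, Real.coe_toNNReal _ (variance_nonneg _ _),
    variance_of_integral_eq_zero hL.aemeasurable hmean]

/-- The moments of order four of a centred Gaussian process. -/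
theorem integral_mul_mul_mul_of_isGaussianProcess {T : Type*} {X : T → Ω → ℝ}
    (hX : IsGaussianProcess X P) (hmean : ∀ t, P[X t] = 0) (t₁ t₂ t₃ t₄ : T) :
    ∫ ω, X t₁ ω * X t₂ ω * X t₃ ω * X t₄ ω ∂P =
      (∫ ω, X t₁ ω * X t₂ ω ∂P) * (∫ ω, X t₃ ω * X t₄ ω ∂P) +
      (∫ ω, X t₁ ω * X t₃ ω ∂P) * (∫ ω, X t₂ ω * X t₄ ω ∂P) +
      (∫ ω, X t₁ ω * X t₄ ω ∂P) * (∫ ω, X t₂ ω * X t₃ ω ∂P) := by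
  have hLp : ∀ t, MemLp (X t) 2 P := fun t => (hX.hasGaussianLaw_eval t).memLp_two
  have hint : ∀ t t', Integrable (fun ω => X t ω * X t' ω) P := fun t t' =>
    (hLp t).integrable_mul (hLp t')
  have hP := hX.isProbabilityMeasure
  set y : Fin 4 → T := ![t₁, t₂, t₃, t₄] with hy
  have hgauss : ∀ c : Fin 4 → ℝ, HasGaussianLaw (fun ω => ∑ i, c i * X (y i) ω) P := fun c =>
    ((hX.comp_right y).smul c).hasGaussianLaw_fun_sum
  have hsq : ∀ c : Fin 4 → ℝ, ∫ ω, (∑ i, c i * X (y i) ω) ^ 2 ∂P =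
      ∑ i, ∑ j, c i * c j * ∫ ω, X (y i) ω * X (y j) ω ∂P := by
    intro c
    have h1 : ∀ ω, (∑ i, c i * X (y i) ω) ^ 2 =
        ∑ i, ∑ j, c i * c j * (X (y i) ω * X (y j) ω) := by
      intro ω
      rw [pow_two, Finset.sum_mul_sum]
      exact Finset.sum_congr rfl fun i _ => Finset.sum_congr rfl fun j _ => by ring
    simp_rw [h1]
    rw [integral_finsetSum _ fun i _ => integrable_finsetSum _ fun j _ => (hint _ _).const_mul _]
    refine Finset.sum_congr rfl fun i _ => ?_
    rw [integral_finsetSum _ fun j _ => (hint _ _).const_mul _]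
    exact Finset.sum_congr rfl fun j _ => integral_const_mul _ _
  have hzero : ∀ c : Fin 4 → ℝ, ∫ ω, ∑ i, c i * X (y i) ω ∂P = 0 := by
    intro c
    rw [integral_finsetSum _ fun i _ => ((hLp _).integrable one_le_two).const_mul _]
    refine Finset.sum_eq_zero fun i _ => ?_
    rw [integral_const_mul, hmean, mul_zero]
  have h4 : ∀ c : Fin 4 → ℝ, ∫ ω, (∑ i, c i * X (y i) ω) ^ 4 ∂P =
      3 * (∑ i, ∑ j, c i * c j * ∫ ω, X (y i) ω * X (y j) ω ∂P) ^ 2 := fun c => by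
    rw [integral_pow_four_of_hasGaussianLaw (hgauss c) (hzero c), hsq]
  have hint4 : ∀ c : Fin 4 → ℝ, Integrable (fun ω => (∑ i, c i * X (y i) ω) ^ 4) P := by
    intro c
    have := ((hgauss c).memLp (p := 4) (by simp)).integrable_norm_pow (by simp)
    refine this.congr (ae_of_all _ fun ω => ?_)
    simp only [Real.norm_eq_abs]
    exact Even.pow_abs (by decide) _
  let s : Finset ℝ := {1, -1}
  -- Polarization: summing signed fourth powers over the eight sign choices leaves only the monomial
  -- with all four factors, with coefficient `8 * 4! = 192`. Every linear combination is a centred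
  -- normal variable, so its fourth moment is three times its squared variance.
  have hpol : ∀ ω, X t₁ ω * X t₂ ω * X t₃ ω * X t₄ ω = (192 : ℝ)⁻¹ *
      ∑ q ∈ s ×ˢ s ×ˢ s, q.1 * q.2.1 * q.2.2 *
        (∑ i, (![1, q.1, q.2.1, q.2.2] : Fin 4 → ℝ) i * X (y i) ω) ^ 4 := by
    intro ω
    have hne : (1 : ℝ) ≠ -1 := by norm_num
    simp only [s, Finset.sum_product, Finset.sum_pair hne, Fin.sum_univ_four, hy]
    simp
    ring
  simp_rw [hpol]
  rw [integral_const_mul, integral_finsetSum _ fun q _ => (hint4 _).const_mul _]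
  simp_rw [integral_const_mul, h4]
  have hcomm : ∀ t t', ∫ ω, X t ω * X t' ω ∂P = ∫ ω, X t' ω * X t ω ∂P := fun t t' => by
    simp_rw [mul_comm]
  have hne : (1 : ℝ) ≠ -1 := by norm_num
  simp only [s, Finset.sum_product, Finset.sum_pair hne, Fin.sum_univ_four, hy]
  simp only [Matrix.cons_val]
  rw [hcomm t₂ t₁, hcomm t₃ t₁, hcomm t₃ t₂, hcomm t₄ t₁, hcomm t₄ t₂, hcomm t₄ t₃]
  ring

end GaussianMoments

namespace FunctionalData

variable {D : FunctionalData Ω}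

/-- Of the three pairings in the fourth moment, the one of `s₁` with `t₁` and `s₂` with `t₂` is
cancelled by the centring in `gammaStar`. -/
theorem IsModel.gammaStar_eq_of_isGaussianProcess [IsProbabilityMeasure P] (hD : D.IsModel P)
    (hG : IsGaussianProcess (fun (s : Icc D.a D.b) => D.v 0 s) P) {s₁ t₁ s₂ t₂ : ℝ}
    (hs₁ : s₁ ∈ Icc D.a D.b) (ht₁ : t₁ ∈ Icc D.a D.b) (hs₂ : s₂ ∈ Icc D.a D.b)
    (ht₂ : t₂ ∈ Icc D.a D.b) :
    D.gammaStar P (s₁, t₁) (s₂, t₂) = D.γ s₁ t₂ * D.γ s₂ t₁ + D.γ s₁ s₂ * D.γ t₁ t₂ := by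
  have h1 := integral_mul_mul_mul_of_isGaussianProcess hG
    (fun t => (hD.v_sp 0).mean t t.2) ⟨s₁, hs₁⟩ ⟨t₁, ht₁⟩ ⟨s₂, hs₂⟩ ⟨t₂, ht₂⟩
  simp only at h1
  rw [gammaStar, h1, (hD.v_sp 0).integral_mul hs₁ ht₁, (hD.v_sp 0).integral_mul hs₂ ht₂,
    (hD.v_sp 0).integral_mul hs₁ hs₂, (hD.v_sp 0).integral_mul ht₁ ht₂,
    (hD.v_sp 0).integral_mul hs₁ ht₂, ← (hD.v_sp 0).integral_mul hs₂ ht₁]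
  simp_rw [mul_comm (D.v 0 t₁ _)]
  ring

end FunctionalData

end FDA

end

theorem theorem4 {Ω : Type*} [MeasurableSpace Ω] (P : Measure Ω) [IsProbabilityMeasure P]
    (D : FDA.FunctionalData Ω) (hD : D.IsModel P)
    (p : ℕ) (hp : Odd p) (K : ℝ → ℝ) (h : ℕ → ℝ) (π : ℝ → ℝ) (δ : ℝ)
    (J : Set ℝ) (hJ : Ioo D.a D.b ⊆ J) (hJT : J ⊆ Icc D.a D.b)
    (hA : D.ConditionA P p K h π δ J)
    (hh : h =Θ[atTop] fun n : ℕ => (n : ℝ) ^ (-(δ / (2 * p + 3)))) :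
    (∀ S : Set ℝ, IsCompact S → S ⊆ J →
      FDA.IsBigOUP P (fun n s ω => D.etaHat p K h n s ω - D.etaTilde n s ω)
        (fun n : ℕ => (n : ℝ) ^ (-((p + 1) * δ / (2 * p + 3)))) S ∧
      FDA.IsBigOUP P (fun n x ω => D.gammaHat p K h n x ω - D.gammaTilde n x ω)
        (fun n : ℕ => (n : ℝ) ^ (-((p + 1) * δ / (2 * p + 3)))) (S ×ˢ S)) ∧
    (1 + 1 / (2 * (p + 1)) < δ →
      FDA.IsAGP P (fun n s ω => √(n : ℝ) * (D.etaHat p K h n s ω - D.η s)) J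
        (fun _ => 0) D.γ ∧
      ((∀ s ∈ J, MemLp (D.v 0 s) 4 P) →
        FDA.IsAGP P (fun n x ω => √(n : ℝ) * (D.gammaHat p K h n x ω - D.γ x.1 x.2)) (J ×ˢ J)
          (fun _ => 0) (D.gammaStar P))) ∧
    (IsGaussianProcess (fun (s : Icc D.a D.b) => D.v 0 s) P →
      ∀ s₁ ∈ Icc D.a D.b, ∀ t₁ ∈ Icc D.a D.b, ∀ s₂ ∈ Icc D.a D.b, ∀ t₂ ∈ Icc D.a D.b,
        D.gammaStar P (s₁, t₁) (s₂, t₂) = D.γ s₁ t₂ * D.γ s₂ t₁ + D.γ s₁ s₂ * D.γ t₁ t₂) := by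
  exact ⟨fun S hS hSJ => hA.isBigOUP_estimators hD hJ hJT hh hS hSJ,
    fun hδ => ⟨hA.isAGP_etaHat hD hJ hJT hh hδ, hA.isAGP_gammaHat hD hJ hJT hh hδ⟩,
    fun hG _ hs₁ _ ht₁ _ hs₂ _ ht₂ => hD.gammaStar_eq_of_isGaussianProcess hG hs₁ ht₁ hs₂ ht₂⟩
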